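/- Let $\tilde K/k$ be a finite Galois extension with group $G\cong S_4$, let $G'\le G$ be a subgroup of order $3$, and let $K=\tilde K^{G'}$, so that $[K:k]=8$. A Hopf Galois structure on $K/k$ is a pair $(H,\mu)$, where $H$ is a finite cocommutative $k$-Hopf algebra and $\mu:H\to \mathrm{End}_k(K)$ is a Hopf action (making $K$ an $H$-module algebra) such that $K\otimes_k H\to \mathrm{End}_k(K)$, $x\otimes h\mapsto (y\mapsto x\,\mu(h)(y))$, is bijective. An isomorphism $(H_1,\mu_1)\to(H_2,\mu_2)$ is a Hopf algebra isomorphism $f:H_1\to H_2$ with $\mu_2\circ f=\mu_1$. For a sub-Hopf algebra $H'\subseteq H$ put $K^{H'}=\{x\in K: \mu(h)(x)=\varepsilon(h)x \text{ for all } h\in H'\}$; the Galois correspondence of $(H,\mu)$ is the map $H'\mapsto K^{H'}$. Let $\lambda:G\to \mathrm{Sym}(G/G')$ be the action by left translation on the left cosets. One can identify $G$ with $S_4$ in such a way that $G'=\langle(2,3,4)\rangle$, and enumerate $G/G'$ (so that $\mathrm{Sym}(G/G')=S_8$) in such a way that, for $\tau=(1,2,3,4)$ and $\sigma=(1,2)$,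 $$\lambda(\tau)=(1,2,3,4)(5,6,7,8),\qquad \lambda(\sigma)=(1,2)(3,5)(4,6)(7,8).$$ For every such identification and enumeration the following holds. Put - $r_1=(1,3)(2,4)(5,7)(6,8)$, $s_1=(1,8)(2,7)(3,6)(4,5)$, $t_1=(1,7)(2,8)(3,5)(4,6)$; - $r_2=(1,3)(2,6)(4,8)(5,7)$, $s_2=(1,4)(2,5)(3,8)(6,7)$, $t_2=t_1$; - $r_3=(1,6)(2,4)(3,8)(5,7)$, $s_3=(1,7)(2,3)(4,8)(5,6)$, $t_3=(1,8)(2,5)(3,6)(4,7)$; - $r_4=(1,3)(2,5)(4,7)(6,8)$, $s_4=(1,7)(2,6)(3,4)(5,8)$, $t_4=(1,6)(2,7)(3,8)(4,5)$; and $N_i=\langle r_i,s_i,t_i\rangle$ for $1\le i\le 4$. 1. The groups $N_1,\dots,N_4$ are pairwise distinct, each is isomorphic to $C_2\times C_2\times C_2$, and they are exactly the regular subgroups of $S_8$ normalized by $\lambda(G)$. 2. Up to isomorphism there are exactly four Hopf Galois structures on $K/k$, one for each $N_i$: the structure attached to $N_i$ has as Hopf algebra $\tilde K[N_i]^G$,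 the fixed points of $G$ in the group algebra, where $G$ acts on $\tilde K$ by field automorphisms and on $N_i$ by conjugation via $\lambda$; its action on $K$ is $\left(\sum a_n n\right)\cdot x=\sum a_n\,(n^{-1}(\overline{1_G}))(x)$, where $\overline{1_G}=G'$ and a coset $gG'$ is applied to $x\in K$ as $g(x)$. 3. Suppose that $\operatorname{char} k\ne 2$ and that $\tilde K$ is the splitting field over $k$ of a polynomial $P\in k[X]$ of degree $4$ with discriminant $\delta$. Then $P$ has a root in $K$ and $\delta$ is a square in $K$. For any root $\alpha\in K$ of $P$ and any square root $\sqrt\delta\in K$ of $\delta$, we have $K=k(\alpha,\sqrt\delta)$; the fields strictly between $k$ and $K$ are exactly $k(\alpha)$ and $k(\sqrt\delta)$, which are distinct; and the nontrivial proper subgroups $N'$ of $N_i$ normalized by $\lambda(G)$, together with the fields $K^{H'}$ fixed by the corresponding sub-Hopf algebras $H'=\tilde K[N']^G$, are $$\begin{array}{c|c|c} & N' & K^{H'}\\ \hline N_1 & \langle t_1\rangle,\ \langle r_1,s_1\rangle & k(\alpha),\ k(\sqrt\delta)\\ N_2 & \langle t_2\rangle & k(\alpha)\\ N_3 & \langle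 r_3,t_3\rangle & k(\sqrt\delta)\\ N_4 & \langle r_4,t_4\rangle & k(\sqrt\delta)\end{array}$$ The image of the Galois correspondence of the structure attached to $N_i$ consists of $k$, $K$ and the fields listed in the row of $N_i$; thus its members strictly between $k$ and $K$ are respectively $\{k(\alpha),k(\sqrt\delta)\}$, $\{k(\alpha)\}$, $\{k(\sqrt\delta)\}$ and $\{k(\sqrt\delta)\}$. -/

import Mathlib

open scoped TensorProduct IntermediateField

universe u v w w'

noncomputable section

namespace HopfGalois

/-! ### Hopf Galois structures and the Galois correspondence -/

/-- A sub-Hopf algebra of a Hopf algebra `H` over a field `k`: a subalgebra `H'` with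
`Δ(H') ⊆ H' ⊗ H'` (inside `H ⊗ H`) and `S(H') ⊆ H'`. -/
structure SubHopfAlgebra (k : Type u) (H : Type w) [Field k] [Ring H] [HopfAlgebra k H]
    extends Subalgebra k H where
  comul_mem : ∀ h ∈ toSubalgebra, Coalgebra.comul (R := k) h ∈
    LinearMap.range (TensorProduct.map toSubalgebra.val.toLinearMap toSubalgebra.val.toLinearMap)
  antipode_mem : ∀ h ∈ toSubalgebra, HopfAlgebra.antipode k h ∈ toSubalgebra

/-- A Hopf Galois structure `(H, μ)` on a field extension `K / k`: a finite cocommutative `k`-Hopf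
algebra `H` with a Hopf action `μ` on `K` (so `K` is an `H`-module algebra) such that
`K ⊗ H → End_k(K)`, `x ⊗ h ↦ (y ↦ x * μ(h)(y))`, is bijective. -/
structure HopfGaloisStructure (k : Type u) (K : Type v) [Field k] [Field K] [Algebra k K] where
  /-- The underlying Hopf algebra. -/
  H : Type w
  [ring : Ring H]
  [hopf : HopfAlgebra k H]
  [finite : Module.Finite k H]
  [cocomm : Coalgebra.IsCocomm k H]
  /-- The action of `H` on `K`. -/
  μ : H →ₐ[k] Module.End k K
  /-- `h(x y) = ∑ h₁(x) h₂(y)` -/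
  map_mul : ∀ (h : H) (x y : K), μ h (x * y) =
    LinearMap.mul' k K (TensorProduct.map (μ.toLinearMap.flip x) (μ.toLinearMap.flip y)
      (Coalgebra.comul (R := k) h))
  /-- `h(1) = ε(h) 1` -/
  map_one : ∀ h : H, μ h 1 = algebraMap k K (Coalgebra.counit (R := k) h)
  bijective : Function.Bijective (TensorProduct.lift
    ((LinearMap.mul k (Module.End k K)).compl₁₂ (Algebra.lmul k K).toLinearMap μ.toLinearMap))

attribute [instance] HopfGaloisStructure.ring HopfGaloisStructure.hopf
  HopfGaloisStructure.finite HopfGaloisStructure.cocomm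

namespace HopfGaloisStructure

variable {k : Type u} {K : Type v} [Field k] [Field K] [Algebra k K]

/-- Isomorphism of Hopf Galois structures: a Hopf algebra isomorphism `f` with `μ₂ ∘ f = μ₁`
(bialgebra isomorphisms of Hopf algebras automatically respect the antipodes). -/
def IsIso (S : HopfGaloisStructure.{u, v, w} k K) (T : HopfGaloisStructure.{u, v, w'} k K) : Prop :=
  ∃ f : S.H ≃ₐc[k] T.H, ∀ h : S.H, T.μ (f h) = S.μ h

/-- The field `K^{H'} = {x ∈ K ∣ μ(h)(x) = ε(h) x for all h ∈ H'}` attached to a sub-Hopf algebra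
`H'`; the map `H' ↦ K^{H'}` is the Galois correspondence of the Hopf Galois structure. -/
def fixedField [Algebra.IsAlgebraic k K] (S : HopfGaloisStructure.{u, v, w} k K)
    (H' : SubHopfAlgebra k S.H) : IntermediateField k K :=
  Subalgebra.toIntermediateField'
    { carrier := {x | ∀ h ∈ H'.toSubalgebra, S.μ h x = Coalgebra.counit (R := k) h • x}
      add_mem' := fun {x y} hx hy h hh => by
        rw [_root_.map_add, hx h hh, hy h hh, smul_add]
      algebraMap_mem' := fun c h _ => by
        rw [Algebra.algebraMap_eq_smul_one, map_smul, S.map_one, Algebra.algebraMap_eq_smul_one,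
          smul_comm]
      mul_mem' := fun {x y} hx hy h hh => by
        have key : ∀ z : H'.toSubalgebra ⊗[k] H'.toSubalgebra,
            LinearMap.mul' k K (TensorProduct.map (S.μ.toLinearMap.flip x) (S.μ.toLinearMap.flip y)
              (TensorProduct.map H'.toSubalgebra.val.toLinearMap
                H'.toSubalgebra.val.toLinearMap z)) =
            LinearMap.mul' k k (TensorProduct.map (Coalgebra.counit (R := k) (A := S.H))
              (Coalgebra.counit (R := k) (A := S.H))
              (TensorProduct.map H'.toSubalgebra.val.toLinearMap
                H'.toSubalgebra.val.toLinearMap z)) • (x * y) := by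
          intro z
          induction z with
          | zero => simp
          | add a b ha hb => simp only [_root_.map_add, ha, hb, add_smul]
          | tmul a b =>
            have h1 := hx a.1 a.2
            have h2 := hy b.1 b.2
            simp only [TensorProduct.map_tmul, LinearMap.mul'_apply, LinearMap.flip_apply,
              AlgHom.toLinearMap_apply, Subalgebra.coe_val, h1, h2, smul_mul_smul_comm]
        obtain ⟨z, hz⟩ := H'.comul_mem h hh
        have hc : LinearMap.mul' k k (TensorProduct.map (Coalgebra.counit (R := k) (A := S.H))
            (Coalgebra.counit (R := k) (A := S.H)) (Coalgebra.comul (R := k) h)) =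
            Coalgebra.counit (R := k) h := by
          have h3 := congrArg (LinearMap.lTensor k (Coalgebra.counit (R := k) (A := S.H)))
            (Coalgebra.rTensor_counit_comul (R := k) h)
          rw [← LinearMap.comp_apply, LinearMap.lTensor_comp_rTensor] at h3
          rw [h3]
          simp
        rw [S.map_mul, ← hz, key, hz, hc] }
    (Subalgebra.isField_of_algebraic _)

end HopfGaloisStructure

/-! ### The Greither-Pareigis description -/

section GreitherPareigis

variable {k : Type u} {Kt : Type v} [Field k] [Field Kt] [Algebra k Kt]
variable {G' : Subgroup Gal(Kt/k)} {X : Type} (e : Gal(Kt/k) ⧸ G' ≃ X)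

/-- The morphism `λ : G → Sym(G/G')`, where `Sym(G/G')` is identified with the symmetric group
of `X` through an enumeration `e` of the cosets. -/
def leftTranslation : Gal(Kt/k) →* Equiv.Perm X :=
  e.permCongrHom.toMonoidHom.comp (MulAction.toPermHom Gal(Kt/k) (Gal(Kt/k) ⧸ G'))

/-- `N` is a regular (simply transitive) subgroup of the symmetric group of `X`. -/
def IsRegular {X : Type} (N : Subgroup (Equiv.Perm X)) : Prop :=
  ∀ x y : X, ∃! π : Equiv.Perm X, π ∈ N ∧ π x = y

/-- `N` is normalized by `λ(G)`. -/
def IsNormalized (N : Subgroup (Equiv.Perm X)) : Prop :=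
  (leftTranslation e).range ≤ Subgroup.normalizer (N : Set (Equiv.Perm X))

/-- `g(x) ∈ Kt` for a coset `gG'` and an element `x` of the fixed field of `G'`. -/
def cosetApply (c : Gal(Kt/k) ⧸ G') (x : IntermediateField.fixedField G') : Kt :=
  Quotient.liftOn' c (fun g => g (x : Kt)) (by
    intro a b hab
    have h := x.2 ⟨a⁻¹ * b, QuotientGroup.leftRel_apply.mp hab⟩
    have h' : (a⁻¹ * b) (x : Kt) = x := h
    calc a (x : Kt) = a ((a⁻¹ * b) (x : Kt)) := by rw [h']
      _ = (a * (a⁻¹ * b)) (x : Kt) := rfl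
      _ = b (x : Kt) := by rw [mul_inv_cancel_left])

/-- `Kt[N]^G`, inside the group algebra `Kt[Sym X]`: the elements supported on `N` that are fixed
under `G`, acting on `Kt` by field automorphisms and on permutations by conjugation via `λ`. -/
def fixedGroupAlgebra (N : Subgroup (Equiv.Perm X)) : Set (MonoidAlgebra Kt (Equiv.Perm X)) :=
  {a | (∀ π, π ∉ N → a.coeff π = 0) ∧
    ∀ (g : Gal(Kt/k)) (π : Equiv.Perm X),
      a.coeff (leftTranslation e g * π * (leftTranslation e g)⁻¹) = g (a.coeff π)}

/-- An identification of a Hopf Galois structure `(H, μ)` on `K = Kt^{G'}` with the one attached to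
`N`: an isomorphism `ι` of `H` onto `Kt[N]^G`, compatible with the Hopf algebra structure of the
group algebra, under which the action is `(∑ aₙ n) x = ∑ aₙ (n⁻¹(1̄))(x)`. -/
structure Realization (N : Subgroup (Equiv.Perm X))
    (S : HopfGaloisStructure.{u, v, w} k (IntermediateField.fixedField G')) where
  /-- The isomorphism of `H` onto `Kt[N]^G`. -/
  ι : S.H →ₐ[k] MonoidAlgebra Kt (Equiv.Perm X)
  injective : Function.Injective ι
  range_eq : Set.range ι = fixedGroupAlgebra e N
  /-- The right-hand side is the image of `Δ(h)` in `Kt[Sym X] ⊗ Kt[Sym X]` (over `Kt`). -/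
  comul_eq : ∀ h : S.H, Coalgebra.comul (R := Kt) (ι h) =
    TensorProduct.mapOfCompatibleSMul Kt k k
      (MonoidAlgebra Kt (Equiv.Perm X)) (MonoidAlgebra Kt (Equiv.Perm X))
      (TensorProduct.map ι.toLinearMap ι.toLinearMap (Coalgebra.comul (R := k) h))
  counit_eq : ∀ h : S.H, Coalgebra.counit (R := Kt) (ι h) =
    algebraMap k Kt (Coalgebra.counit (R := k) h)
  action_eq : ∀ (h : S.H) (x : IntermediateField.fixedField G'),
    ((S.μ h x : IntermediateField.fixedField G') : Kt) =
      (ι h).coeff.sum fun π a =>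
        a * cosetApply (e.symm (π⁻¹ (e ((1 : Gal(Kt/k)) : Gal(Kt/k) ⧸ G')))) x

/-- The Galois correspondence of a Hopf Galois structure `S` attached to `N` is described by a table
of pairs (stable subgroup, fixed field): the nontrivial proper `λ(G)`-stable subgroups of `N` are
exactly the first entries, the field fixed by the sub-Hopf algebra `Kt[N']^G` is the second entry,
and the image of the correspondence consists of `k`, `K` and the second entries. -/
def HasGaloisTable [FiniteDimensional k Kt] {N : Subgroup (Equiv.Perm X)}
    {S : HopfGaloisStructure.{u, v, w} k (IntermediateField.fixedField G')}
    (R : Realization e N S)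
    (rows : Set (Subgroup (Equiv.Perm X) ×
      IntermediateField k (IntermediateField.fixedField G'))) : Prop :=
  {N' : Subgroup (Equiv.Perm X) | N' ≤ N ∧ N' ≠ ⊥ ∧ N' ≠ N ∧ IsNormalized e N'} =
      Prod.fst '' rows ∧
    (∀ r ∈ rows, ∃ H' : SubHopfAlgebra k S.H,
      R.ι '' (H'.toSubalgebra : Set S.H) = fixedGroupAlgebra e r.1 ∧ S.fixedField H' = r.2) ∧
    Set.range S.fixedField = {⊥, ⊤} ∪ Prod.snd '' rows

end GreitherPareigis

/-! ### The four subgroups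

Points of `{1, …, 8}` (resp. `{1, …, 4}`) are written as elements of `Fin 8` (resp. `Fin 4`), read
modulo `8` (resp. `4`), so that the point `8` (resp. `4`) is the element `0`. -/

open Equiv in
/-- The permutation `(a, b)(c, d)(e, f)(g, h)`. -/
def transp (a b c d e f g h : Fin 8) : Perm (Fin 8) :=
  swap a b * swap c d * swap e f * swap g h

/-- `r₁, r₂, r₃, r₄` (indexed by `0, 1, 2, 3`) -/
def r : Fin 4 → Equiv.Perm (Fin 8) :=
  ![transp 1 3 2 4 5 7 6 8, transp 1 3 2 6 4 8 5 7, transp 1 6 2 4 3 8 5 7, transp 1 3 2 5 4 7 6 8]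

/-- `s₁, s₂, s₃, s₄` -/
def s : Fin 4 → Equiv.Perm (Fin 8) :=
  ![transp 1 8 2 7 3 6 4 5, transp 1 4 2 5 3 8 6 7, transp 1 7 2 3 4 8 5 6, transp 1 7 2 6 3 4 5 8]

/-- `t, t, t₃, t₄` -/
def t : Fin 4 → Equiv.Perm (Fin 8) :=
  ![transp 1 7 2 8 3 5 4 6, transp 1 7 2 8 3 5 4 6, transp 1 8 2 5 3 6 4 7, transp 1 6 2 7 3 8 4 5]

/-- `N₁, N₂, N₃, N₄`, with `Nᵢ = ⟨rᵢ, sᵢ, tᵢ⟩` -/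
def N (i : Fin 4) : Subgroup (Equiv.Perm (Fin 8)) := Subgroup.closure {r i, s i, t i}

/-- An identification `φ` of `G` with `S₄` and an enumeration `e` of `G/G'` are admissible if
`G' = ⟨(2,3,4)⟩` and, for `τ = (1,2,3,4)`, `σ = (1,2)`, one has `λ(τ) = (1,2,3,4)(5,6,7,8)` and
`λ(σ) = (1,2)(3,5)(4,6)(7,8)`. -/
structure IsAdmissible {k : Type u} {Kt : Type v} [Field k] [Field Kt] [Algebra k Kt]
    {G' : Subgroup Gal(Kt/k)} (φ : Gal(Kt/k) ≃* Equiv.Perm (Fin 4))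
    (e : Gal(Kt/k) ⧸ G' ≃ Fin 8) : Prop where
  map_eq : G'.map φ.toMonoidHom = Subgroup.zpowers c[2, 3, 4]
  tau_eq : leftTranslation e (φ.symm c[1, 2, 3, 4]) = c[1, 2, 3, 4] * c[5, 6, 7, 8]
  sigma_eq : leftTranslation e (φ.symm c[1, 2]) = transp 1 2 3 5 4 6 7 8

end HopfGalois

end

open scoped TensorProduct IntermediateField

noncomputable section

set_option linter.unusedSectionVars false

/-! The mechanism is Greither-Pareigis theory, proved here in coordinates. Write `K = Kt^{G'}` and
`X = G/G'`. The cosets give embeddings `K → Kt`, and by Dedekind and a dimension count these form a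
`Kt`-basis of `Hom_k(K, Kt)`. After extension of scalars a Hopf Galois structure becomes the group
algebra of a group permuting this basis simply transitively, and descent to `k` amounts to stability
under conjugation by `λ(G)`.

From groups to structures: an element of `Kt[N]^G` is a `G`-equivariant function on permutations
supported on `N`. Averaging over the Galois group gives both halves of descent
(`linearIndependent_of_mem_equivariant`, `mem_of_mem_span`). The tensor square embeds into functions
on pairs by `pairing`, where the comultiplication is extension by zero off the diagonal. Hence every
Hopf identity is checked on values.

From structures to groups: expand `emb c ∘ μ h` in the basis of embeddings and call the coefficients
the row of `c`. The module algebra axiom makes each row a coalgebra map, and bijectivity of `K ⊗ H →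
End_k(K)` makes the rows span. Passing from one row to another is therefore a 0-1 matrix
(`coord_mul_coord`), that is, a self-map of `X` for each group-like element. Multiplicativity,
regularity and stability of the resulting `permGroup` follow, and `Realization.eq_permGroup` and
`Realization.isIso` make structure and group determine each other.

Sub-Hopf algebras correspond to stable subgroups `N'` through supports, because contracting one leg
of `Δ h` isolates each group element occurring in `h`. The fixed field consists of the `x` on which
the embeddings `π⁻¹(1̄)`, `π ∈ N'`, agree with the inclusion (`mem_fixedField_iff`).

What remains is finite. In a stable regular group, the elements taking `1` to `7` and to `0`
determine everything by conjugation with `λ((2,3,4))`, and a search over `3 · 8³` tables leaves the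
four `Nᵢ` (`exists_eq_N`). Their stable subgroups are invariant subspaces of `𝔽₂³`. Strictly between
`C₃` and `S₄` lie only a point stabilizer and `A₄`, which belong to `k(α)` and `k(√δ)`. One
nontrivial element of `N'` then suffices to tell which of the two fields is fixed
(`mem_iff_forall_emb`). -/

namespace HopfGalois

/-! ### Galois descent for equivariant functions -/

section Descent

variable {k : Type u} {L : Type v} [Field k] [Field L] [Algebra k L]
variable {I : Type*} {J : Type*}

/-- The functions `f : I → L` which are equivariant for the action of the Galois group on `L` and
an action `ρ` on `I`. -/
def equivariant (ρ : Gal(L/k) →* Equiv.Perm I) : Submodule k (I → L) where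
  carrier := {f | ∀ g i, f (ρ g i) = g (f i)}
  add_mem' hf hf' g i := by simp [hf g i, hf' g i]
  zero_mem' g i := by simp
  smul_mem' c f hf g i := by simp [hf g i]

variable [FiniteDimensional k L] (ρ : Gal(L/k) →* Equiv.Perm I)

/-- The average of a function over the Galois group. -/
def average (f : I → L) : I → L := fun i => ∑ g : Gal(L/k), g (f (ρ g⁻¹ i))

theorem average_mem (f : I → L) : average ρ f ∈ equivariant ρ := by
  intro g i
  rw [average, average, map_sum]
  refine Fintype.sum_equiv (Equiv.mulLeft g⁻¹) _ _ fun h => ?_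
  simp [mul_inv_rev, ← AlgEquiv.mul_apply]

theorem average_add (f f' : I → L) : average ρ (f + f') = average ρ f + average ρ f' := by
  ext i
  simp [average, Finset.sum_add_distrib]

/-- An equivariant `f` pulls out of the average and leaves the sum of the conjugates of `y`. Both
descent statements below rest on this trace. -/
theorem average_smul_of_mem [IsGalois k L] {f : I → L} (hf : f ∈ equivariant ρ) (y : L) :
    average ρ (y • f) = Algebra.trace k L y • f := by
  ext i
  rw [Pi.smul_apply, Algebra.smul_def (Algebra.trace k L y) (f i), trace_eq_sum_automorphisms,
    Finset.sum_mul, average]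
  refine Finset.sum_congr rfl fun g _ => ?_
  rw [Pi.smul_apply, smul_eq_mul, map_mul, ← hf g, ← Equiv.Perm.mul_apply, ← map_mul,
    mul_inv_cancel, map_one, Equiv.Perm.one_apply]

/-- A functional `φ` killing all these averages satisfies `∑ g, φ (δ_{g i}) * g y = 0` for every
`y`. Dedekind independence of the automorphisms kills each coefficient, and the one at `g = 1` is `φ
(δ_i)`. -/
theorem single_mem_span_average [DecidableEq I] (i : I) : Pi.single i (1 : L) ∈
    Submodule.span L (Set.range fun y : L => average ρ (Pi.single i y)) := by
  by_contra h
  obtain ⟨φ, hφ, hle⟩ := Submodule.exists_le_ker_of_notMem h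
  have key : ∀ y : L, ∑ g : Gal(L/k), φ (Pi.single (ρ g i) 1) * g y = 0 := by
    intro y
    have h1 : φ (average ρ (Pi.single i y)) = 0 := hle (Submodule.subset_span ⟨y, rfl⟩)
    have h2 : average ρ (Pi.single i y) = ∑ g : Gal(L/k), g y • Pi.single (ρ g i) (1 : L) := by
      ext j
      rw [average, Finset.sum_apply]
      refine Finset.sum_congr rfl fun g _ => ?_
      rw [Pi.smul_apply, map_inv, smul_eq_mul]
      by_cases hj : j = ρ g i
      · simp [hj]
      · have : (ρ g)⁻¹ j ≠ i := fun h => hj (by rw [← h]; simp)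
        rw [Pi.single_eq_of_ne this, Pi.single_eq_of_ne hj, map_zero, mul_zero]
    rw [h2, map_sum] at h1
    rw [← h1]
    exact Finset.sum_congr rfl fun g _ => by rw [map_smul, smul_eq_mul, mul_comm]
  have hind := (linearIndependent_toLinearMap k L L).comp
    (fun g : Gal(L/k) => (g : L →ₐ[k] L)) (fun g h hgh => by
      ext y; exact DFunLike.congr_fun hgh y)
  rw [Fintype.linearIndependent_iff] at hind
  have := hind (fun g => φ (Pi.single (ρ g i) 1)) (by ext y; simpa using key y) 1
  exact hφ (by simpa using this)

theorem average_single_apply_eq_zero [DecidableEq I] {i j : I} (y : L) (h : ∀ g, ρ g i ≠ j) :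
    average ρ (Pi.single i y) j = 0 := by
  refine Finset.sum_eq_zero fun g _ => ?_
  rw [Pi.single_eq_of_ne, map_zero]
  rintro rfl
  exact h g (by simp)

/-- Multiply a relation `∑ z j • b j = 0` by an arbitrary `y` and average: the coefficients become
`Tr(y * z j)` in `k`, so they vanish, and the trace form is nondegenerate. -/
theorem linearIndependent_of_mem_equivariant [IsGalois k L] {ι : Type*} {b : ι → I → L}
    (hb : LinearIndependent k b) (hmem : ∀ j, b j ∈ equivariant ρ) : LinearIndependent L b := by
  classical
  rw [linearIndependent_iff'] at hb ⊢
  intro s z hz j hj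
  refine (traceForm_nondegenerate k L).1 (z j) fun y => ?_
  rw [Algebra.traceForm_apply, mul_comm]
  refine hb s (fun j => Algebra.trace k L (y * z j)) ?_ j hj
  have h1 : ∀ s : Finset ι, ∑ j ∈ s, Algebra.trace k L (y * z j) • b j =
      average ρ (∑ j ∈ s, (y * z j) • b j) := by
    intro s
    induction s using Finset.induction_on with
    | empty => ext; simp [average]
    | insert a s ha ih =>
      rw [Finset.sum_insert ha, Finset.sum_insert ha, average_add, ih,
        average_smul_of_mem ρ (hmem a)]
  rw [h1]
  simp_rw [mul_smul, ← Finset.smul_sum, hz]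
  ext; simp [average]

/-- For `f` in the `L`-span of `S`, every average of `y • f` already lies in `S`. When `Tr y = 1`
and `f` is equivariant, that average is `f` itself. -/
theorem mem_of_mem_span [IsGalois k L] {S : Submodule k (I → L)} (hS : S ≤ equivariant ρ)
    {f : I → L} (hf : f ∈ equivariant ρ) (hfS : f ∈ Submodule.span L (S : Set (I → L))) :
    f ∈ S := by
  have key : ∀ f ∈ Submodule.span L (S : Set (I → L)), ∀ y : L, average ρ (y • f) ∈ S := by
    intro f hf
    induction hf using Submodule.span_induction with
    | mem x hx =>
      intro y
      rw [average_smul_of_mem ρ (hS hx)]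
      exact S.smul_mem _ hx
    | zero =>
      intro y
      have : average ρ (y • (0 : I → L)) = 0 := by ext; simp [average]
      rw [this]
      exact S.zero_mem
    | add x x' _ _ hx hx' =>
      intro y
      rw [smul_add, average_add]
      exact S.add_mem (hx y) (hx' y)
    | smul a x _ hx =>
      intro y
      rw [smul_smul]
      exact hx _
  obtain ⟨y, hy⟩ := Algebra.trace_surjective k L 1
  have := key f hfS y
  rwa [average_smul_of_mem ρ hf, hy, one_smul] at this

end Descent

/-! ### Tensor products as functions on pairs -/

section Pairing

variable {k : Type u} {L : Type v} [Field k] [Field L] [Algebra k L]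
variable {I J : Type*} {V : Type w} {W : Type w'} [AddCommGroup V] [Module k V] [AddCommGroup W] [Module k W]

/-- The `k`-linear map `V ⊗ W → (I × J → L)`, `v ⊗ w ↦ ((i, j) ↦ E v i * F w j)`. -/
def pairing (E : V →ₗ[k] I → L) (F : W →ₗ[k] J → L) : V ⊗[k] W →ₗ[k] I × J → L :=
  LinearMap.pi fun p => LinearMap.mul' k L ∘ₗ
    TensorProduct.map (LinearMap.proj p.1 ∘ₗ E) (LinearMap.proj p.2 ∘ₗ F)

@[simp]
theorem pairing_tmul (E : V →ₗ[k] I → L) (F : W →ₗ[k] J → L) (v : V) (w : W) (p : I × J) :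
    pairing E F (v ⊗ₜ w) p = E v p.1 * F w p.2 := rfl

/-- `E` sends some `k`-basis to `L`-linearly independent functions; equivalently, its `L`-linear
extension to `L ⊗ V` is injective. -/
def IsFormInjective {V : Type w} [AddCommGroup V] [Module k V] (E : V →ₗ[k] I → L) : Prop :=
  ∃ (ι : Type w) (b : Module.Basis ι k V), LinearIndependent L (E ∘ b)

theorem IsFormInjective.injective {E : V →ₗ[k] I → L} (hE : IsFormInjective E) :
    Function.Injective E := by
  obtain ⟨ι, b, hb⟩ := hE
  rw [← LinearMap.ker_eq_bot, LinearMap.ker_eq_bot']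
  intro v hv
  have h := linearIndependent_iff.1 (hb.restrict_scalars' k) (b.repr v) (by
    rw [← Finsupp.apply_linearCombination, b.linearCombination_repr, hv])
  simpa using h

theorem isFormInjective_of_mem_equivariant [FiniteDimensional k L] [IsGalois k L]
    (ρ : Gal(L/k) →* Equiv.Perm I) {E : V →ₗ[k] I → L} (hE : Function.Injective E)
    (hmem : ∀ v, E v ∈ equivariant ρ) : IsFormInjective E :=
  ⟨_, Module.Basis.ofVectorSpace k V, linearIndependent_of_mem_equivariant ρ
    ((Module.Basis.ofVectorSpace k V).linearIndependent.map' E (LinearMap.ker_eq_bot.2 hE))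
    fun _ => hmem _⟩

/-- Separation of variables: for fixed `p`, a relation is one among the `F (c j)`, and the vanishing
of its coefficients for all `p` is a relation among the `E (b i)`. This is what allows identities in
tensor products to be verified on values. -/
theorem IsFormInjective.pairing {E : V →ₗ[k] I → L} {F : W →ₗ[k] J → L}
    (hE : IsFormInjective E) (hF : IsFormInjective F) : IsFormInjective (pairing E F) := by
  classical
  obtain ⟨ι, b, hb⟩ := hE
  obtain ⟨κ, c, hc⟩ := hF
  refine ⟨ι × κ, b.tensorProduct c, ?_⟩
  rw [linearIndependent_iff''] at hb hc ⊢
  intro s z hz hsum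
  have h0 : ∑ i ∈ s.image Prod.fst, ∑ j ∈ s.image Prod.snd,
      z (i, j) • (HopfGalois.pairing E F ∘ b.tensorProduct c) (i, j) = 0 := by
    rw [← Finset.sum_product', ← hsum]
    exact (Finset.sum_subset Finset.subset_product fun p _ hp => by rw [hz p hp, zero_smul]).symm
  have h1 : ∀ p, ∀ j, ∑ i ∈ s.image Prod.fst, z (i, j) * E (b i) p = 0 := by
    intro p
    refine hc (s.image Prod.snd) (fun j => ∑ i ∈ s.image Prod.fst, z (i, j) * E (b i) p) ?_ ?_
    · intro j hj
      refine Finset.sum_eq_zero fun i _ => ?_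
      rw [hz (i, j) fun h => hj (Finset.mem_image_of_mem Prod.snd h), zero_mul]
    · ext q
      have := congrFun h0 (p, q)
      simp only [Finset.sum_apply, Pi.smul_apply, Function.comp_apply,
        Module.Basis.tensorProduct_apply, pairing_tmul, smul_eq_mul, Pi.zero_apply] at this ⊢
      rw [← this, Finset.sum_comm]
      refine Finset.sum_congr rfl fun j _ => ?_
      rw [Finset.sum_mul]
      exact Finset.sum_congr rfl fun i _ => by ring
  rintro ⟨i, j⟩
  refine hb (s.image Prod.fst) (fun i => z (i, j)) (fun i hi => ?_) ?_ i
  · exact hz _ fun h => hi (Finset.mem_image_of_mem Prod.fst h)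
  · ext p
    simpa using h1 p j

end Pairing

/-! ### The embeddings of `K` into `Kt` indexed by cosets -/

section Embeddings

variable {k : Type u} {Kt : Type v} [Field k] [Field Kt] [Algebra k Kt]
variable {G' : Subgroup Gal(Kt/k)} {X : Type} (e : Gal(Kt/k) ⧸ G' ≃ X)

@[simp]
theorem cosetApply_mk (g : Gal(Kt/k)) (y : IntermediateField.fixedField G') :
    cosetApply (g : Gal(Kt/k) ⧸ G') y = g (y : Kt) := rfl

/-- The embedding of `Kt^{G'}` into `Kt` given by the coset with number `x`. -/
def emb (x : X) : IntermediateField.fixedField G' →ₐ[k] Kt where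
  toFun y := cosetApply (e.symm x) y
  map_one' := by induction e.symm x using QuotientGroup.induction_on; simp
  map_mul' a b := by induction e.symm x using QuotientGroup.induction_on; simp
  map_zero' := by induction e.symm x using QuotientGroup.induction_on; simp
  map_add' a b := by induction e.symm x using QuotientGroup.induction_on; simp
  commutes' a := by
    induction e.symm x using QuotientGroup.induction_on with
    | H g => exact g.commutes a

/-- The number of the trivial coset. -/
def basePoint : X := e ((1 : Gal(Kt/k)) : Gal(Kt/k) ⧸ G')

theorem emb_apply (x : X) (y : IntermediateField.fixedField G') :
    emb e x y = cosetApply (e.symm x) y := rfl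

theorem emb_mk (g : Gal(Kt/k)) (y : IntermediateField.fixedField G') :
    emb e (e (g : Gal(Kt/k) ⧸ G')) y = g (y : Kt) := by
  rw [emb_apply, e.symm_apply_apply, cosetApply_mk]

@[simp]
theorem emb_basePoint (y : IntermediateField.fixedField G') : emb e (basePoint e) y = y :=
  emb_mk e 1 y

theorem leftTranslation_mk (g h : Gal(Kt/k)) :
    leftTranslation e g (e (h : Gal(Kt/k) ⧸ G')) = e ((g * h : Gal(Kt/k)) : Gal(Kt/k) ⧸ G') := by
  change e (g • e.symm (e (h : Gal(Kt/k) ⧸ G'))) = _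
  rw [e.symm_apply_apply]
  rfl

theorem exists_mk_eq (x : X) : ∃ g : Gal(Kt/k), e (g : Gal(Kt/k) ⧸ G') = x := by
  obtain ⟨g, hg⟩ := QuotientGroup.mk_surjective (e.symm x)
  exact ⟨g, by rw [hg, e.apply_symm_apply]⟩

theorem leftTranslation_basePoint (g : Gal(Kt/k)) :
    leftTranslation e g (basePoint e) = e (g : Gal(Kt/k) ⧸ G') := by
  rw [basePoint, leftTranslation_mk, mul_one]

theorem exists_leftTranslation_basePoint (x : X) :
    ∃ g : Gal(Kt/k), leftTranslation e g (basePoint e) = x := by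
  simp_rw [leftTranslation_basePoint]
  exact exists_mk_eq e x

theorem leftTranslation_basePoint_eq_iff (g : Gal(Kt/k)) :
    leftTranslation e g (basePoint e) = basePoint e ↔ g ∈ G' := by
  rw [leftTranslation_basePoint, basePoint, e.apply_eq_iff_eq, eq_comm, QuotientGroup.eq]
  simp

theorem apply_emb (g : Gal(Kt/k)) (x : X) (y : IntermediateField.fixedField G') :
    g (emb e x y) = emb e (leftTranslation e g x) y := by
  obtain ⟨h, rfl⟩ := exists_mk_eq e x
  rw [leftTranslation_mk, emb_mk, emb_mk, AlgEquiv.mul_apply]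

variable [FiniteDimensional k Kt]

theorem emb_injective [IsGalois k Kt] : Function.Injective (emb e) := by
  intro x x' h
  obtain ⟨g, rfl⟩ := exists_mk_eq e x
  obtain ⟨g', rfl⟩ := exists_mk_eq e x'
  rw [e.apply_eq_iff_eq, QuotientGroup.eq, ← IntermediateField.fixingSubgroup_fixedField G',
    IntermediateField.mem_fixingSubgroup_iff]
  intro y hy
  have := DFunLike.congr_fun h ⟨y, hy⟩
  rw [emb_mk, emb_mk] at this
  change g y = g' y at this
  rw [AlgEquiv.mul_apply, ← this, ← AlgEquiv.mul_apply, inv_mul_cancel, AlgEquiv.one_apply]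

theorem linearIndependent_emb [IsGalois k Kt] :
    LinearIndependent Kt fun x => (emb e x).toLinearMap :=
  (linearIndependent_toLinearMap k (IntermediateField.fixedField G') Kt).comp _ (emb_injective e)

theorem card_eq_finrank [IsGalois k Kt] [Fintype X] (e : Gal(Kt/k) ⧸ G' ≃ X) :
    Fintype.card X = Module.finrank k (IntermediateField.fixedField G') := by
  have h1 : Nat.card G' * Module.finrank k (IntermediateField.fixedField G') = Nat.card Gal(Kt/k) := by
    rw [IsGalois.card_aut_eq_finrank, ← Module.finrank_mul_finrank k
      (IntermediateField.fixedField G') Kt, IntermediateField.finrank_fixedField_eq_card, mul_comm]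
  have h2 := Subgroup.card_mul_index G'
  rw [← h1] at h2
  rw [← Nat.eq_of_mul_eq_mul_left Nat.card_pos h2, Subgroup.index, Nat.card_congr e,
    Nat.card_eq_fintype_card]

variable [IsGalois k Kt] [Fintype X]

/-- The embeddings of `Kt^{G'}` into `Kt` form a `Kt`-basis of the space of `k`-linear maps. -/
def embBasis : Module.Basis X Kt (IntermediateField.fixedField G' →ₗ[k] Kt) :=
  haveI : Nonempty X := ⟨basePoint e⟩
  basisOfLinearIndependentOfCardEqFinrank (linearIndependent_emb e) (by
    rw [card_eq_finrank e, Module.finrank_linearMap_self])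

@[simp]
theorem embBasis_apply (x : X) : embBasis e x = (emb e x).toLinearMap := by
  simp [embBasis]

end Embeddings

/-! ### Coordinates on group algebras -/

section GroupAlgebra

variable {k : Type u} {L : Type v} [Field k] [Field L] [Algebra k L]
variable {P : Type*} {V : Type w} [AddCommGroup V] [Module k V]

/-- The family of coefficients of a linear map into a group algebra. -/
def coeffs (ι : V →ₗ[k] MonoidAlgebra L P) : V →ₗ[k] P → L where
  toFun v := (ι v).coeff
  map_add' _ _ := by rw [map_add]; rfl
  map_smul' _ _ := by rw [map_smul]; rfl

@[simp]
theorem coeffs_apply (ι : V →ₗ[k] MonoidAlgebra L P) (v : V) (p : P) :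
    coeffs ι v p = (ι v).coeff p := rfl

theorem coeffs_injective {ι : V →ₗ[k] MonoidAlgebra L P} (hι : Function.Injective ι) :
    Function.Injective (coeffs ι) := fun _ _ h =>
  hι (MonoidAlgebra.ext (DFunLike.ext _ _ (congrFun h)))

variable [DecidableEq P]

/-- The function on `P × P` supported on the diagonal with the values of `f` there. -/
def diag : (P → L) →ₗ[k] P × P → L where
  toFun f p := if p.1 = p.2 then f p.1 else 0
  map_add' _ _ := by ext p; simp only [Pi.add_apply]; split_ifs <;> simp
  map_smul' _ _ := by ext p; simp only [Pi.smul_apply]; split_ifs <;> simp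

theorem diag_apply (f : P → L) (p q : P) :
    diag (k := k) f (p, q) = if p = q then f p else 0 := rfl

theorem pairing_coeffs_comul (a : MonoidAlgebra L P) :
    pairing (coeffs (LinearMap.id (R := L) (M := MonoidAlgebra L P))) (coeffs LinearMap.id)
      (Coalgebra.comul (R := L) a) = diag (k := L) a.coeff := by
  induction a using MonoidAlgebra.induction_linear with
  | zero => ext; simp
  | add a b ha hb =>
    rw [map_add, map_add, ha, hb, ← map_add]
    rfl
  | single p c =>
    ext ⟨q, r⟩
    simp [diag_apply, Finsupp.single_apply]
    grind

/-- Since `Δ(p) = p ⊗ p` for group elements, the coordinates of `Δ(a)` live on the diagonal. This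
replaces an equation in a tensor product over `L` by one between functions on `P × P`, where the
element `z` over `k` can be compared. -/
theorem comul_eq_iff (ι : V →ₗ[k] MonoidAlgebra L P) (z : V ⊗[k] V) (a : MonoidAlgebra L P) :
    Coalgebra.comul (R := L) a = TensorProduct.mapOfCompatibleSMul L k k (MonoidAlgebra L P)
      (MonoidAlgebra L P) (TensorProduct.map ι ι z) ↔
    pairing (coeffs ι) (coeffs ι) z = diag (k := k) a.coeff := by
  have hinj : Function.Injective (pairing (coeffs (LinearMap.id (R := L) (M := MonoidAlgebra L P)))
      (coeffs (LinearMap.id (R := L) (M := MonoidAlgebra L P)))) := by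
    have h : IsFormInjective (coeffs (LinearMap.id (R := L) (M := MonoidAlgebra L P))) :=
      ⟨_, Module.Basis.ofVectorSpace L _, (Module.Basis.ofVectorSpace L _).linearIndependent.map' _
        (LinearMap.ker_eq_bot.2 (coeffs_injective Function.injective_id))⟩
    exact (h.pairing h).injective
  rw [← hinj.eq_iff, pairing_coeffs_comul, eq_comm]
  have h2 : pairing (coeffs (LinearMap.id (R := L) (M := MonoidAlgebra L P)))
      (coeffs (LinearMap.id (R := L) (M := MonoidAlgebra L P)))
      (TensorProduct.mapOfCompatibleSMul L k k (MonoidAlgebra L P)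
      (MonoidAlgebra L P) (TensorProduct.map ι ι z)) = pairing (coeffs ι) (coeffs ι) z := by
    induction z with
    | zero => simp
    | add z z' hz hz' => simp only [map_add, hz, hz']
    | tmul v w => rfl
  rw [h2]
  rfl

end GroupAlgebra

/-! ### Coalgebra and Hopf structures on forms of group algebras -/

section FormCoalgebra

variable {k : Type u} {L : Type v} [Field k] [Field L] [Algebra k L]
variable {P : Type*} {V : Type w} [AddCommGroup V] [Module k V]

theorem pairing_assoc_tmul (E : V →ₗ[k] P → L) (z : V ⊗[k] V) (v : V) (p q r : P) :
    pairing E (pairing E E) (TensorProduct.assoc k V V V (z ⊗ₜ v)) (p, q, r) =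
      pairing E E z (p, q) * E v r := by
  induction z with
  | zero => rw [TensorProduct.zero_tmul, map_zero, map_zero, map_zero]; simp
  | add z z' hz hz' =>
    rw [TensorProduct.add_tmul, map_add, map_add, map_add, Pi.add_apply, Pi.add_apply, hz, hz',
      add_mul]
  | tmul v v' => rw [TensorProduct.assoc_tmul, pairing_tmul, pairing_tmul, pairing_tmul, mul_assoc]

variable [DecidableEq P] {E : V →ₗ[k] P → L} {Δ : V →ₗ[k] V ⊗[k] V}

/-- Splitting a leg inserts a Kronecker delta. Doing so on either side of `Δ v` gives `E v p`
supported on `p = q = r`, which is coassociativity. -/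
theorem pairing_rTensor (hΔ : ∀ v, pairing E E (Δ v) = diag (k := k) (E v)) (z : V ⊗[k] V)
    (p q r : P) :
    pairing E (pairing E E) (TensorProduct.assoc k V V V (Δ.rTensor V z)) (p, q, r) =
      if p = q then pairing E E z (p, r) else 0 := by
  induction z with
  | zero => simp
  | add z z' hz hz' =>
    rw [map_add, map_add, map_add, map_add, Pi.add_apply, Pi.add_apply, hz, hz']
    split_ifs <;> simp
  | tmul v w =>
    rw [LinearMap.rTensor_tmul, pairing_assoc_tmul, hΔ, diag_apply, pairing_tmul]
    split_ifs <;> simp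

theorem pairing_lTensor (hΔ : ∀ v, pairing E E (Δ v) = diag (k := k) (E v)) (z : V ⊗[k] V)
    (p q r : P) :
    pairing E (pairing E E) (Δ.lTensor V z) (p, q, r) =
      if q = r then pairing E E z (p, q) else 0 := by
  induction z with
  | zero => simp
  | add z z' hz hz' =>
    rw [map_add, map_add, map_add, Pi.add_apply, Pi.add_apply, hz, hz']
    split_ifs <;> simp
  | tmul v w =>
    rw [LinearMap.lTensor_tmul, pairing_tmul, hΔ, diag_apply, pairing_tmul]
    split_ifs <;> simp

theorem apply_lid_rTensor [Fintype P] {ε : V →ₗ[k] k}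
    (hε : ∀ v, algebraMap k L (ε v) = ∑ p, E v p) (z : V ⊗[k] V) (q : P) :
    E (TensorProduct.lid k V (ε.rTensor V z)) q = ∑ p, pairing E E z (p, q) := by
  induction z with
  | zero => simp
  | add z z' hz hz' => simp only [map_add, Pi.add_apply, hz, hz', Finset.sum_add_distrib]
  | tmul v w =>
    rw [LinearMap.rTensor_tmul, TensorProduct.lid_tmul, map_smul, Pi.smul_apply,
      Algebra.smul_def, hε, Finset.sum_mul]
    rfl

theorem apply_rid_lTensor [Fintype P] {ε : V →ₗ[k] k}
    (hε : ∀ v, algebraMap k L (ε v) = ∑ p, E v p) (z : V ⊗[k] V) (q : P) :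
    E (TensorProduct.rid k V (ε.lTensor V z)) q = ∑ p, pairing E E z (q, p) := by
  induction z with
  | zero => simp
  | add z z' hz hz' => simp only [map_add, Pi.add_apply, hz, hz', Finset.sum_add_distrib]
  | tmul v w =>
    rw [LinearMap.lTensor_tmul, TensorProduct.rid_tmul, map_smul, Pi.smul_apply,
      Algebra.smul_def, hε, mul_comm, Finset.mul_sum]
    rfl

/-- The coalgebra structure on a form `V` of the coalgebra of functions on the finite set `P`. -/
@[reducible]
def coalgebraOfForm [Fintype P] (hE : IsFormInjective E)
    (hΔ : ∀ v, pairing E E (Δ v) = diag (k := k) (E v)) (ε : V →ₗ[k] k)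
    (hε : ∀ v, algebraMap k L (ε v) = ∑ p, E v p) : Coalgebra k V where
  comul := Δ
  counit := ε
  coassoc := by
    ext1 a
    apply (hE.pairing (hE.pairing hE)).injective
    ext ⟨p, q, r⟩
    rw [LinearMap.comp_apply, LinearMap.comp_apply, LinearMap.comp_apply, LinearEquiv.coe_coe,
      pairing_rTensor hΔ, pairing_lTensor hΔ, hΔ, diag_apply, diag_apply]
    grind
  rTensor_counit_comp_comul := by
    ext1 a
    apply (TensorProduct.lid k V).injective
    apply hE.injective
    ext q
    rw [LinearMap.comp_apply, apply_lid_rTensor hε, hΔ]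
    simp [diag_apply]
  lTensor_counit_comp_comul := by
    ext1 a
    apply (TensorProduct.rid k V).injective
    apply hE.injective
    ext q
    rw [LinearMap.comp_apply, apply_rid_lTensor hε, hΔ]
    simp [diag_apply]

theorem isCocomm_of_form [Coalgebra k V] (hE : IsFormInjective E)
    (hΔ : ∀ v, pairing E E (Coalgebra.comul (R := k) v) = diag (k := k) (E v)) :
    Coalgebra.IsCocomm k V where
  comm_comp_comul := by
    ext1 a
    apply (hE.pairing hE).injective
    ext ⟨p, q⟩
    have h : ∀ z : V ⊗[k] V,
        pairing E E (TensorProduct.comm k _ _ z) (p, q) = pairing E E z (q, p) := by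
      intro z
      induction z with
      | zero => simp
      | add z z' hz hz' => simp only [map_add, Pi.add_apply, hz, hz']
      | tmul v w => rw [TensorProduct.comm_tmul, pairing_tmul, pairing_tmul, mul_comm]
    rw [LinearMap.comp_apply, LinearEquiv.coe_coe, h, hΔ, diag_apply, diag_apply]
    grind

end FormCoalgebra

section FormHopf

variable {k : Type u} {L : Type v} [Field k] [Field L] [Algebra k L]
variable {P : Type*} [Group P] [Fintype P] [DecidableEq P]
variable {A : Type w} [Ring A] [Algebra k A] {ι : A →ₐ[k] MonoidAlgebra L P}

theorem counit_eq_sum (a : MonoidAlgebra L P) :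
    Coalgebra.counit (R := L) a = ∑ p, a.coeff p := by
  induction a using MonoidAlgebra.induction_linear with
  | zero => simp
  | add a b ha hb => rw [map_add, ha, hb, ← Finset.sum_add_distrib]; rfl
  | single p c => simp [Finsupp.single_apply]

/-- The algebra homomorphism from the tensor square of a form of a group algebra to the tensor
square of the group algebra. -/
def tensorHom (ι : A →ₐ[k] MonoidAlgebra L P) :
    A ⊗[k] A →ₐ[k] MonoidAlgebra L P ⊗[L] MonoidAlgebra L P :=
  ((Algebra.TensorProduct.mapOfCompatibleSMul L k k (MonoidAlgebra L P)
    (MonoidAlgebra L P)).restrictScalars k).comp (Algebra.TensorProduct.map ι ι)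

/-- An element of `A ⊗ A` is `Δ(a)` as soon as its image is `Δ(ι a)`, so the multiplicative axioms
for `Δ` are inherited from the group algebra. -/
theorem comul_eq_tensorHom_iff [Coalgebra k A] (hι : IsFormInjective (coeffs ι.toLinearMap))
    (hΔ : ∀ a, pairing (coeffs ι.toLinearMap) (coeffs ι.toLinearMap) (Coalgebra.comul (R := k) a) =
      diag (k := k) (coeffs ι.toLinearMap a)) (a : A) (z : A ⊗[k] A) :
    Coalgebra.comul (R := L) (ι a) = tensorHom ι z ↔ Coalgebra.comul (R := k) a = z := by
  rw [← (hι.pairing hι).injective.eq_iff, hΔ, eq_comm (a := diag _)]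
  exact comul_eq_iff ι.toLinearMap z (ι a)

/-- The bialgebra structure on a form of a group algebra. -/
@[reducible]
def bialgebraOfForm [Coalgebra k A] (hι : IsFormInjective (coeffs ι.toLinearMap))
    (hΔ : ∀ a, pairing (coeffs ι.toLinearMap) (coeffs ι.toLinearMap) (Coalgebra.comul (R := k) a) =
      diag (k := k) (coeffs ι.toLinearMap a))
    (hε : ∀ a : A, algebraMap k L (Coalgebra.counit a) = ∑ p, (ι a).coeff p) : Bialgebra k A :=
  have h := comul_eq_tensorHom_iff hι hΔ
  have hc := fun a => (h a _).2 rfl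
  Bialgebra.mk' k A
    (by
      apply FaithfulSMul.algebraMap_injective k L
      rw [hε, ← counit_eq_sum, map_one ι, Bialgebra.counit_one, map_one])
    (by
      intro a b
      apply FaithfulSMul.algebraMap_injective k L
      rw [map_mul (algebraMap k L), hε, hε, hε, ← counit_eq_sum, ← counit_eq_sum, ← counit_eq_sum,
        map_mul ι, Bialgebra.counit_mul])
    (by rw [← h, map_one ι, Bialgebra.comul_one, map_one])
    (by
      intro a b
      rw [← h, map_mul ι, Bialgebra.comul_mul, hc, hc, map_mul])

theorem coeff_mul_eq_sum {L P : Type*} [Semiring L] [Group P] [Fintype P] (a b : MonoidAlgebra L P)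
    (p : P) : (a * b).coeff p = ∑ q, a.coeff q * b.coeff (q⁻¹ * p) := by
  rw [MonoidAlgebra.coeff_mul_apply_left, Finsupp.sum_fintype _ _ (by simp)]

theorem coeff_algebraMap (c : k) (p : P) :
    (algebraMap k (MonoidAlgebra L P) c).coeff p = if p = 1 then algebraMap k L c else 0 := by
  rw [MonoidAlgebra.coe_algebraMap, Function.comp_apply, MonoidAlgebra.coeff_single,
    Finsupp.single_apply]
  simp [eq_comm]

theorem coeff_mul'_rTensor {S : A →ₗ[k] A} (hS : ∀ a p, (ι (S a)).coeff p = (ι a).coeff p⁻¹)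
    (z : A ⊗[k] A) (p : P) : (ι (LinearMap.mul' k A (S.rTensor A z))).coeff p =
      ∑ q, pairing (coeffs ι.toLinearMap) (coeffs ι.toLinearMap) z (q⁻¹, q⁻¹ * p) := by
  induction z with
  | zero => simp
  | add z z' hz hz' =>
    simp only [map_add, Pi.add_apply, MonoidAlgebra.coeff_add, Finsupp.add_apply, hz, hz',
      Finset.sum_add_distrib]
  | tmul v w =>
    rw [LinearMap.rTensor_tmul, LinearMap.mul'_apply, map_mul, coeff_mul_eq_sum]
    simp only [hS]
    rfl

theorem coeff_mul'_lTensor {S : A →ₗ[k] A} (hS : ∀ a p, (ι (S a)).coeff p = (ι a).coeff p⁻¹)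
    (z : A ⊗[k] A) (p : P) : (ι (LinearMap.mul' k A (S.lTensor A z))).coeff p =
      ∑ q, pairing (coeffs ι.toLinearMap) (coeffs ι.toLinearMap) z (q, (q⁻¹ * p)⁻¹) := by
  induction z with
  | zero => simp
  | add z z' hz hz' =>
    simp only [map_add, Pi.add_apply, MonoidAlgebra.coeff_add, Finsupp.add_apply, hz, hz',
      Finset.sum_add_distrib]
  | tmul v w =>
    rw [LinearMap.lTensor_tmul, LinearMap.mul'_apply, map_mul, coeff_mul_eq_sum]
    simp only [hS]
    rfl

/-- The Hopf algebra structure on a form of a group algebra. -/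
@[reducible]
def hopfAlgebraOfForm {A : Type w} [Ring A] [Bialgebra k A] {ι : A →ₐ[k] MonoidAlgebra L P}
    (hι : IsFormInjective (coeffs ι.toLinearMap))
    (hΔ : ∀ a, pairing (coeffs ι.toLinearMap) (coeffs ι.toLinearMap) (Coalgebra.comul (R := k) a) =
      diag (k := k) (coeffs ι.toLinearMap a))
    (hε : ∀ a : A, algebraMap k L (Coalgebra.counit a) = ∑ p, (ι a).coeff p)
    {S : A →ₗ[k] A} (hS : ∀ a p, (ι (S a)).coeff p = (ι a).coeff p⁻¹) : HopfAlgebra k A where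
  antipode := S
  mul_antipode_rTensor_comul := by
    ext1 a
    apply hι.injective
    ext p
    rw [coeffs_apply, coeffs_apply]
    change (ι _).coeff p = (ι (algebraMap k A (Coalgebra.counit a))).coeff p
    rw [LinearMap.comp_apply, LinearMap.comp_apply, coeff_mul'_rTensor hS, hΔ, AlgHom.commutes,
      coeff_algebraMap, hε]
    simp only [diag_apply, left_eq_mul]
    split_ifs
    · exact Fintype.sum_equiv (Equiv.inv _) _ _ fun _ => rfl
    · exact Finset.sum_const_zero
  mul_antipode_lTensor_comul := by
    ext1 a
    apply hι.injective
    ext p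
    rw [coeffs_apply, coeffs_apply]
    change (ι _).coeff p = (ι (algebraMap k A (Coalgebra.counit a))).coeff p
    rw [LinearMap.comp_apply, LinearMap.comp_apply, coeff_mul'_lTensor hS, hΔ, AlgHom.commutes,
      coeff_algebraMap, hε]
    simp only [diag_apply, mul_inv_rev, inv_inv, right_eq_mul, inv_eq_one]
    split_ifs
    · rfl
    · exact Finset.sum_const_zero

end FormHopf

/-! ### Descent of the comultiplication -/

section DiagonalDescent

variable {k : Type u} {L : Type v} [Field k] [Field L] [Algebra k L]
variable {I J : Type*} {V : Type w} {W : Type w'}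
variable [AddCommGroup V] [Module k V] [AddCommGroup W] [Module k W]

/-- The product of two actions. -/
def prodAction (ρ : Gal(L/k) →* Equiv.Perm I) (ρ' : Gal(L/k) →* Equiv.Perm J) :
    Gal(L/k) →* Equiv.Perm (I × J) where
  toFun g := (ρ g).prodCongr (ρ' g)
  map_one' := by ext <;> simp
  map_mul' _ _ := by ext <;> simp

theorem pairing_mem_equivariant {ρ : Gal(L/k) →* Equiv.Perm I} {ρ' : Gal(L/k) →* Equiv.Perm J}
    {E : V →ₗ[k] I → L} {F : W →ₗ[k] J → L} (hE : ∀ v, E v ∈ equivariant ρ)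
    (hF : ∀ w, F w ∈ equivariant ρ') (z : V ⊗[k] W) :
    pairing E F z ∈ equivariant (prodAction ρ ρ') := by
  induction z with
  | zero => rw [map_zero]; exact Submodule.zero_mem _
  | add a b ha hb => rw [map_add]; exact Submodule.add_mem _ ha hb
  | tmul v w =>
    rintro g ⟨i, j⟩
    change E v (ρ g i) * F w (ρ' g j) = g (E v i * F w j)
    rw [hE, hF, map_mul]

theorem pairing_mem_span {E : V →ₗ[k] I → L} {F : W →ₗ[k] J → L} {f : I → L} {f' : J → L}
    (hf : f ∈ Submodule.span L (Set.range E)) (hf' : f' ∈ Submodule.span L (Set.range F)) :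
    (fun p : I × J => f p.1 * f' p.2) ∈
      Submodule.span L (LinearMap.range (pairing E F) : Set (I × J → L)) := by
  let B : (I → L) →ₗ[L] (J → L) →ₗ[L] (I × J → L) :=
    LinearMap.mk₂ L (fun f f' p => f p.1 * f' p.2)
      (fun _ _ _ => by ext; simp [add_mul]) (fun _ _ _ => by ext; simp [mul_assoc])
      (fun _ _ _ => by ext; simp [mul_add]) (fun _ _ _ => by ext; simp [mul_left_comm])
  have h := Submodule.apply_mem_map₂ B hf hf'
  rw [Submodule.map₂_span_span] at h
  refine Submodule.span_mono ?_ h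
  rintro _ ⟨_, ⟨v, rfl⟩, _, ⟨w, rfl⟩, rfl⟩
  exact ⟨v ⊗ₜ w, rfl⟩

/-- The function `diag f` is equivariant for the product action and equals `∑ f i • δ_i ⊗ δ_i`, so
it lies in the span of the image and descends. The spanning hypothesis is asked only where `f i ≠
0`, so that the statement serves both `Kt[N]^G` and its sub-Hopf algebras. -/
theorem exists_pairing_eq_diag [FiniteDimensional k L] [IsGalois k L] [Fintype I] [DecidableEq I]
    (ρ : Gal(L/k) →* Equiv.Perm I) {E : V →ₗ[k] I → L} (hE : ∀ v, E v ∈ equivariant ρ)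
    {f : I → L} (hf : f ∈ equivariant ρ)
    (hspan : ∀ i, f i ≠ 0 → Pi.single i (1 : L) ∈ Submodule.span L (Set.range E)) :
    ∃ z, pairing E E z = diag (k := k) f := by
  refine mem_of_mem_span (prodAction ρ ρ) (S := LinearMap.range (pairing E E)) ?_ ?_ ?_
  · rintro _ ⟨z, rfl⟩
    exact pairing_mem_equivariant hE hE z
  · rintro g ⟨i, j⟩
    change (if ρ g i = ρ g j then f (ρ g i) else 0) = g (if i = j then f i else 0)
    simp only [EmbeddingLike.apply_eq_iff_eq]
    split_ifs
    · exact hf g i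
    · rw [map_zero]
  · have h : diag (k := k) f = ∑ i, f i • fun p : I × I =>
        (Pi.single i 1 : I → L) p.1 * (Pi.single i 1 : I → L) p.2 := by
      ext ⟨i, j⟩
      simp only [diag_apply, Finset.sum_apply, Pi.smul_apply, Pi.single_apply, smul_eq_mul]
      simp only [mul_ite, mul_one, mul_zero, Finset.sum_ite_eq, Finset.mem_univ, if_true]
      split_ifs with h
      · rw [h]
      · rfl
    rw [h]
    refine Submodule.sum_mem _ fun i _ => ?_
    by_cases hi : f i = 0
    · rw [hi, zero_smul]
      exact Submodule.zero_mem _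
    · exact Submodule.smul_mem _ _ (pairing_mem_span (hspan i hi) (hspan i hi))

end DiagonalDescent

/-! ### The algebra `Kt[N]^G` and its dimension -/

section FixedSubalgebra

variable {k : Type u} {Kt : Type v} [Field k] [Field Kt] [Algebra k Kt]
variable {G' : Subgroup Gal(Kt/k)} {X : Type} (e : Gal(Kt/k) ⧸ G' ≃ X)

/-- The action of the Galois group on permutations by conjugation via `λ`. -/
def conjAction : Gal(Kt/k) →* Equiv.Perm (Equiv.Perm X) :=
  (MulAut.toPerm _).comp (MulAut.conj.comp (leftTranslation e))

@[simp]
theorem conjAction_apply (g : Gal(Kt/k)) (π : Equiv.Perm X) :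
    conjAction e g π = leftTranslation e g * π * (leftTranslation e g)⁻¹ := rfl

theorem conj_mem {N : Subgroup (Equiv.Perm X)} (hN : IsNormalized e N) (g : Gal(Kt/k))
    {π : Equiv.Perm X} (hπ : π ∈ N) :
    leftTranslation e g * π * (leftTranslation e g)⁻¹ ∈ N :=
  (Subgroup.mem_normalizer_iff.1 (hN ⟨g, rfl⟩) π).1 hπ

variable [Fintype X] [DecidableEq X]

/-- The `k`-algebra `Kt[N]^G`. -/
def fixedSubalgebra (N : Subgroup (Equiv.Perm X)) :
    Subalgebra k (MonoidAlgebra Kt (Equiv.Perm X)) where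
  carrier := fixedGroupAlgebra e N
  mul_mem' {a b} ha hb := by
    refine ⟨fun π hπ => ?_, fun g π => ?_⟩
    · rw [coeff_mul_eq_sum]
      refine Finset.sum_eq_zero fun q _ => ?_
      by_cases hq : q ∈ N
      · rw [hb.1, mul_zero]
        exact fun h => hπ (by simpa using N.mul_mem hq h)
      · rw [ha.1 q hq, zero_mul]
    · rw [coeff_mul_eq_sum, coeff_mul_eq_sum, map_sum]
      refine (Fintype.sum_equiv (conjAction e g) _ _ fun q => ?_).symm
      rw [map_mul, ← hb.2 g, ← ha.2 g, conjAction_apply]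
      congr 2
      group
  add_mem' {a b} ha hb := by
    refine ⟨fun π hπ => ?_, fun g π => ?_⟩
    · rw [MonoidAlgebra.coeff_add, Finsupp.add_apply, ha.1 π hπ, hb.1 π hπ, add_zero]
    · rw [MonoidAlgebra.coeff_add, Finsupp.add_apply, Finsupp.add_apply, ha.2, hb.2, map_add]
  algebraMap_mem' c := by
    have h := coeff_algebraMap (L := Kt) (P := Equiv.Perm X) c
    refine ⟨fun π hπ => ?_, fun g π => ?_⟩
    · rw [h, if_neg]
      rintro rfl
      exact hπ N.one_mem
    · rw [h, h]
      have : leftTranslation e g * π * (leftTranslation e g)⁻¹ = 1 ↔ π = 1 := by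
        rw [mul_inv_eq_one, mul_eq_left]
      simp only [this]
      split_ifs <;> simp

variable (N : Subgroup (Equiv.Perm X))

theorem mem_fixedSubalgebra {a : MonoidAlgebra Kt (Equiv.Perm X)} :
    a ∈ fixedSubalgebra e N ↔ a ∈ fixedGroupAlgebra e N := Iff.rfl

/-- The coefficients of an element of `Kt[N]^G`. -/
abbrev fixedCoeffs : fixedSubalgebra e N →ₗ[k] Equiv.Perm X → Kt :=
  coeffs (fixedSubalgebra e N).val.toLinearMap

theorem fixedCoeffs_mem (a : fixedSubalgebra e N) :
    fixedCoeffs e N a ∈ equivariant (conjAction e) := a.2.2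

theorem fixedCoeffs_injective : Function.Injective (fixedCoeffs e N) :=
  coeffs_injective Subtype.val_injective

/-- An element of `Kt[N]^G` with given coefficients. -/
def ofCoeffs (f : Equiv.Perm X → Kt) (h : ∀ π, π ∉ N → f π = 0)
    (hf : f ∈ equivariant (conjAction e)) : fixedSubalgebra e N :=
  ⟨.ofCoeff (Finsupp.equivFunOnFinite.symm f), h, hf⟩

@[simp]
theorem fixedCoeffs_ofCoeffs (f : Equiv.Perm X → Kt) (h : ∀ π, π ∉ N → f π = 0)
    (hf : f ∈ equivariant (conjAction e)) : fixedCoeffs e N (ofCoeffs e N f h hf) = f := rfl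

variable [FiniteDimensional k Kt]

theorem isFormInjective_fixedCoeffs [IsGalois k Kt] : IsFormInjective (fixedCoeffs e N) :=
  isFormInjective_of_mem_equivariant _ (fixedCoeffs_injective e N) (fixedCoeffs_mem e N)

/-- The averages of functions supported at `π` are supported on the `λ(G)`-conjugates of `π`, which
stay in `N`; so they are coefficient functions of elements of `Kt[N]^G`. -/
theorem single_mem_span_fixedCoeffs (hN : IsNormalized e N) {π : Equiv.Perm X} (hπ : π ∈ N) :
    Pi.single π (1 : Kt) ∈ Submodule.span Kt (Set.range (fixedCoeffs e N)) := by
  refine Submodule.span_mono ?_ (single_mem_span_average (conjAction e) π)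
  rintro _ ⟨y, rfl⟩
  refine ⟨ofCoeffs e N _ (fun π' hπ' => ?_) (average_mem _ _), fixedCoeffs_ofCoeffs ..⟩
  refine average_single_apply_eq_zero _ _ fun g h => hπ' ?_
  rw [← h]
  exact conj_mem e hN g hπ

theorem span_fixedCoeffs (hN : IsNormalized e N) :
    Submodule.span Kt (Set.range (fixedCoeffs e N)) =
      Submodule.span Kt (Set.range fun π : N => Pi.single (π : Equiv.Perm X) (1 : Kt)) := by
  refine le_antisymm (Submodule.span_le.2 ?_) (Submodule.span_le.2 ?_)
  · rintro _ ⟨a, rfl⟩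
    have : fixedCoeffs e N a = ∑ π, fixedCoeffs e N a π • Pi.single π (1 : Kt) := by
      ext π
      simp [Pi.single_apply]
    rw [this]
    refine Submodule.sum_mem _ fun π _ => ?_
    by_cases hπ : π ∈ N
    · exact Submodule.smul_mem _ _ (Submodule.subset_span ⟨⟨π, hπ⟩, rfl⟩)
    · rw [show fixedCoeffs e N a π = 0 from a.2.1 π hπ, zero_smul]
      exact Submodule.zero_mem _
  · rintro _ ⟨π, rfl⟩
    exact single_mem_span_fixedCoeffs e N hN π.2

instance finite_fixedSubalgebra : Module.Finite k (fixedSubalgebra e N) := by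
  have : Module.Finite k (Equiv.Perm X → Kt) := Module.Finite.trans Kt _
  exact Module.Finite.of_injective _ (fixedCoeffs_injective e N)

/-- A `k`-basis of the invariants has `Kt`-independent coefficient functions, and these span the
same `Kt`-space as the delta functions on `N`. -/
theorem finrank_fixedSubalgebra [IsGalois k Kt] (hN : IsNormalized e N) :
    Module.finrank k (fixedSubalgebra e N) = Nat.card N := by
  classical
  obtain ⟨ι, b, hb⟩ := isFormInjective_fixedCoeffs e N
  have : Fintype ι := FiniteDimensional.fintypeBasisIndex b
  have h1 := finrank_span_eq_card hb
  have h2 : Submodule.span Kt (Set.range (fixedCoeffs e N ∘ b)) =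
      Submodule.span Kt (Set.range (fixedCoeffs e N)) := by
    refine le_antisymm (Submodule.span_mono (Set.range_comp_subset_range _ _))
      (Submodule.span_le.2 ?_)
    rintro _ ⟨a, rfl⟩
    rw [← b.sum_repr a, map_sum]
    refine Submodule.sum_mem _ fun i _ => ?_
    rw [map_smul]
    exact Submodule.smul_of_tower_mem _ _ (Submodule.subset_span ⟨i, rfl⟩)
  have h3 : LinearIndependent Kt fun π : N => (Pi.single (π : Equiv.Perm X) (1 : Kt) : _ → Kt) := by
    have := (Pi.basisFun Kt (Equiv.Perm X)).linearIndependent.comp ((↑) : N → Equiv.Perm X)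
      Subtype.val_injective
    convert this using 1
    ext π
    simp
  rw [h2, span_fixedCoeffs e N hN, finrank_span_eq_card h3] at h1
  rw [Module.finrank_eq_card_basis b, ← h1, Nat.card_eq_fintype_card]

end FixedSubalgebra

/-! ### The Hopf algebra `Kt[N]^G` -/

section HopfStructure

variable {k : Type u} {Kt : Type v} [Field k] [Field Kt] [Algebra k Kt]
variable [FiniteDimensional k Kt] [IsGalois k Kt]
variable {G' : Subgroup Gal(Kt/k)} {X : Type} (e : Gal(Kt/k) ⧸ G' ≃ X)
variable [Fintype X] [DecidableEq X] (N : Subgroup (Equiv.Perm X))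

theorem pairing_fixedCoeffs_injective :
    Function.Injective (pairing (fixedCoeffs e N) (fixedCoeffs e N)) :=
  ((isFormInjective_fixedCoeffs e N).pairing (isFormInjective_fixedCoeffs e N)).injective

/-- A Galois automorphism permutes the coefficients through conjugation, so their sum is invariant
and lies in `k`. -/
theorem exists_sum_fixedCoeffs (a : fixedSubalgebra e N) :
    ∃ c : k, algebraMap k Kt c = ∑ π, fixedCoeffs e N a π := by
  have : ∑ π, fixedCoeffs e N a π ∈ (⊥ : IntermediateField k Kt) := by
    rw [IsGalois.mem_bot_iff_fixed]
    intro g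
    rw [map_sum]
    exact Fintype.sum_equiv (conjAction e g) _ _ fun π => (fixedCoeffs_mem e N a g π).symm
  exact IntermediateField.mem_bot.1 this

/-- The counit of `Kt[N]^G`: the sum of the coefficients. -/
def fixedCounit : fixedSubalgebra e N →ₗ[k] k :=
  have h := fun a => (exists_sum_fixedCoeffs e N a).choose_spec
  { toFun := fun a => (exists_sum_fixedCoeffs e N a).choose
    map_add' := fun a b => by
      apply FaithfulSMul.algebraMap_injective k Kt
      refine (h _).trans ?_
      rw [map_add (algebraMap k Kt), h, h, ← Finset.sum_add_distrib, map_add]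
      rfl
    map_smul' := fun c a => by
      apply FaithfulSMul.algebraMap_injective k Kt
      refine (h _).trans ?_
      rw [RingHom.id_apply, smul_eq_mul, map_mul, h, Finset.mul_sum, map_smul]
      exact Finset.sum_congr rfl fun π _ => Algebra.smul_def _ _ }

theorem algebraMap_fixedCounit (a : fixedSubalgebra e N) :
    algebraMap k Kt (fixedCounit e N a) = ∑ π, fixedCoeffs e N a π :=
  (exists_sum_fixedCoeffs e N a).choose_spec

/-- The antipode of `Kt[N]^G`: inversion of the group elements. -/
def fixedAntipode : fixedSubalgebra e N →ₗ[k] fixedSubalgebra e N where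
  toFun a := ofCoeffs e N (fun π => fixedCoeffs e N a π⁻¹)
    (fun π hπ => a.2.1 _ fun h => hπ (by simpa using h))
    (fun g π => by
      rw [← fixedCoeffs_mem e N a g π⁻¹]
      simp [mul_assoc])
  map_add' a b := by
    apply fixedCoeffs_injective e N
    simp only [fixedCoeffs_ofCoeffs, map_add]
    rfl
  map_smul' c a := by
    apply fixedCoeffs_injective e N
    simp only [fixedCoeffs_ofCoeffs, map_smul]
    rfl

theorem fixedCoeffs_fixedAntipode (a : fixedSubalgebra e N) (π : Equiv.Perm X) :
    fixedCoeffs e N (fixedAntipode e N a) π = fixedCoeffs e N a π⁻¹ := rfl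

variable [hN : Fact (IsNormalized e N)]

theorem diag_mem_range (a : fixedSubalgebra e N) : diag (k := k) (fixedCoeffs e N a) ∈
    LinearMap.range (pairing (fixedCoeffs e N) (fixedCoeffs e N)) := by
  obtain ⟨z, hz⟩ := exists_pairing_eq_diag (conjAction e) (fixedCoeffs_mem e N)
    (fixedCoeffs_mem e N a) fun π hπ => single_mem_span_fixedCoeffs e N hN.out
      (by_contra fun h => hπ (a.2.1 π h))
  exact ⟨z, hz⟩

/-- The comultiplication of `Kt[N]^G`. -/
def fixedComul : fixedSubalgebra e N →ₗ[k] fixedSubalgebra e N ⊗[k] fixedSubalgebra e N :=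
  (LinearEquiv.ofInjective _ (pairing_fixedCoeffs_injective e N)).symm.toLinearMap ∘ₗ
    LinearMap.codRestrict _ (diag ∘ₗ fixedCoeffs e N) (diag_mem_range e N)

theorem pairing_fixedComul (a : fixedSubalgebra e N) :
    pairing (fixedCoeffs e N) (fixedCoeffs e N) (fixedComul e N a) =
      diag (k := k) (fixedCoeffs e N a) := by
  have := LinearEquiv.apply_symm_apply
    (LinearEquiv.ofInjective _ (pairing_fixedCoeffs_injective e N))
    ⟨diag (fixedCoeffs e N a), diag_mem_range e N a⟩
  exact congrArg Subtype.val this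

instance fixedCoalgebra : Coalgebra k (fixedSubalgebra e N) :=
  coalgebraOfForm (isFormInjective_fixedCoeffs e N) (pairing_fixedComul e N)
    (fixedCounit e N) (algebraMap_fixedCounit e N)

instance fixedBialgebra : Bialgebra k (fixedSubalgebra e N) :=
  bialgebraOfForm (isFormInjective_fixedCoeffs e N) (pairing_fixedComul e N)
    (algebraMap_fixedCounit e N)

instance fixedHopfAlgebra : HopfAlgebra k (fixedSubalgebra e N) :=
  hopfAlgebraOfForm (isFormInjective_fixedCoeffs e N) (pairing_fixedComul e N)
    (algebraMap_fixedCounit e N) (S := fixedAntipode e N) (fixedCoeffs_fixedAntipode e N)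

instance fixedIsCocomm : Coalgebra.IsCocomm k (fixedSubalgebra e N) :=
  isCocomm_of_form (isFormInjective_fixedCoeffs e N) (pairing_fixedComul e N)

end HopfStructure

/-! ### The action on `K` and the structure attached to `N` -/

section Action

variable {k : Type u} {Kt : Type v} [Field k] [Field Kt] [Algebra k Kt]
variable {G' : Subgroup Gal(Kt/k)} {X : Type} (e : Gal(Kt/k) ⧸ G' ≃ X)
variable [Fintype X] [DecidableEq X]

/-- The `Kt`-linear map sending a permutation `π` to the embedding given by the coset
`π⁻¹ (1̄)`. -/
def toLinearMaps : (Equiv.Perm X → Kt) →ₗ[Kt] IntermediateField.fixedField G' →ₗ[k] Kt where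
  toFun f := ∑ π, f π • (emb e (π⁻¹ (basePoint e))).toLinearMap
  map_add' f f' := by simp [add_smul, Finset.sum_add_distrib]
  map_smul' c f := by simp [mul_smul, Finset.smul_sum]

theorem toLinearMaps_apply (f : Equiv.Perm X → Kt) (y : IntermediateField.fixedField G') :
    toLinearMaps e f y = ∑ π, f π * emb e (π⁻¹ (basePoint e)) y := by
  simp [toLinearMaps]

theorem coeff_sum_eq (a : MonoidAlgebra Kt (Equiv.Perm X))
    (y : IntermediateField.fixedField G') :
    (a.coeff.sum fun π a =>
        a * cosetApply (e.symm (π⁻¹ (e ((1 : Gal(Kt/k)) : Gal(Kt/k) ⧸ G')))) y) =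
      toLinearMaps e a.coeff y := by
  rw [Finsupp.sum_fintype _ _ (by simp), toLinearMaps_apply]
  rfl

/-- The conjugation on the coefficients cancels against the translation of the embeddings, so `g`
only moves the point at which `π⁻¹` is evaluated. For `g ∈ G'` that point is unchanged, which is why
the action preserves `K`. -/
theorem apply_toLinearMaps {f : Equiv.Perm X → Kt} (hf : f ∈ equivariant (conjAction e))
    (g : Gal(Kt/k)) (y : IntermediateField.fixedField G') :
    g (toLinearMaps e f y) =
      ∑ π, f π * emb e (π⁻¹ (leftTranslation e g (basePoint e))) y := by
  rw [toLinearMaps_apply, map_sum]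
  refine Fintype.sum_equiv (conjAction e g) _ _ fun π => ?_
  rw [map_mul, apply_emb, hf]
  congr 2
  simp

variable [FiniteDimensional k Kt] [IsGalois k Kt]

theorem toLinearMaps_mem {f : Equiv.Perm X → Kt} (hf : f ∈ equivariant (conjAction e))
    (y : IntermediateField.fixedField G') :
    toLinearMaps e f y ∈ IntermediateField.fixedField G' := by
  rintro ⟨g, hg⟩
  change g (toLinearMaps e f y) = _
  rw [apply_toLinearMaps e hf, (leftTranslation_basePoint_eq_iff e g).2 hg, toLinearMaps_apply]

theorem emb_toLinearMaps {f : Equiv.Perm X → Kt} (hf : f ∈ equivariant (conjAction e)) (x : X)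
    (y y' : IntermediateField.fixedField G') (hy : (y' : Kt) = toLinearMaps e f y) :
    emb e x y' = ∑ π, f π * emb e (π⁻¹ x) y := by
  obtain ⟨g, rfl⟩ := exists_leftTranslation_basePoint e x
  rw [← apply_emb, emb_basePoint, hy, apply_toLinearMaps e hf]

theorem IsRegular.bijective {N : Subgroup (Equiv.Perm X)} (hN : IsRegular N) (x : X) :
    Function.Bijective fun π : N => (π⁻¹ : Equiv.Perm X) x := by
  constructor
  · intro π π' h
    obtain ⟨_, _, huniq⟩ := hN x ((π⁻¹ : Equiv.Perm X) x)
    have := (huniq _ ⟨N.inv_mem π.2, rfl⟩).trans (huniq _ ⟨N.inv_mem π'.2, h.symm⟩).symm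
    exact Subtype.ext (inv_injective this)
  · intro y
    obtain ⟨π, ⟨hπ, rfl⟩, _⟩ := hN x y
    exact ⟨⟨π⁻¹, N.inv_mem hπ⟩, by simp⟩

theorem toLinearMaps_eq_sum {N : Subgroup (Equiv.Perm X)} {f : Equiv.Perm X → Kt}
    (hf : ∀ π, π ∉ N → f π = 0) [Fintype N] :
    toLinearMaps e f = ∑ π : N, f π • (emb e ((π⁻¹ : Equiv.Perm X) (basePoint e))).toLinearMap := by
  classical
  change ∑ π, f π • (emb e (π⁻¹ (basePoint e))).toLinearMap = _
  rw [← Finset.sum_subset (Finset.subset_univ (Finset.univ.filter (· ∈ N)))]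
  · rw [Finset.sum_subtype (p := (· ∈ N))]
    · simp
  · intro π _ hπ
    rw [hf, zero_smul]
    simpa using hπ

/-- Regularity makes `π ↦ π⁻¹(1̄)` injective on `N`, so pairwise distinct embeddings occur and
Dedekind independence applies. -/
theorem toLinearMaps_injOn {N : Subgroup (Equiv.Perm X)} (hN : IsRegular N)
    {f : Equiv.Perm X → Kt} (hf : ∀ π, π ∉ N → f π = 0) (h : toLinearMaps e f = 0) : f = 0 := by
  classical
  have hind := (linearIndependent_emb e).comp _ (hN.bijective (basePoint e)).1
  rw [Fintype.linearIndependent_iff] at hind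
  rw [toLinearMaps_eq_sum e hf] at h
  ext π
  by_cases hπ : π ∈ N
  · exact hind (fun π => f π) h ⟨π, hπ⟩
  · exact hf π hπ

end Action

section MulFormula

variable {k : Type u} {L : Type v} [Field k] [Field L] [Algebra k L]
variable {I : Type*} [Fintype I] {V : Type w} [AddCommGroup V] [Module k V]
variable {K : Type*} [Field K] [Algebra k K]

theorem apply_mul'_map {E : V →ₗ[k] I → L} {μ : V →ₗ[k] Module.End k K} {θ : K →ₐ[k] L}
    {F : I → K → L} (hμ : ∀ v y, θ (μ v y) = ∑ i, E v i * F i y) (z : V ⊗[k] V) (x y : K) :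
    θ (LinearMap.mul' k K (TensorProduct.map (μ.flip x) (μ.flip y) z)) =
      ∑ i, ∑ j, pairing E E z (i, j) * (F i x * F j y) := by
  induction z with
  | zero => simp
  | add z z' hz hz' =>
    simp only [map_add, hz, hz', Pi.add_apply, add_mul, Finset.sum_add_distrib]
  | tmul v w =>
    rw [TensorProduct.map_tmul, LinearMap.mul'_apply, LinearMap.flip_apply, LinearMap.flip_apply,
      map_mul, hμ, hμ, Finset.sum_mul_sum]
    refine Finset.sum_congr rfl fun i _ => Finset.sum_congr rfl fun j _ => ?_
    rw [pairing_tmul]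
    ring

end MulFormula

section FixedStructure

variable {k : Type u} {Kt : Type v} [Field k] [Field Kt] [Algebra k Kt]
variable [FiniteDimensional k Kt] [IsGalois k Kt]
variable {G' : Subgroup Gal(Kt/k)} {X : Type} (e : Gal(Kt/k) ⧸ G' ≃ X)
variable [Fintype X] [DecidableEq X] (N : Subgroup (Equiv.Perm X))

/-- The action of an element of `Kt[N]^G` on `Kt^{G'}`. -/
def fixedAct (a : fixedSubalgebra e N) : Module.End k (IntermediateField.fixedField G') where
  toFun y := ⟨toLinearMaps e (fixedCoeffs e N a) y, toLinearMaps_mem e (fixedCoeffs_mem e N a) y⟩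
  map_add' y y' := Subtype.ext (map_add _ y y')
  map_smul' c y := Subtype.ext (map_smul _ c y)

theorem coe_fixedAct (a : fixedSubalgebra e N) (y : IntermediateField.fixedField G') :
    (fixedAct e N a y : Kt) = toLinearMaps e (fixedCoeffs e N a) y := rfl

theorem emb_fixedAct (a : fixedSubalgebra e N) (x : X) (y : IntermediateField.fixedField G') :
    emb e x (fixedAct e N a y) = ∑ π, fixedCoeffs e N a π * emb e (π⁻¹ x) y :=
  emb_toLinearMaps e (fixedCoeffs_mem e N a) x y _ rfl

/-- The action of `Kt[N]^G` on `Kt^{G'}`. -/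
def fixedAction : fixedSubalgebra e N →ₐ[k] Module.End k (IntermediateField.fixedField G') :=
  AlgHom.ofLinearMap
    { toFun := fixedAct e N
      map_add' := fun a b => LinearMap.ext fun y => Subtype.ext <| by
        rw [coe_fixedAct, map_add, map_add]
        rfl
      map_smul' := fun c a => LinearMap.ext fun y => Subtype.ext <| by
        rw [coe_fixedAct, map_smul, LinearMap.map_smul_of_tower]
        rfl }
    (LinearMap.ext fun y => Subtype.ext <| by
      change toLinearMaps e (fixedCoeffs e N 1) y = y
      rw [toLinearMaps_apply, Finset.sum_eq_single 1]
      · rw [inv_one, Equiv.Perm.one_apply, emb_basePoint]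
        change (1 : MonoidAlgebra Kt (Equiv.Perm X)).coeff 1 * _ = _
        simp [MonoidAlgebra.one_def]
      · intro π _ hπ
        change (1 : MonoidAlgebra Kt (Equiv.Perm X)).coeff π * _ = _
        simp [MonoidAlgebra.one_def, hπ.symm]
      · simp)
    (fun a b => LinearMap.ext fun y => Subtype.ext <| by
      change toLinearMaps e (fixedCoeffs e N (a * b)) y =
        toLinearMaps e (fixedCoeffs e N a) (fixedAct e N b y)
      simp_rw [toLinearMaps_apply, emb_fixedAct, Finset.mul_sum]
      have h : ∀ π, fixedCoeffs e N (a * b) π =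
          ∑ q, fixedCoeffs e N a q * fixedCoeffs e N b (q⁻¹ * π) := coeff_mul_eq_sum _ _
      simp_rw [h, Finset.sum_mul]
      rw [Finset.sum_comm]
      refine Finset.sum_congr rfl fun q _ => ?_
      refine Fintype.sum_equiv (Equiv.mulLeft q⁻¹) _ _ fun π => ?_
      simp [mul_assoc])

theorem coe_fixedAction (a : fixedSubalgebra e N) (y : IntermediateField.fixedField G') :
    (fixedAction e N a y : Kt) = toLinearMaps e (fixedCoeffs e N a) y := rfl

/-- If `z = ∑ cᵢ ⊗ bᵢ` acts as zero, then `∑ cᵢ • (coefficients of bᵢ)` vanishes by regularity; the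
coefficient functions of the `bᵢ` are independent over `Kt`, which contains the `cᵢ`. -/
theorem fixedAction_injective (hN : IsRegular N) : Function.Injective (TensorProduct.lift
    ((LinearMap.mul k (Module.End k (IntermediateField.fixedField G'))).compl₁₂
      (Algebra.lmul k (IntermediateField.fixedField G')).toLinearMap
      (fixedAction e N).toLinearMap)) := by
  classical
  obtain ⟨ι, b, hb⟩ := isFormInjective_fixedCoeffs e N
  rw [← LinearMap.ker_eq_bot, LinearMap.ker_eq_bot']
  intro z hz
  obtain ⟨c, rfl⟩ := (TensorProduct.equivFinsuppOfBasisRight b).symm.surjective z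
  rw [TensorProduct.equivFinsuppOfBasisRight_symm_apply, Finsupp.sum, map_sum] at hz
  have h0 : toLinearMaps e (∑ i ∈ c.support, (c i : Kt) • fixedCoeffs e N (b i)) = 0 := by
    ext y
    rw [map_sum, LinearMap.sum_apply]
    have := congrArg Subtype.val (LinearMap.congr_fun hz y)
    rw [LinearMap.sum_apply, AddSubmonoidClass.coe_finsetSum] at this
    rw [LinearMap.zero_apply, ← ZeroMemClass.coe_zero (IntermediateField.fixedField G')]
    refine Eq.trans (Finset.sum_congr rfl fun i _ => ?_) this
    rw [map_smul]
    rfl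
  have h1 := toLinearMaps_injOn e hN (fun π hπ => by
    rw [Finset.sum_apply]
    refine Finset.sum_eq_zero fun i _ => ?_
    rw [Pi.smul_apply, show fixedCoeffs e N (b i) π = 0 from (b i).2.1 π hπ, smul_zero]) h0
  have h2 := linearIndependent_iff'.1 hb _ _ h1
  rw [LinearEquiv.map_eq_zero_iff]
  ext i
  by_cases hi : i ∈ c.support
  · exact h2 i hi
  · simpa using hi

variable [hN : Fact (IsNormalized e N)]

/-- The Hopf Galois structure attached to a regular subgroup normalized by `λ(G)`. -/
def fixedStructure (hreg : IsRegular N) :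
    HopfGaloisStructure.{u, v, v} k (IntermediateField.fixedField G') where
  H := fixedSubalgebra e N
  μ := fixedAction e N
  map_mul h x y := by
    apply Subtype.ext
    have := apply_mul'_map (θ := (IntermediateField.fixedField G').val) (E := fixedCoeffs e N)
      (μ := (fixedAction e N).toLinearMap) (F := fun π y => emb e (π⁻¹ (basePoint e)) y)
      (fun v y => toLinearMaps_apply e _ y) (Coalgebra.comul (R := k) h) x y
    refine Eq.trans ?_ this.symm
    rw [coe_fixedAction, toLinearMaps_apply]
    refine Finset.sum_congr rfl fun π _ => ?_
    have hd : ∀ p q, pairing (fixedCoeffs e N) (fixedCoeffs e N) (Coalgebra.comul (R := k) h) (p, q)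
        = if p = q then fixedCoeffs e N h p else 0 := fun p q =>
      congrFun (pairing_fixedComul e N h) (p, q)
    simp_rw [hd]
    simp
  map_one h := by
    apply Subtype.ext
    rw [coe_fixedAction, toLinearMaps_apply]
    refine Eq.trans ?_ (algebraMap_fixedCounit e N h).symm
    exact Finset.sum_congr rfl fun π _ => by rw [map_one, mul_one]
  bijective := by
    have hinj := fixedAction_injective e N hreg
    refine ⟨hinj, (LinearMap.injective_iff_surjective_of_finrank_eq_finrank ?_).1 hinj⟩
    rw [Module.finrank_tensorProduct, Module.finrank_linearMap, finrank_fixedSubalgebra e N hN.out,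
      Nat.card_congr (Equiv.ofBijective _ (hreg.bijective (basePoint e))), Nat.card_eq_fintype_card,
      card_eq_finrank e]

/-- The structure attached to `N` has the Hopf algebra `Kt[N]^G`, with its action. -/
def fixedRealization (hreg : IsRegular N) : Realization e N (fixedStructure e N hreg) where
  ι := (fixedSubalgebra e N).val
  injective := Subtype.val_injective
  range_eq := by
    ext a
    simp only [Set.mem_range]
    exact ⟨fun ⟨h, hh⟩ => hh ▸ h.2, fun ha => ⟨⟨a, ha⟩, rfl⟩⟩
  comul_eq h := (comul_eq_iff (fixedSubalgebra e N).val.toLinearMap _ _).2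
    (pairing_fixedComul e N h)
  counit_eq h := by
    rw [counit_eq_sum]
    exact (algebraMap_fixedCounit e N h).symm
  action_eq h x := (coeff_sum_eq e _ x).symm

end FixedStructure

/-! ### Rows of an arbitrary Hopf Galois structure -/

section Rows

variable {k : Type u} {Kt : Type v} [Field k] [Field Kt] [Algebra k Kt]
variable [FiniteDimensional k Kt] [IsGalois k Kt]
variable {G' : Subgroup Gal(Kt/k)} {X : Type} (e : Gal(Kt/k) ⧸ G' ≃ X) [Fintype X]

theorem eq_of_sum_emb_eq {f f' : X → Kt}
    (h : ∀ y : IntermediateField.fixedField G', ∑ x, f x * emb e x y = ∑ x, f' x * emb e x y) :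
    f = f' := by
  have hind := Fintype.linearIndependent_iff.1 (linearIndependent_emb e) (fun x => f x - f' x) (by
    ext y
    have := sub_eq_zero.2 (h y)
    rw [← Finset.sum_sub_distrib] at this
    simpa [sub_mul] using this)
  ext x
  exact sub_eq_zero.1 (hind x)

variable (T : HopfGaloisStructure.{u, v, w} k (IntermediateField.fixedField G'))

/-- The coordinates of `emb e c ∘ T.μ h` with respect to the embeddings of `Kt^{G'}`. -/
def rowMap (c : X) : T.H →ₗ[k] X → Kt where
  toFun h := (embBasis e).equivFun ((emb e c).toLinearMap ∘ₗ T.μ h)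
  map_add' h h' := by rw [map_add, LinearMap.comp_add, map_add]
  map_smul' a h := by
    rw [map_smul, LinearMap.comp_smul, ← algebraMap_smul Kt a, map_smul, algebraMap_smul]
    rfl

theorem emb_mu (c : X) (h : T.H) (y : IntermediateField.fixedField G') :
    emb e c (T.μ h y) = ∑ x, rowMap e T c h x * emb e x y := by
  have := LinearMap.congr_fun ((embBasis e).sum_equivFun ((emb e c).toLinearMap ∘ₗ T.μ h)) y
  refine Eq.trans this.symm ?_
  simp [rowMap]

theorem apply_rowMap (g : Gal(Kt/k)) (c x : X) (h : T.H) :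
    g (rowMap e T c h x) = rowMap e T (leftTranslation e g c) h (leftTranslation e g x) := by
  have := congrFun (eq_of_sum_emb_eq e (f := fun x => g (rowMap e T c h (leftTranslation e g⁻¹ x)))
    (f' := rowMap e T (leftTranslation e g c) h) fun y => ?_) (leftTranslation e g x)
  · simpa using this
  · rw [← emb_mu, ← apply_emb, emb_mu, map_sum]
    refine Fintype.sum_equiv (leftTranslation e g⁻¹) _ _ fun x => ?_
    rw [map_mul, apply_emb]
    simp

variable [DecidableEq X]

/-- Expand `emb c (μ h (y * z))` in two ways, directly and through `Δ h` by the module algebra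
axiom, then compare coefficients in `z` and in `y` separately. Thus every row is a coalgebra map to
`X → Kt` with group-like delta functions. -/
theorem pairing_rowMap (c : X) (h : T.H) :
    pairing (rowMap e T c) (rowMap e T c) (Coalgebra.comul (R := k) h) =
      diag (k := k) (rowMap e T c h) := by
  have key : ∀ y z : IntermediateField.fixedField G', ∑ i, ∑ j,
      pairing (rowMap e T c) (rowMap e T c) (Coalgebra.comul (R := k) h) (i, j) *
        (emb e i y * emb e j z) =
      ∑ i, ∑ j, diag (k := k) (rowMap e T c h) (i, j) * (emb e i y * emb e j z) := by
    intro y z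
    rw [← apply_mul'_map (θ := emb e c) (E := rowMap e T c) (μ := T.μ.toLinearMap)
      (F := fun i y => emb e i y) (fun h y => emb_mu e T c h y), ← T.map_mul, emb_mu]
    simp [diag_apply]
  have h1 : ∀ z j, ∑ i, pairing (rowMap e T c) (rowMap e T c) (Coalgebra.comul (R := k) h) (i, j) * emb e i z =
    ∑ i, diag (k := k) (rowMap e T c h) (i, j) * emb e i z := by
    intro y j
    refine congrFun (eq_of_sum_emb_eq e (f := fun j => ∑ i, pairing (rowMap e T c) (rowMap e T c)
      (Coalgebra.comul (R := k) h) (i, j) * emb e i y) (f' := fun j =>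
      ∑ i, diag (k := k) (rowMap e T c h) (i, j) * emb e i y) fun z => ?_) j
    simp only [Finset.sum_mul, mul_assoc]
    rw [Finset.sum_comm, key, Finset.sum_comm]
  ext ⟨i, j⟩
  exact congrFun (eq_of_sum_emb_eq e fun z => h1 z j) i

/-- A functional killing all rows kills `emb c ∘ (y · μ h)`, hence `emb c ∘ f` for every `f ∈
End_k(K)` by surjectivity of `K ⊗ H → End_k(K)`. Those maps span `Hom_k(K, Kt)` over `Kt`. -/
theorem span_range_rowMap (c : X) : Submodule.span Kt (Set.range (rowMap e T c)) = ⊤ := by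
  by_contra htop
  obtain ⟨φ, hφ, hle⟩ := Submodule.exists_le_ker_of_lt_top _ (lt_top_iff_ne_top.2 htop)
  let Z : (IntermediateField.fixedField G' →ₗ[k] Kt) →ₗ[Kt] Kt :=
    φ ∘ₗ (embBasis e).equivFun.toLinearMap
  have h1 : ∀ h : T.H, Z ((emb e c).toLinearMap ∘ₗ T.μ h) = 0 := fun h =>
    hle (Submodule.subset_span ⟨h, rfl⟩)
  have h2 : ∀ z : IntermediateField.fixedField G' ⊗[k] T.H, Z ((emb e c).toLinearMap ∘ₗ
      (TensorProduct.lift ((LinearMap.mul k (Module.End k (IntermediateField.fixedField G'))).compl₁₂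
        (Algebra.lmul k (IntermediateField.fixedField G')).toLinearMap T.μ.toLinearMap) z)) = 0 := by
    intro z
    induction z with
    | zero => simp
    | add z z' hz hz' => rw [map_add, LinearMap.comp_add, map_add, hz, hz', add_zero]
    | tmul y h =>
      have : (emb e c).toLinearMap ∘ₗ (TensorProduct.lift
          ((LinearMap.mul k (Module.End k (IntermediateField.fixedField G'))).compl₁₂
          (Algebra.lmul k (IntermediateField.fixedField G')).toLinearMap T.μ.toLinearMap) (y ⊗ₜ h)) =
          emb e c y • ((emb e c).toLinearMap ∘ₗ T.μ h) := by
        ext x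
        simp
      rw [this, map_smul, h1, smul_zero]
  have h3 : ∀ f : Module.End k (IntermediateField.fixedField G'),
      Z ((emb e c).toLinearMap ∘ₗ f) = 0 := by
    intro f
    obtain ⟨z, rfl⟩ := T.bijective.2 f
    exact h2 z
  apply hφ
  have h4 : ∀ f : IntermediateField.fixedField G' →ₗ[k] Kt, Z f = 0 := by
    intro f
    let b := Module.finBasis k (IntermediateField.fixedField G')
    -- The endomorphism `y ↦ b.coord j y • 1` takes values in `k`, where `emb c` is the identity, so
    -- composing with `emb c` gives the dual basis of `b`.
    have : f = ∑ j, f (b j) • ((emb e c).toLinearMap ∘ₗ (b.coord j).smulRight 1) := by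
      refine b.ext fun i => ?_
      simp [Finsupp.single_apply]
    rw [this, map_sum]
    exact Finset.sum_eq_zero fun j _ => by rw [map_smul, h3, smul_zero]
  refine LinearMap.ext fun f => ?_
  have := h4 ((embBasis e).equivFun.symm f)
  rwa [show Z _ = φ f from congrArg φ (LinearEquiv.apply_symm_apply _ _)] at this

theorem rowMap_mul (c : X) (h h' : T.H) (x : X) :
    rowMap e T c (h * h') x = ∑ d, rowMap e T c h d * rowMap e T d h' x := by
  refine congrFun (eq_of_sum_emb_eq e (f := rowMap e T c (h * h'))
    (f' := fun x => ∑ d, rowMap e T c h d * rowMap e T d h' x) fun y => ?_) x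
  rw [← emb_mu, map_mul, Module.End.mul_apply, emb_mu]
  simp_rw [emb_mu, Finset.mul_sum, Finset.sum_mul]
  rw [Finset.sum_comm]
  simp only [mul_assoc]

theorem rowMap_one (c x : X) : rowMap e T c 1 x = if c = x then 1 else 0 := by
  refine congrFun (eq_of_sum_emb_eq e (f := rowMap e T c 1)
    (f' := fun x => if c = x then 1 else 0) fun y => ?_) x
  rw [← emb_mu, map_one]
  simp

theorem sum_rowMap (c : X) (h : T.H) :
    ∑ x, rowMap e T c h x = algebraMap k Kt (Coalgebra.counit h) := by
  have := emb_mu e T c h 1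
  rw [T.map_one, AlgHom.commutes] at this
  rw [this]
  simp

theorem finrank_H (T : HopfGaloisStructure.{u, v, w} k (IntermediateField.fixedField G')) :
    Module.finrank k T.H = Module.finrank k (IntermediateField.fixedField G') := by
  have := (LinearEquiv.ofBijective _ T.bijective).finrank_eq
  rw [Module.finrank_tensorProduct, Module.finrank_linearMap] at this
  exact Nat.eq_of_mul_eq_mul_left Module.finrank_pos this

/-- The entries of the rows, as functionals on the Hopf algebra. -/
def entry (c x : X) : T.H →ₗ[k] Kt := LinearMap.proj x ∘ₗ rowMap e T c

theorem entry_apply (c x : X) (h : T.H) : entry e T c x h = rowMap e T c h x := rfl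

/-- Dual to the spanning of the rows: a relation among the entries is a functional on `X → Kt` that
kills every row. -/
theorem linearIndependent_entry (c : X) : LinearIndependent Kt (entry e T c) := by
  rw [Fintype.linearIndependent_iff]
  intro z hz
  let φ : (X → Kt) →ₗ[Kt] Kt := Fintype.linearCombination Kt z
  have h1 : ∀ f, φ f = 0 := by
    intro f
    have hf : f ∈ Submodule.span Kt (Set.range (rowMap e T c)) := by
      rw [span_range_rowMap]; trivial
    have hle : Submodule.span Kt (Set.range (rowMap e T c)) ≤ LinearMap.ker φ := by
      rw [Submodule.span_le]
      rintro _ ⟨h, rfl⟩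
      have := LinearMap.congr_fun hz h
      simp only [LinearMap.sum_apply, LinearMap.smul_apply, LinearMap.zero_apply] at this
      change φ _ = 0
      rw [Fintype.linearCombination_apply, ← this]
      exact Finset.sum_congr rfl fun i _ => mul_comm _ _
    exact hle hf
  intro i
  have := h1 (Pi.single i 1)
  simpa [φ, Fintype.linearCombination_apply, Pi.single_apply] using this

theorem eq_of_sum_entry_eq (c : X) {z z' : X → Kt}
    (h : ∀ a : T.H, ∑ x, z x * rowMap e T c a x = ∑ x, z' x * rowMap e T c a x) : z = z' := by
  have hind := Fintype.linearIndependent_iff.1 (linearIndependent_entry e T c)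
    (fun x => z x - z' x) (by
    ext a
    have := sub_eq_zero.2 (h a)
    rw [← Finset.sum_sub_distrib] at this
    simpa [sub_mul, entry_apply] using this)
  ext x
  exact sub_eq_zero.1 (hind x)

/-- The entries of the row of the base point form a basis. -/
def entryBasis : Module.Basis X Kt (T.H →ₗ[k] Kt) :=
  haveI : Nonempty X := ⟨basePoint e⟩
  basisOfLinearIndependentOfCardEqFinrank (linearIndependent_entry e T (basePoint e)) (by
    rw [card_eq_finrank e, Module.finrank_linearMap_self, finrank_H])

/-- The coordinates of the entries with respect to the row of the base point. -/
def coord (c x d : X) : Kt := (entryBasis e T).repr (entry e T c x) d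

theorem rowMap_eq_sum_coord (c x : X) (h : T.H) :
    rowMap e T c h x = ∑ d, coord e T c x d * rowMap e T (basePoint e) h d := by
  have := LinearMap.congr_fun ((entryBasis e T).sum_repr (entry e T c x)) h
  rw [entry_apply] at this
  rw [← this, LinearMap.sum_apply]
  refine Finset.sum_congr rfl fun d _ => ?_
  rw [LinearMap.smul_apply, smul_eq_mul]
  congr 1
  simp [entryBasis, entry_apply]

end Rows

section Decomposition

variable {k : Type u} {L : Type v} [Field k] [Field L] [Algebra k L]
variable {I J J' : Type*} {V : Type w} [AddCommGroup V] [Module k V]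

theorem pairing_apply_of_sum [Fintype I] {E : V →ₗ[k] I → L} {F : V →ₗ[k] J → L}
    {F' : V →ₗ[k] J' → L} {a : J → I → L} {a' : J' → I → L}
    (hF : ∀ v j, F v j = ∑ i, a j i * E v i) (hF' : ∀ v j, F' v j = ∑ i, a' j i * E v i)
    (z : V ⊗[k] V) (j : J) (j' : J') :
    pairing F F' z (j, j') = ∑ i, ∑ i', a j i * a' j' i' * pairing E E z (i, i') := by
  induction z with
  | zero => simp
  | add z z' hz hz' => simp only [map_add, hz, hz', Pi.add_apply, mul_add, Finset.sum_add_distrib]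
  | tmul v w =>
    rw [pairing_tmul, hF, hF', Finset.sum_mul_sum]
    refine Finset.sum_congr rfl fun i _ => Finset.sum_congr rfl fun i' _ => ?_
    rw [pairing_tmul]
    ring

end Decomposition

/-! ### The permutation group of a Hopf Galois structure -/

section Permutations

variable {k : Type u} {Kt : Type v} [Field k] [Field Kt] [Algebra k Kt]
variable [FiniteDimensional k Kt] [IsGalois k Kt]
variable {G' : Subgroup Gal(Kt/k)} {X : Type} (e : Gal(Kt/k) ⧸ G' ≃ X) [Fintype X] [DecidableEq X]
variable (T : HopfGaloisStructure.{u, v, w} k (IntermediateField.fixedField G'))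

/-- The row of `c` and the base row are both coalgebra maps, and comparing their diagonals gives
orthogonal idempotents for each fixed `d`. Counits show that they sum to `1`, so in the field `Kt`
exactly one of them is `1` and the others are `0`. -/
theorem coord_mul_coord (c x x' d : X) :
    coord e T c x d * coord e T c x' d = if x = x' then coord e T c x d else 0 := by
  refine congrFun (eq_of_sum_entry_eq e T (basePoint e)
    (z := fun d => coord e T c x d * coord e T c x' d)
    (z' := fun d => if x = x' then coord e T c x d else 0) fun h => ?_) d
  have h1 := pairing_apply_of_sum (E := rowMap e T (basePoint e)) (F := rowMap e T c)
    (F' := rowMap e T c) (fun v j => rowMap_eq_sum_coord e T c j v)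
    (fun v j => rowMap_eq_sum_coord e T c j v) (Coalgebra.comul (R := k) h) x x'
  rw [pairing_rowMap, pairing_rowMap, diag_apply] at h1
  simp only [diag_apply, mul_ite, mul_zero, Finset.sum_ite_eq, Finset.mem_univ, if_true] at h1
  rw [← h1]
  split_ifs
  · rw [rowMap_eq_sum_coord]
  · simp

theorem sum_coord (c d : X) : ∑ x, coord e T c x d = 1 := by
  refine congrFun (eq_of_sum_entry_eq e T (basePoint e) (z := fun d => ∑ x, coord e T c x d)
    (z' := fun _ => 1) fun h => ?_) d
  simp_rw [one_mul, Finset.sum_mul]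
  rw [Finset.sum_comm]
  simp_rw [← rowMap_eq_sum_coord, sum_rowMap]

theorem exists_coord_eq (c d : X) : ∃ x, ∀ x', coord e T c x' d = if x = x' then 1 else 0 := by
  obtain ⟨x, _, hx⟩ := Finset.exists_ne_zero_of_sum_ne_zero
    (show ∑ x, coord e T c x d ≠ 0 by rw [sum_coord]; exact one_ne_zero)
  refine ⟨x, fun x' => ?_⟩
  have h := coord_mul_coord e T c x x' d
  split_ifs with hxx
  · subst hxx
    rw [if_pos rfl] at h
    exact mul_left_cancel₀ hx (by rw [h, mul_one])
  · rw [if_neg hxx] at h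
    exact (mul_eq_zero.1 h).resolve_left hx

/-- The self-map of the set of cosets by which the group-like element with number `d` acts. -/
def shift (d c : X) : X := (exists_coord_eq e T c d).choose

theorem coord_eq (c d x : X) : coord e T c x d = if shift e T d c = x then 1 else 0 :=
  (exists_coord_eq e T c d).choose_spec x

theorem rowMap_eq_sum_shift (c x : X) (h : T.H) : rowMap e T c h x =
    ∑ d, (if shift e T d c = x then 1 else 0) * rowMap e T (basePoint e) h d := by
  rw [rowMap_eq_sum_coord]
  simp_rw [coord_eq]

@[simp]
theorem shift_basePoint (d : X) : shift e T d (basePoint e) = d := by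
  have h := congrFun (eq_of_sum_entry_eq e T (basePoint e)
    (z := fun d' => if d' = d then 1 else 0)
    (z' := fun d' => if shift e T d' (basePoint e) = d then 1 else 0) fun h => by
      rw [← rowMap_eq_sum_shift]; simp) d
  by_contra hne
  simp [hne] at h

theorem exists_shift_eq (c x : X) : ∃ d, shift e T d c = x := by
  by_contra! hne
  refine (linearIndependent_entry e T c).ne_zero x ?_
  ext h
  rw [entry_apply, rowMap_eq_sum_shift]
  simp [hne]

theorem shift_one (c : X) : shift e T (basePoint e) c = c := by
  have h := rowMap_one e T c c
  rw [rowMap_eq_sum_shift] at h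
  simp_rw [rowMap_one] at h
  by_contra hne
  simp [hne] at h

theorem rowMap_mul_eq_sum (b x : X) (h h' : T.H) : rowMap e T b (h * h') x =
    ∑ d, ∑ d', (if shift e T d' (shift e T d b) = x then 1 else 0) *
      (rowMap e T (basePoint e) h d * rowMap e T (basePoint e) h' d') := by
  rw [rowMap_mul]
  have h1 : ∀ c, rowMap e T b h c * rowMap e T c h' x = ∑ d, if shift e T d b = c then
      rowMap e T (basePoint e) h d * rowMap e T c h' x else 0 := fun c => by
    rw [rowMap_eq_sum_shift, Finset.sum_mul]
    exact Finset.sum_congr rfl fun d _ => by split_ifs <;> simp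
  simp_rw [h1]
  rw [Finset.sum_comm]
  refine Finset.sum_congr rfl fun d _ => ?_
  rw [Finset.sum_ite_eq, if_pos (Finset.mem_univ _), rowMap_eq_sum_shift e T (shift e T d b),
    Finset.mul_sum]
  exact Finset.sum_congr rfl fun d' _ => by ring

/-- The row of `b` of a product `h * h'` can be computed by composing the two endomorphisms, or by
expanding `h * h'` along the base row. The entries of that row are independent, so the coefficients
at `d` and `d'` agree. -/
theorem shift_shift (d d' b : X) :
    shift e T d' (shift e T d b) = shift e T (shift e T d' d) b := by
  have key : ∀ x h h', ∑ d, ∑ d', (if shift e T d' (shift e T d b) = x then 1 else 0) *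
      (rowMap e T (basePoint e) h d * rowMap e T (basePoint e) h' d') =
      ∑ d, ∑ d', (if shift e T (shift e T d' d) b = x then 1 else 0) *
      (rowMap e T (basePoint e) h d * rowMap e T (basePoint e) h' d') := by
    intro x h h'
    rw [← rowMap_mul_eq_sum, rowMap_eq_sum_shift]
    simp_rw [rowMap_mul_eq_sum, shift_basePoint, Finset.mul_sum]
    rw [Finset.sum_comm]
    refine Finset.sum_congr rfl fun d _ => ?_
    rw [Finset.sum_comm]
    refine Finset.sum_congr rfl fun d' _ => ?_
    simp_rw [← mul_assoc, ← Finset.sum_mul]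
    congr 2
    simp
  have h1 : ∀ x h', (fun d => ∑ d', (if shift e T d' (shift e T d b) = x then 1 else 0) *
      rowMap e T (basePoint e) h' d') = fun d => ∑ d',
      (if shift e T (shift e T d' d) b = x then 1 else 0) * rowMap e T (basePoint e) h' d' := by
    intro x h'
    refine eq_of_sum_entry_eq e T (basePoint e) fun h => ?_
    have := key x h h'
    simp only [Finset.sum_mul]
    refine Eq.trans ?_ (this.trans ?_) <;>
    exact Finset.sum_congr rfl fun d _ => Finset.sum_congr rfl fun d' _ => by ring
  have h2 := congrFun (eq_of_sum_entry_eq e T (basePoint e) fun h' =>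
    congrFun (h1 (shift e T d' (shift e T d b)) h') d) d'
  by_contra hne
  simp [Ne.symm hne] at h2

theorem exists_shift_shift (d : X) : ∃ d', ∀ c, shift e T d' (shift e T d c) = c := by
  obtain ⟨d', hd'⟩ := exists_shift_eq e T d (basePoint e)
  exact ⟨d', fun c => by rw [shift_shift, hd', shift_one]⟩

theorem shift_injective (d : X) : Function.Injective (shift e T d) := by
  obtain ⟨d', hd'⟩ := exists_shift_shift e T d
  exact Function.LeftInverse.injective hd'

/-- The subgroup of the symmetric group attached to a Hopf Galois structure. -/
def permGroup : Subgroup (Equiv.Perm X) where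
  -- The shift is required of `π⁻¹`, not of `π`, to match the inverse in the action formula.
  carrier := {π | ∀ c, π⁻¹ c = shift e T (π⁻¹ (basePoint e)) c}
  mul_mem' {π ρ} hπ hρ c := by
    rw [mul_inv_rev, Equiv.Perm.mul_apply, Equiv.Perm.mul_apply, hρ, hπ, shift_shift,
      ← hρ (π⁻¹ (basePoint e))]
  one_mem' c := by simp [shift_one]
  inv_mem' {π} hπ c := by
    obtain ⟨d', hd'⟩ := exists_shift_shift e T (π⁻¹ (basePoint e))
    have h : ∀ c, shift e T d' c = π c := fun c => by
      have := hd' (π c)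
      rwa [← hπ, show π⁻¹ (π c) = c from π.symm_apply_apply c] at this
    rw [inv_inv, ← h, ← h (basePoint e), shift_basePoint]

theorem exists_mem_permGroup (d : X) : ∃ π ∈ permGroup e T, ∀ c, π⁻¹ c = shift e T d c := by
  let ρ := Equiv.ofBijective _ (Finite.injective_iff_bijective.1 (shift_injective e T d))
  have h : ∀ c, (ρ⁻¹)⁻¹ c = shift e T d c := fun c => by rw [inv_inv]; rfl
  refine ⟨ρ⁻¹, fun c => ?_, h⟩
  rw [h, h, shift_basePoint]

/-- A fixed point of a group element can be carried to the base point by conjugation within the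
group, and there a shift is determined by its value. -/
theorem isRegular_permGroup : IsRegular (permGroup e T) := by
  have hfix : ∀ π ∈ permGroup e T, ∀ x, π x = x → π = 1 := by
    intro π hπ x hx
    obtain ⟨d, hd⟩ := exists_shift_eq e T (basePoint e) x
    obtain ⟨ρ, hρ, hρd⟩ := exists_mem_permGroup e T d
    have h1 := (permGroup e T).mul_mem ((permGroup e T).mul_mem hρ hπ) ((permGroup e T).inv_mem hρ)
    have h2 : (ρ * π * ρ⁻¹)⁻¹ (basePoint e) = basePoint e := by
      rw [Equiv.Perm.inv_eq_iff_eq, Equiv.Perm.mul_apply, Equiv.Perm.mul_apply, hρd, hd, hx, ← hd,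
        ← hρd]
      exact (ρ.apply_symm_apply _).symm
    have h3 : (ρ * π * ρ⁻¹)⁻¹ = 1 := by
      ext c
      rw [h1 c, h2, shift_one]
      rfl
    rwa [inv_eq_one, mul_inv_eq_one, mul_eq_left] at h3
  intro x y
  obtain ⟨d, hd⟩ := exists_shift_eq e T y x
  obtain ⟨π, hπ, hπd⟩ := exists_mem_permGroup e T d
  refine ⟨π, ⟨hπ, ?_⟩, fun π' hπ' => ?_⟩
  · rw [← hd, ← hπd]
    exact π.apply_symm_apply y
  · have := hfix (π⁻¹ * π') ((permGroup e T).mul_mem ((permGroup e T).inv_mem hπ) hπ'.1) x (by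
      rw [Equiv.Perm.mul_apply, hπ'.2, hπd, hd])
    exact (inv_mul_eq_one.1 this).symm

/-- Only one group element takes `c` to `π⁻¹ c` under inversion, so every row is a permuted copy of
the base row and the coefficient of `π` can be read off in any of them. -/
theorem rowMap_inv {π : Equiv.Perm X} (hπ : π ∈ permGroup e T) (c : X) (h : T.H) :
    rowMap e T c h (π⁻¹ c) = rowMap e T (basePoint e) h (π⁻¹ (basePoint e)) := by
  rw [rowMap_eq_sum_shift, Finset.sum_eq_single (π⁻¹ (basePoint e))]
  · rw [← hπ c, if_pos rfl, one_mul]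
  · intro d _ hd
    rw [if_neg, zero_mul]
    intro hc
    obtain ⟨ρ, hρ, hρd⟩ := exists_mem_permGroup e T d
    rw [← hρd] at hc
    have := ((isRegular_permGroup e T).bijective c).1 (a₁ := ⟨ρ, hρ⟩) (a₂ := ⟨π, hπ⟩) hc
    apply hd
    rw [← congrArg (fun π : permGroup e T => (π⁻¹ : Equiv.Perm X) (basePoint e)) this]
    change _ = ρ⁻¹ _
    rw [hρd, shift_basePoint]
  · simp

end Permutations

/-! ### Every structure comes from its permutation group -/

section PermRealization

variable {k : Type u} {Kt : Type v} [Field k] [Field Kt] [Algebra k Kt]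
variable [FiniteDimensional k Kt] [IsGalois k Kt]
variable {G' : Subgroup Gal(Kt/k)} {X : Type} (e : Gal(Kt/k) ⧸ G' ≃ X) [Fintype X] [DecidableEq X]
variable (T : HopfGaloisStructure.{u, v, w} k (IntermediateField.fixedField G'))

theorem rowMap_basePoint_inv {π : Equiv.Perm X} (hπ : π ∈ permGroup e T) (g : Gal(Kt/k)) (h : T.H) :
    g (rowMap e T (basePoint e) h (π⁻¹ (basePoint e))) = rowMap e T (basePoint e) h
      ((leftTranslation e g * π * (leftTranslation e g)⁻¹)⁻¹ (basePoint e)) := by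
  rw [← rowMap_inv e T hπ (leftTranslation e g⁻¹ (basePoint e)), apply_rowMap]
  rw [← Equiv.Perm.mul_apply (leftTranslation e g) (leftTranslation e g⁻¹), ← map_mul,
    mul_inv_cancel, map_one, Equiv.Perm.one_apply]
  simp

/-- The entry along `π⁻¹` does not depend on the row, and the Galois group transports this to the
conjugate of `π`. The element `ρ` of the group that agrees with the conjugate at the base point has
the same entries in every row; since the entries of a row are independent, the two permutations
agree. -/
theorem isNormalized_permGroup : IsNormalized e (permGroup e T) := by
  have key : ∀ g, ∀ π ∈ permGroup e T,
      leftTranslation e g * π * (leftTranslation e g)⁻¹ ∈ permGroup e T := by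
    intro g π hπ c
    obtain ⟨ρ, ⟨hρ, hρ'⟩, _⟩ := isRegular_permGroup e T
      ((leftTranslation e g * π * (leftTranslation e g)⁻¹)⁻¹ (basePoint e)) (basePoint e)
    have h1 : ρ⁻¹ (basePoint e) =
        (leftTranslation e g * π * (leftTranslation e g)⁻¹)⁻¹ (basePoint e) :=
      Equiv.Perm.inv_eq_iff_eq.2 hρ'.symm
    rw [← h1, ← hρ c]
    refine (linearIndependent_entry e T c).injective ?_
    ext h
    rw [entry_apply, entry_apply, rowMap_inv e T hρ, h1, ← rowMap_basePoint_inv e T hπ,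
      ← rowMap_inv e T hπ (leftTranslation e g⁻¹ c), apply_rowMap]
    rw [← Equiv.Perm.mul_apply (leftTranslation e g) (leftTranslation e g⁻¹), ← map_mul,
      mul_inv_cancel, map_one, Equiv.Perm.one_apply]
    simp
  rintro _ ⟨g, rfl⟩
  rw [Subgroup.mem_normalizer_iff]
  refine fun π => ⟨key g π, fun h => ?_⟩
  have := key g⁻¹ _ h
  simpa [mul_assoc] using this

open Classical in
/-- The coefficients of an element of the Hopf algebra with respect to its group-like elements. -/
def permCoeffs : T.H →ₗ[k] Equiv.Perm X → Kt where
  toFun h π := if π ∈ permGroup e T then rowMap e T (basePoint e) h (π⁻¹ (basePoint e)) else 0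
  map_add' h h' := by
    ext π
    simp only [map_add, Pi.add_apply]
    split_ifs <;> simp
  map_smul' c h := by
    ext π
    simp only [map_smul, Pi.smul_apply]
    split_ifs <;> simp

theorem permCoeffs_of_mem {π : Equiv.Perm X} (hπ : π ∈ permGroup e T) (h : T.H) :
    permCoeffs e T h π = rowMap e T (basePoint e) h (π⁻¹ (basePoint e)) := if_pos hπ

theorem permCoeffs_of_notMem {π : Equiv.Perm X} (hπ : π ∉ permGroup e T) (h : T.H) :
    permCoeffs e T h π = 0 := if_neg hπ

theorem permCoeffs_mem (h : T.H) : permCoeffs e T h ∈ equivariant (conjAction e) := by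
  intro g π
  have hiff : conjAction e g π ∈ permGroup e T ↔ π ∈ permGroup e T :=
    (Subgroup.mem_normalizer_iff.1 (isNormalized_permGroup e T ⟨g, rfl⟩) π).symm
  by_cases hπ : π ∈ permGroup e T
  · rw [permCoeffs_of_mem e T hπ, permCoeffs_of_mem e T (hiff.2 hπ), rowMap_basePoint_inv e T hπ]
    rfl
  · rw [permCoeffs_of_notMem e T hπ, permCoeffs_of_notMem e T fun h => hπ (hiff.1 h), map_zero]

theorem sum_permGroup_eq (F : Equiv.Perm X → Kt) (F' : X → Kt)
    (h0 : ∀ π, π ∉ permGroup e T → F π = 0)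
    (h1 : ∀ π ∈ permGroup e T, F π = F' (π⁻¹ (basePoint e))) : ∑ π, F π = ∑ x, F' x := by
  classical
  rw [← Finset.sum_subset (Finset.subset_univ (Finset.univ.filter (· ∈ permGroup e T)))]
  · rw [Finset.sum_subtype (p := (· ∈ permGroup e T))]
    · exact Fintype.sum_bijective _ ((isRegular_permGroup e T).bijective (basePoint e)) _ _
        fun π => h1 π π.2
    · simp
  · intro π _ hπ
    exact h0 π (by simpa using hπ)

/-- The embedding of the Hopf algebra of `T` into the group algebra. -/
def permHom : T.H →ₐ[k] fixedSubalgebra e (permGroup e T) :=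
  AlgHom.ofLinearMap
    { toFun := fun h => ofCoeffs e _ (permCoeffs e T h) (fun _ hπ => permCoeffs_of_notMem e T hπ h)
        (permCoeffs_mem e T h)
      map_add' := fun h h' => by
        apply fixedCoeffs_injective
        exact map_add (permCoeffs e T) h h'
      map_smul' := fun c h => by
        apply fixedCoeffs_injective
        exact map_smul (permCoeffs e T) c h }
    (by
      apply fixedCoeffs_injective
      ext π
      change permCoeffs e T 1 π = (1 : MonoidAlgebra Kt (Equiv.Perm X)).coeff π
      rw [MonoidAlgebra.one_def, MonoidAlgebra.coeff_single, Finsupp.single_apply]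
      by_cases hπ : π ∈ permGroup e T
      · rw [permCoeffs_of_mem e T hπ, rowMap_one]
        refine if_congr ⟨fun h => ?_, fun h => by simp [← h]⟩ rfl rfl
        exact congrArg Subtype.val (((isRegular_permGroup e T).bijective (basePoint e)).1
          (a₁ := 1) (a₂ := ⟨π, hπ⟩) (by simpa using h))
      · rw [permCoeffs_of_notMem e T hπ, if_neg]
        rintro rfl
        exact hπ (one_mem _))
    (fun h h' => by
      apply fixedCoeffs_injective
      ext π
      change permCoeffs e T (h * h') π = (_ * _ : MonoidAlgebra Kt (Equiv.Perm X)).coeff π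
      rw [coeff_mul_eq_sum]
      change _ = ∑ q, permCoeffs e T h q * permCoeffs e T h' (q⁻¹ * π)
      by_cases hπ : π ∈ permGroup e T
      · rw [permCoeffs_of_mem e T hπ, rowMap_mul]
        refine (sum_permGroup_eq e T _ _ (fun q hq => ?_) fun q hq => ?_).symm
        · rw [permCoeffs_of_notMem e T hq, zero_mul]
        · have hm := mul_mem (inv_mem hq) hπ
          rw [permCoeffs_of_mem e T hq, permCoeffs_of_mem e T hm,
            ← rowMap_inv e T hm (q⁻¹ (basePoint e))]
          simp
      · rw [permCoeffs_of_notMem e T hπ, eq_comm]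
        refine Finset.sum_eq_zero fun q _ => ?_
        by_cases hq : q ∈ permGroup e T
        · rw [permCoeffs_of_notMem e T (π := q⁻¹ * π), mul_zero]
          exact fun hm => hπ (by simpa using mul_mem hq hm)
        · rw [permCoeffs_of_notMem e T hq, zero_mul])

theorem fixedCoeffs_permHom (h : T.H) :
    fixedCoeffs e _ (permHom e T h) = permCoeffs e T h := rfl

theorem permHom_injective : Function.Injective (permHom e T) := by
  refine (injective_iff_map_eq_zero _).2 fun h hh => ?_
  have h1 : ∀ x, rowMap e T (basePoint e) h x = 0 := by
    intro x
    obtain ⟨π, hπ, hπx⟩ := exists_mem_permGroup e T x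
    have := congrFun (congrArg (fixedCoeffs e _) hh) π
    rw [fixedCoeffs_permHom, permCoeffs_of_mem e T hπ, hπx, shift_basePoint] at this
    exact this
  have h2 : T.μ h = 0 := by
    ext y
    rw [← emb_basePoint e (T.μ h y), emb_mu]
    simp [h1]
  have h3 := T.bijective.1 (a₁ := 1 ⊗ₜ h) (a₂ := 0) (by
    rw [map_zero, TensorProduct.lift.tmul]
    change _ * T.μ h = 0
    rw [h2, mul_zero])
  exact Algebra.TensorProduct.includeRight_injective
    (FaithfulSMul.algebraMap_injective k (IntermediateField.fixedField G')) (h3.trans (map_zero _).symm)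

theorem permHom_surjective : Function.Surjective (permHom e T) := by
  refine (LinearMap.injective_iff_surjective_of_finrank_eq_finrank
    (f := (permHom e T).toLinearMap) ?_).1 (permHom_injective e T)
  rw [finrank_fixedSubalgebra e _ (isNormalized_permGroup e T), finrank_H,
    Nat.card_congr (Equiv.ofBijective _ ((isRegular_permGroup e T).bijective (basePoint e))),
    Nat.card_eq_fintype_card, card_eq_finrank e]

theorem pairing_permCoeffs (z : T.H ⊗[k] T.H) (π ρ : Equiv.Perm X) :
    pairing (permCoeffs e T) (permCoeffs e T) z (π, ρ) =
      open Classical in if π ∈ permGroup e T ∧ ρ ∈ permGroup e T then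
        pairing (rowMap e T (basePoint e)) (rowMap e T (basePoint e)) z
          (π⁻¹ (basePoint e), ρ⁻¹ (basePoint e)) else 0 := by
  classical
  induction z with
  | zero => simp
  | add z z' hz hz' =>
    rw [map_add, map_add, Pi.add_apply, Pi.add_apply, hz, hz']
    split_ifs <;> simp
  | tmul v w =>
    rw [pairing_tmul, pairing_tmul]
    by_cases hπ : π ∈ permGroup e T
    · by_cases hρ : ρ ∈ permGroup e T
      · rw [if_pos ⟨hπ, hρ⟩, permCoeffs_of_mem e T hπ, permCoeffs_of_mem e T hρ]
      · rw [if_neg fun h => hρ h.2, permCoeffs_of_notMem e T hρ, mul_zero]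
    · rw [if_neg fun h => hπ h.1, permCoeffs_of_notMem e T hπ, zero_mul]

/-- Every Hopf Galois structure is the one attached to its group of permutations. -/
def permRealization : Realization e (permGroup e T) T where
  ι := (fixedSubalgebra e (permGroup e T)).val.comp (permHom e T)
  injective := Subtype.val_injective.comp (permHom_injective e T)
  range_eq := by
    ext a
    refine ⟨?_, fun ha => ?_⟩
    · rintro ⟨h, rfl⟩
      exact (permHom e T h).2
    · obtain ⟨h, hh⟩ := permHom_surjective e T ⟨a, ha⟩
      exact ⟨h, congrArg Subtype.val hh⟩
  comul_eq h := by
    refine (comul_eq_iff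
      ((fixedSubalgebra e (permGroup e T)).val.comp (permHom e T)).toLinearMap _ _).2 ?_
    change pairing (permCoeffs e T) (permCoeffs e T) _ = diag (k := k) (permCoeffs e T h)
    ext ⟨π, ρ⟩
    rw [pairing_permCoeffs, pairing_rowMap, diag_apply, diag_apply]
    by_cases hπ : π ∈ permGroup e T
    · by_cases hρ : ρ ∈ permGroup e T
      · rw [if_pos ⟨hπ, hρ⟩, permCoeffs_of_mem e T hπ]
        refine if_congr ⟨fun h => ?_, fun h => by rw [h]⟩ rfl rfl
        exact congrArg Subtype.val (((isRegular_permGroup e T).bijective (basePoint e)).1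
          (a₁ := ⟨π, hπ⟩) (a₂ := ⟨ρ, hρ⟩) h)
      · rw [if_neg fun h => hρ h.2, if_neg]
        rintro rfl
        exact hρ hπ
    · rw [if_neg fun h => hπ h.1, permCoeffs_of_notMem e T hπ, ite_self]
  counit_eq h := by
    rw [counit_eq_sum, ← sum_rowMap e T (basePoint e)]
    exact sum_permGroup_eq e T (permCoeffs e T h) _ (fun π hπ => permCoeffs_of_notMem e T hπ h)
      fun π hπ => permCoeffs_of_mem e T hπ h
  action_eq h x := by
    rw [coeff_sum_eq, ← emb_basePoint e (T.μ h x), emb_mu]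
    change _ = toLinearMaps e (permCoeffs e T h) x
    rw [toLinearMaps_apply, eq_comm]
    refine sum_permGroup_eq e T _ (fun c => rowMap e T (basePoint e) h c * emb e c x)
      (fun π hπ => ?_) fun π hπ => ?_
    · rw [permCoeffs_of_notMem e T hπ, zero_mul]
    · rw [permCoeffs_of_mem e T hπ]

end PermRealization

/-! ### Uniqueness: group and structure determine each other -/

namespace Realization

variable {k : Type u} {Kt : Type v} [Field k] [Field Kt] [Algebra k Kt]
variable {G' : Subgroup Gal(Kt/k)} {X : Type} {e : Gal(Kt/k) ⧸ G' ≃ X} [Fintype X] [DecidableEq X]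
variable {N : Subgroup (Equiv.Perm X)}
variable {T : HopfGaloisStructure.{u, v, w} k (IntermediateField.fixedField G')}
variable (R : Realization e N T)

theorem ι_mem (h : T.H) : R.ι h ∈ fixedGroupAlgebra e N := by
  rw [← R.range_eq]
  exact ⟨h, rfl⟩

theorem coeff_mem (h : T.H) : ⇑(R.ι h).coeff ∈ equivariant (conjAction e) := (R.ι_mem h).2

theorem coeff_of_notMem (h : T.H) {π : Equiv.Perm X} (hπ : π ∉ N) : (R.ι h).coeff π = 0 :=
  (R.ι_mem h).1 π hπ

theorem coe_mu (h : T.H) (y : IntermediateField.fixedField G') :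
    (T.μ h y : Kt) = toLinearMaps e (R.ι h).coeff y := by
  rw [R.action_eq, coeff_sum_eq]

theorem pairing_comul (h : T.H) :
    pairing (coeffs R.ι.toLinearMap) (coeffs R.ι.toLinearMap) (Coalgebra.comul (R := k) h) =
      diag (k := k) (coeffs R.ι.toLinearMap h) :=
  (comul_eq_iff R.ι.toLinearMap _ _).1 (R.comul_eq h)

theorem algebraMap_counit (h : T.H) :
    algebraMap k Kt (Coalgebra.counit h) = ∑ π, (R.ι h).coeff π := by
  rw [← R.counit_eq, counit_eq_sum]

variable [FiniteDimensional k Kt] [IsGalois k Kt]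

theorem isFormInjective : IsFormInjective (coeffs R.ι.toLinearMap) :=
  isFormInjective_of_mem_equivariant _ (coeffs_injective R.injective) R.coeff_mem

theorem emb_mu (h : T.H) (x : X) (y : IntermediateField.fixedField G') :
    emb e x (T.μ h y) = ∑ π, (R.ι h).coeff π * emb e (π⁻¹ x) y :=
  emb_toLinearMaps e (R.coeff_mem h) x y _ (R.coe_mu h y)

/-- The action formula expands `emb c ∘ μ h` along the embeddings `π⁻¹ c`, which regularity makes a
relabelling of the basis; so the coefficients of any realization are entries of rows. -/
theorem rowMap_inv (hN : IsRegular N) {π : Equiv.Perm X} (hπ : π ∈ N) (c : X) (h : T.H) :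
    rowMap e T c h (π⁻¹ c) = (R.ι h).coeff π := by
  classical
  let σ := Equiv.ofBijective _ (hN.bijective c)
  have key : rowMap e T c h = fun x => (R.ι h).coeff (σ.symm x) := by
    refine eq_of_sum_emb_eq e fun y => ?_
    rw [← HopfGalois.emb_mu, R.emb_mu,
      ← Finset.sum_subset (Finset.subset_univ (Finset.univ.filter (· ∈ N)))]
    · rw [Finset.sum_subtype (p := (· ∈ N))]
      · refine Fintype.sum_equiv σ _ _ fun π => ?_
        rw [Equiv.symm_apply_apply]
        rfl
      · simp
    · intro π _ hπ
      rw [R.coeff_of_notMem h (by simpa using hπ), zero_mul]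
  rw [key]
  change (R.ι h).coeff (σ.symm (σ ⟨π, hπ⟩)) = _
  rw [Equiv.symm_apply_apply]

/-- Two elements, one from each group, that agree after inversion at the base point have equal
entries in every row, hence are equal. The group is thus an invariant of the structure, which
separates the four classes. -/
theorem eq_permGroup (R : Realization e N T) (hN : IsRegular N) : N = permGroup e T := by
  have key : ∀ π ∈ N, ∀ ρ ∈ permGroup e T, π⁻¹ (basePoint e) = ρ⁻¹ (basePoint e) → π = ρ := by
    intro π hπ ρ hρ h
    apply inv_injective
    ext1 c
    refine (linearIndependent_entry e T c).injective ?_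
    ext a
    rw [entry_apply, entry_apply, HopfGalois.rowMap_inv e T hρ, R.rowMap_inv hN hπ, ← h,
      R.rowMap_inv hN hπ]
  ext π
  constructor
  · intro hπ
    obtain ⟨ρ, hρ⟩ := ((isRegular_permGroup e T).bijective (basePoint e)).2 (π⁻¹ (basePoint e))
    rw [key π hπ ρ ρ.2 hρ.symm]
    exact ρ.2
  · intro hρ
    obtain ⟨π', hπ'⟩ := (hN.bijective (basePoint e)).2 (π⁻¹ (basePoint e))
    rw [← key π' π'.2 π hρ hπ']
    exact π'.2

variable {S : HopfGaloisStructure.{u, v, w'} k (IntermediateField.fixedField G')}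

/-- Both Hopf algebras are identified with the same subset of the group algebra, and that
identification determines product, comultiplication, counit and action. -/
theorem isIso (R : Realization e N T) (R' : Realization e N S) : T.IsIso S := by
  have hr : R.ι.range = R'.ι.range := by
    apply SetLike.coe_injective
    rw [AlgHom.coe_range, AlgHom.coe_range, R.range_eq, R'.range_eq]
  let f : T.H ≃ₐ[k] S.H := ((AlgEquiv.ofInjective R.ι R.injective).trans
    (Subalgebra.equivOfEq _ _ hr)).trans (AlgEquiv.ofInjective R'.ι R'.injective).symm
  have hf : ∀ h, R'.ι (f h) = R.ι h := fun h =>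
    congrArg Subtype.val ((AlgEquiv.ofInjective R'.ι R'.injective).apply_symm_apply _)
  have hcoeffs : coeffs R'.ι.toLinearMap ∘ₗ f.toLinearMap = coeffs R.ι.toLinearMap := by
    ext h π
    change (R'.ι (f h)).coeff π = _
    rw [hf]
    rfl
  refine ⟨BialgEquiv.ofAlgEquiv f ?_ ?_, fun h => ?_⟩
  · ext h
    apply FaithfulSMul.algebraMap_injective k Kt
    change algebraMap k Kt (Coalgebra.counit (f h)) = algebraMap k Kt (Coalgebra.counit h)
    rw [R.algebraMap_counit, R'.algebraMap_counit, hf]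
  · ext h
    apply (R'.isFormInjective.pairing R'.isFormInjective).injective
    change pairing _ _ (TensorProduct.map f.toLinearMap f.toLinearMap (Coalgebra.comul (R := k) h)) =
      pairing _ _ (Coalgebra.comul (R := k) (f h))
    have hmap : ∀ z : T.H ⊗[k] T.H, pairing (coeffs R'.ι.toLinearMap) (coeffs R'.ι.toLinearMap)
        (TensorProduct.map f.toLinearMap f.toLinearMap z) =
        pairing (coeffs R.ι.toLinearMap) (coeffs R.ι.toLinearMap) z := by
      intro z
      rw [← hcoeffs]
      induction z with
      | zero => simp
      | add z z' hz hz' => simp only [map_add, hz, hz']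
      | tmul v w => rfl
    rw [hmap, R.pairing_comul, R'.pairing_comul, ← hcoeffs]
    rfl
  · ext y
    change (S.μ (f h) y : Kt) = T.μ h y
    rw [R'.coe_mu, R.coe_mu, hf]

end Realization

section Transport

variable {k : Type u} {Kt : Type v} [Field k] [Field Kt] [Algebra k Kt]
variable {G' : Subgroup Gal(Kt/k)} {X : Type} {e : Gal(Kt/k) ⧸ G' ≃ X} [Fintype X] [DecidableEq X]
variable {N : Subgroup (Equiv.Perm X)}
variable {T : HopfGaloisStructure.{u, v, w} k (IntermediateField.fixedField G')}
variable {S : HopfGaloisStructure.{u, v, w'} k (IntermediateField.fixedField G')}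

theorem nonempty_realization_of_isIso (R : Realization e N S) (h : T.IsIso S) :
    Nonempty (Realization e N T) := by
  obtain ⟨f, hf⟩ := h
  have hcoeffs : coeffs R.ι.toLinearMap ∘ₗ (f : T.H →ₐc[k] S.H).toCoalgHom.toLinearMap =
      coeffs (R.ι.comp ((f : T.H →ₐc[k] S.H) : T.H →ₐ[k] S.H)).toLinearMap := rfl
  refine ⟨{ ι := R.ι.comp ((f : T.H →ₐc[k] S.H) : T.H →ₐ[k] S.H)
            injective := R.injective.comp f.injective
            range_eq := ?_
            comul_eq := fun h => ?_
            counit_eq := fun h => ?_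
            action_eq := fun h x => ?_ }⟩
  · rw [← R.range_eq]
    exact f.surjective.range_comp R.ι
  · refine (comul_eq_iff (R.ι.comp ((f : T.H →ₐc[k] S.H) : T.H →ₐ[k] S.H)).toLinearMap _ _).2 ?_
    have hmap : ∀ z : T.H ⊗[k] T.H, pairing (coeffs R.ι.toLinearMap) (coeffs R.ι.toLinearMap)
        (TensorProduct.map (f : T.H →ₐc[k] S.H).toCoalgHom.toLinearMap
          (f : T.H →ₐc[k] S.H).toCoalgHom.toLinearMap z) =
        pairing (coeffs (R.ι.comp ((f : T.H →ₐc[k] S.H) : T.H →ₐ[k] S.H)).toLinearMap)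
          (coeffs (R.ι.comp ((f : T.H →ₐc[k] S.H) : T.H →ₐ[k] S.H)).toLinearMap) z := by
      intro z
      induction z with
      | zero => simp
      | add z z' hz hz' => simp only [map_add, hz, hz']
      | tmul v w => rfl
    rw [← hmap]
    have hc := LinearMap.congr_fun (f : T.H →ₐc[k] S.H).toCoalgHom.map_comp_comul h
    rw [LinearMap.comp_apply, LinearMap.comp_apply] at hc
    rw [hc]
    exact R.pairing_comul (f h)
  · refine (R.counit_eq (f h)).trans (congrArg _ ?_)
    exact LinearMap.congr_fun (f : T.H →ₐc[k] S.H).toCoalgHom.counit_comp h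
  · rw [← hf]
    exact R.action_eq (f h) x

end Transport

/-! ### Sub-Hopf algebras, stable subgroups and fixed fields -/

theorem coeff_antipode {L P : Type*} [Field L] [Group P] (a : MonoidAlgebra L P) (p : P) :
    (HopfAlgebra.antipode L a).coeff p = a.coeff p⁻¹ := by
  classical
  induction a using MonoidAlgebra.induction_linear with
  | zero => simp
  | add a b ha hb =>
    rw [map_add, MonoidAlgebra.coeff_add, MonoidAlgebra.coeff_add, Finsupp.add_apply, ha, hb,
      Finsupp.add_apply]
  | single q c =>
    simp [MonoidAlgebra.antipode_single, MonoidAlgebra.coeff_single, Finsupp.single_apply,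
      inv_eq_iff_eq_inv]

namespace Realization

variable {k : Type u} {Kt : Type v} [Field k] [Field Kt] [Algebra k Kt]
variable {G' : Subgroup Gal(Kt/k)} {X : Type} {e : Gal(Kt/k) ⧸ G' ≃ X} [Fintype X] [DecidableEq X]
variable {N : Subgroup (Equiv.Perm X)}
variable {T : HopfGaloisStructure.{u, v, w} k (IntermediateField.fixedField G')}
variable (R : Realization e N T)

theorem coeff_mul'_map {V : Type w} [AddCommGroup V] [Module k V]
    (E F : V →ₗ[k] MonoidAlgebra Kt (Equiv.Perm X)) (z : V ⊗[k] V) (p : Equiv.Perm X) :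
    (LinearMap.mul' k _ (TensorProduct.map E F z)).coeff p =
      ∑ q, pairing (coeffs E) (coeffs F) z (q, q⁻¹ * p) := by
  induction z with
  | zero => simp
  | add a b ha hb =>
    simp only [map_add, MonoidAlgebra.coeff_add, Finsupp.add_apply, ha, hb, Pi.add_apply,
      Finset.sum_add_distrib]
  | tmul a b =>
    rw [TensorProduct.map_tmul, LinearMap.mul'_apply, coeff_mul_eq_sum]
    rfl

/-- A realization is not assumed to respect antipodes. Composing `ι` with the antipode of `H` gives
a left convolution inverse of `ι`, composing it with that of the group algebra a right one, so the
two coincide. -/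
theorem coeff_antipode (h : T.H) (π : Equiv.Perm X) :
    (R.ι (HopfAlgebra.antipode k h)).coeff π = (R.ι h).coeff π⁻¹ := by
  let S := (HopfAlgebra.antipode Kt (A := MonoidAlgebra Kt (Equiv.Perm X))).restrictScalars k ∘ₗ
    R.ι.toLinearMap
  have h1 : WithConv.toConv (R.ι.toLinearMap ∘ₗ HopfAlgebra.antipode k (A := T.H)) *
      WithConv.toConv R.ι.toLinearMap = 1 := by
    have := LinearMap.algHom_comp_convMul_distrib R.ι
      (WithConv.toConv (HopfAlgebra.antipode k (A := T.H))) (WithConv.toConv LinearMap.id)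
    rw [LinearMap.antipode_mul_id] at this
    refine Eq.trans ?_ ((WithConv.ext_iff.2 this).symm.trans ?_)
    · rfl
    · ext h
      simp
  have h2 : WithConv.toConv R.ι.toLinearMap * WithConv.toConv S = 1 := by
    ext h p
    rw [LinearMap.convMul_apply, LinearMap.convOne_apply, coeff_mul'_map, coeff_algebraMap,
      R.algebraMap_counit]
    have hS : ∀ z (q q' : Equiv.Perm X), pairing (coeffs R.ι.toLinearMap) (coeffs S) z (q, q') =
        pairing (coeffs R.ι.toLinearMap) (coeffs R.ι.toLinearMap) z (q, q'⁻¹) := by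
      intro z q q'
      induction z with
      | zero => simp
      | add a b ha hb => simp only [map_add, Pi.add_apply, ha, hb]
      | tmul a b =>
        rw [pairing_tmul, pairing_tmul]
        exact congrArg _ (HopfGalois.coeff_antipode _ _)
    have hp : ∀ q : Equiv.Perm X, q = p⁻¹ * q ↔ p = 1 := fun q => by
      rw [eq_comm, mul_eq_right, inv_eq_one]
    simp only [hS, R.pairing_comul, diag_apply, mul_inv_rev, inv_inv, hp]
    split_ifs <;> simp
  have h3 := left_inv_eq_right_inv h1 h2
  have h4 : R.ι (HopfAlgebra.antipode k h) = S h :=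
    LinearMap.congr_fun (WithConv.toConv_injective h3) h
  rw [h4]
  exact HopfGalois.coeff_antipode _ _

section Support

variable (H' : SubHopfAlgebra k T.H)

/-- The `Kt`-linear span of a sub-Hopf algebra. -/
def spanOf : Submodule Kt (MonoidAlgebra Kt (Equiv.Perm X)) :=
  Submodule.span Kt (R.ι '' (H'.toSubalgebra : Set T.H))

/-- Contract the second leg of `Δ h` with the coefficient at `π`. Diagonality leaves a nonzero
multiple of `π`, and `Δ h ∈ H' ⊗ H'` keeps the result in the span. -/
theorem single_mem_spanOf {h : T.H} (hh : h ∈ H'.toSubalgebra) {π : Equiv.Perm X}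
    (hπ : (R.ι h).coeff π ≠ 0) : MonoidAlgebra.single π (1 : Kt) ∈ R.spanOf H' := by
  obtain ⟨z, hz⟩ := H'.comul_mem h hh
  have key : ∀ z : H'.toSubalgebra ⊗[k] H'.toSubalgebra,
      MonoidAlgebra.ofCoeff (Finsupp.equivFunOnFinite.symm fun p =>
        pairing (coeffs R.ι.toLinearMap) (coeffs R.ι.toLinearMap)
          (TensorProduct.map H'.toSubalgebra.val.toLinearMap
            H'.toSubalgebra.val.toLinearMap z) (p, π)) ∈ R.spanOf H' := by
    intro z
    induction z with
    | zero =>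
      convert Submodule.zero_mem _
      ext
      simp
    | add a b ha hb =>
      convert Submodule.add_mem _ ha hb using 1
      ext
      simp
    | tmul a b =>
      convert Submodule.smul_mem (R.spanOf H') ((R.ι b).coeff π) (Submodule.subset_span
        (Set.mem_image_of_mem R.ι a.2)) using 1
      refine MonoidAlgebra.ext (Finsupp.ext fun p => ?_)
      exact mul_comm ((R.ι a).coeff p) ((R.ι b).coeff π)
  have := Submodule.smul_mem _ ((R.ι h).coeff π)⁻¹ (key z)
  convert this using 1
  ext p
  rw [hz, R.pairing_comul]
  simp only [MonoidAlgebra.coeff_single, Finsupp.single_apply, MonoidAlgebra.coeff_smul,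
    Finsupp.smul_apply, Finsupp.equivFunOnFinite_symm_apply_apply,
    diag_apply, coeffs_apply, eq_comm (a := π)]
  split_ifs with hp
  · subst hp
    exact (inv_mul_cancel₀ hπ).symm
  · simp

theorem exists_coeff_ne_zero_iff (π : Equiv.Perm X) :
    (∃ h ∈ H'.toSubalgebra, (R.ι h).coeff π ≠ 0) ↔
      MonoidAlgebra.single π (1 : Kt) ∈ R.spanOf H' := by
  refine ⟨fun ⟨h, hh, hπ⟩ => R.single_mem_spanOf H' hh hπ, fun h => ?_⟩
  by_contra! hcon
  have : ∀ a ∈ R.spanOf H', a.coeff π = 0 := fun a ha => by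
    induction ha using Submodule.span_induction with
    | mem a ha =>
      obtain ⟨h, hh, rfl⟩ := ha
      exact hcon h hh
    | zero => rfl
    | add a b _ _ ha hb => rw [MonoidAlgebra.coeff_add, Finsupp.add_apply, ha, hb, add_zero]
    | smul c a _ ha => rw [MonoidAlgebra.coeff_smul, Finsupp.smul_apply, ha, smul_zero]
  simpa using this _ h

/-- The subgroup attached to a sub-Hopf algebra. -/
def support : Subgroup (Equiv.Perm X) :=
  let M : Submonoid (Equiv.Perm X) :=
    { carrier := {π | MonoidAlgebra.single π (1 : Kt) ∈ R.spanOf H'}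
      one_mem' := Submodule.subset_span ⟨1, H'.toSubalgebra.one_mem, map_one R.ι⟩
      mul_mem' := fun {π π'} h h' => by
        have := Submodule.mul_mem_mul (show _ ∈ R.spanOf H' from h) (show _ ∈ R.spanOf H' from h')
        rw [MonoidAlgebra.single_mul_single, one_mul, spanOf, Submodule.span_mul_span] at this
        refine Submodule.span_mono ?_ this
        rintro _ ⟨_, ⟨a, ha, rfl⟩, _, ⟨b, hb, rfl⟩, rfl⟩
        exact ⟨a * b, H'.toSubalgebra.mul_mem ha hb, map_mul R.ι a b⟩ }
  { M with
    -- In a finite group the inverse is a power, so the submonoid is already a subgroup.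
    inv_mem' := fun {π} hπ => by
      have : π⁻¹ ∈ Submonoid.powers π :=
        (isOfFinOrder_of_finite π).mem_powers_iff_mem_zpowers.2
          (Subgroup.inv_mem _ (Subgroup.mem_zpowers π))
      exact (Submonoid.powers_le (P := M)).2 hπ this }

theorem mem_support_iff_single {π : Equiv.Perm X} :
    π ∈ R.support H' ↔ MonoidAlgebra.single π (1 : Kt) ∈ R.spanOf H' := Iff.rfl

theorem mem_support_iff {π : Equiv.Perm X} :
    π ∈ R.support H' ↔ ∃ h ∈ H'.toSubalgebra, (R.ι h).coeff π ≠ 0 :=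
  (R.exists_coeff_ne_zero_iff H' π).symm

theorem support_le : R.support H' ≤ N := by
  intro π hπ
  obtain ⟨h, -, hπ⟩ := (R.mem_support_iff H').1 hπ
  exact by_contra fun hn => hπ (R.coeff_of_notMem h hn)

theorem isNormalized_of_forall_conj_mem {N : Subgroup (Equiv.Perm X)}
    (h : ∀ g, ∀ π ∈ N, leftTranslation e g * π * (leftTranslation e g)⁻¹ ∈ N) :
    IsNormalized e N := by
  rintro _ ⟨g, rfl⟩
  refine Subgroup.mem_normalizer_iff.2 fun π => ⟨h g π, fun hπ => ?_⟩
  have := h g⁻¹ _ hπ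
  rw [map_inv] at this
  convert this using 1
  group

theorem isNormalized_support : IsNormalized e (R.support H') := by
  refine isNormalized_of_forall_conj_mem fun g π hπ => ?_
  obtain ⟨h, hh, hπ⟩ := (R.mem_support_iff H').1 hπ
  refine (R.mem_support_iff H').2 ⟨h, hh, ?_⟩
  rw [(R.ι_mem h).2 g π]
  simpa using hπ

variable [FiniteDimensional k Kt] [IsGalois k Kt]

/-- The span of `H'` contains every group element of the support, so an equivariant function
supported there lies in the span and descends to `H'` by `mem_of_mem_span`. -/
theorem image_eq_fixedGroupAlgebra :
    R.ι '' (H'.toSubalgebra : Set T.H) = fixedGroupAlgebra e (R.support H') := by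
  apply Set.Subset.antisymm
  · rintro _ ⟨h, hh, rfl⟩
    refine ⟨fun π hπ => ?_, (R.ι_mem h).2⟩
    by_contra hne
    exact hπ ((R.mem_support_iff H').2 ⟨h, hh, hne⟩)
  · intro a ha
    let E := coeffs R.ι.toLinearMap
    have hmem : ⇑a.coeff ∈ (Subalgebra.toSubmodule H'.toSubalgebra).map E := by
      refine mem_of_mem_span (conjAction e) ?_ ha.2 ?_
      · rintro _ ⟨h, -, rfl⟩
        exact R.coeff_mem h
      · have h1 : (⇑a.coeff : Equiv.Perm X → Kt) =
            ∑ π, a.coeff π • Pi.single π (1 : Kt) := by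
          ext p
          simp [Finset.sum_apply, Pi.single_apply]
        rw [h1]
        refine Submodule.sum_mem _ fun π _ => ?_
        by_cases hπ : π ∈ R.support H'
        · refine Submodule.smul_mem _ _ ?_
          have h2 : ∀ b ∈ R.spanOf H', (⇑b.coeff : Equiv.Perm X → Kt) ∈ Submodule.span Kt
              (((Subalgebra.toSubmodule H'.toSubalgebra).map E : Submodule k _) :
                Set (Equiv.Perm X → Kt)) := fun b hb => by
            induction hb using Submodule.span_induction with
            | mem b hb =>
              obtain ⟨h, hh, rfl⟩ := hb
              exact Submodule.subset_span ⟨h, hh, rfl⟩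
            | zero => exact Submodule.zero_mem _
            | add b c _ _ hb hc => exact Submodule.add_mem _ hb hc
            | smul y b _ hb => exact Submodule.smul_mem _ y hb
          convert h2 _ ((R.mem_support_iff_single H').1 hπ) using 1
          ext p
          simp [Pi.single_apply, Finsupp.single_apply, eq_comm]
        · rw [ha.1 π hπ, zero_smul]
          exact Submodule.zero_mem _
    obtain ⟨h, hh, hE⟩ := hmem
    exact ⟨h, hh, MonoidAlgebra.ext (DFunLike.ext _ _ (congrFun hE))⟩

/-- The condition `μ(h) x = ε(h) x` reads `∑ h_π (emb_{π⁻¹(1̄)} x - x) = 0`. Being `Kt`-linear in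
the coefficients, it can be tested on the span of `H'`, hence on the single group elements in it. -/
theorem mem_fixedField_iff (x : IntermediateField.fixedField G') :
    x ∈ T.fixedField H' ↔ ∀ π ∈ R.support H', emb e (π⁻¹ (basePoint e)) x = x := by
  have key : ∀ h : T.H, T.μ h x = Coalgebra.counit (R := k) h • x ↔
      ∑ π, (R.ι h).coeff π * (emb e (π⁻¹ (basePoint e)) x - x) = 0 := by
    intro h
    rw [← Subtype.coe_inj, R.coe_mu, toLinearMaps_apply]
    simp only [mul_sub, Finset.sum_sub_distrib, ← Finset.sum_mul]
    rw [sub_eq_zero, ← R.algebraMap_counit]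
    change _ = Coalgebra.counit (R := k) h • (x : Kt) ↔ _
    rw [Algebra.smul_def]
  change (∀ h ∈ H'.toSubalgebra, T.μ h x = Coalgebra.counit (R := k) h • x) ↔ _
  simp only [key]
  constructor
  · intro hx π hπ
    have : ∀ a ∈ R.spanOf H', ∑ π, a.coeff π * (emb e (π⁻¹ (basePoint e)) x - x) = 0 := by
      intro a ha
      induction ha using Submodule.span_induction with
      | mem a ha =>
        obtain ⟨h, hh, rfl⟩ := ha
        exact hx h hh
      | zero => simp
      | add a b _ _ ha hb =>
        simp only [MonoidAlgebra.coeff_add, Finsupp.add_apply, add_mul, Finset.sum_add_distrib, ha,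
          hb, add_zero]
      | smul c a _ ha =>
        simp only [MonoidAlgebra.coeff_smul, Finsupp.smul_apply, smul_eq_mul, mul_assoc,
          ← Finset.mul_sum, ha, mul_zero]
    have h1 := this _ ((R.mem_support_iff_single H').1 hπ)
    simpa [Finsupp.single_apply, sub_eq_zero] using h1
  · intro hx h hh
    refine Finset.sum_eq_zero fun π _ => ?_
    by_cases hπ : π ∈ R.support H'
    · rw [hx π hπ, sub_self, mul_zero]
    · rw [by_contra fun hne => hπ ((R.mem_support_iff H').2 ⟨h, hh, hne⟩), zero_mul]

end Support

variable [FiniteDimensional k Kt] [IsGalois k Kt]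

/-- The sub-Hopf algebra attached to a subgroup of `N` normalized by `λ(G)`. -/
def subHopf {N' : Subgroup (Equiv.Perm X)} (hle : N' ≤ N) (hN' : IsNormalized e N') :
    SubHopfAlgebra k T.H where
  toSubalgebra := (fixedSubalgebra e N').comap R.ι
  comul_mem h hh := by
    let H' := (fixedSubalgebra e N').comap R.ι
    let E := coeffs (R.ι.comp H'.val).toLinearMap
    have hE : E = coeffs R.ι.toLinearMap ∘ₗ H'.val.toLinearMap := rfl
    -- The diagonal is descended inside `H' ⊗ H'`; injectivity of the pairing identifies the result
    -- with `Δ h`.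
    obtain ⟨z, hz⟩ := exists_pairing_eq_diag (conjAction e) (E := E)
      (f := coeffs R.ι.toLinearMap h) (fun v => R.coeff_mem v) (R.coeff_mem h) (fun π hπ => by
        have hπ' : π ∈ N' := by_contra fun hn => hπ (hh.1 π hn)
        refine Submodule.span_mono ?_ (single_mem_span_fixedCoeffs e N' hN' hπ')
        rintro _ ⟨a, rfl⟩
        have ha : (a : MonoidAlgebra Kt (Equiv.Perm X)) ∈ Set.range R.ι := by
          rw [R.range_eq]
          exact ⟨fun π hπ => a.2.1 π fun h => hπ (hle h), a.2.2⟩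
        obtain ⟨b, hb⟩ := ha
        refine ⟨⟨b, ?_⟩, ?_⟩
        · change R.ι b ∈ fixedSubalgebra e N'
          rw [hb]
          exact a.2
        · ext p
          change (R.ι b).coeff p = _
          rw [hb]
          rfl)
    refine ⟨z, (R.isFormInjective.pairing R.isFormInjective).injective ?_⟩
    rw [R.pairing_comul, ← hz, hE]
    clear hz
    induction z with
    | zero => simp
    | add a b ha hb => simp only [map_add, ha, hb]
    | tmul a b => rfl
  antipode_mem h hh := by
    refine ⟨fun π hπ => ?_, R.coeff_mem _⟩
    refine (R.coeff_antipode h π).trans ?_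
    exact hh.1 _ fun h => hπ (by simpa using h)

theorem image_subHopf {N' : Subgroup (Equiv.Perm X)} (hle : N' ≤ N) (hN' : IsNormalized e N') :
    R.ι '' ((R.subHopf hle hN').toSubalgebra : Set T.H) = fixedGroupAlgebra e N' := by
  change R.ι '' (R.ι ⁻¹' fixedGroupAlgebra e N') = _
  rw [Set.image_preimage_eq_inter_range, R.range_eq, Set.inter_eq_left]
  exact fun a ha => ⟨fun π hπ => ha.1 π fun h => hπ (hle h), ha.2⟩

/-- The delta function of each `π ∈ M` is a `Kt`-combination of elements of `Kt[M]^G`, so this set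
remembers `M`. -/
theorem eq_of_fixedGroupAlgebra_eq {M M' : Subgroup (Equiv.Perm X)} (hM : IsNormalized e M)
    (hM' : IsNormalized e M') (h : fixedGroupAlgebra (k := k) e M = fixedGroupAlgebra e M') :
    M = M' := by
  have key : ∀ M M' : Subgroup (Equiv.Perm X), IsNormalized e M →
      fixedGroupAlgebra (k := k) e M = fixedGroupAlgebra e M' → M ≤ M' := by
    intro M M' hM h π hπ
    by_contra hn
    have h1 : ∀ f ∈ Submodule.span Kt (Set.range (fixedCoeffs e M)), f π = 0 := by
      intro f hf
      induction hf using Submodule.span_induction with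
      | mem f hf =>
        obtain ⟨a, rfl⟩ := hf
        have := a.2
        rw [mem_fixedSubalgebra, h] at this
        exact this.1 π hn
      | zero => rfl
      | add f f' _ _ hf hf' => rw [Pi.add_apply, hf, hf', add_zero]
      | smul c f _ hf => rw [Pi.smul_apply, hf, smul_zero]
    simpa using h1 _ (single_mem_span_fixedCoeffs e M hM hπ)
  exact le_antisymm (key M M' hM h) (key M' M hM' h.symm)

theorem support_subHopf {N' : Subgroup (Equiv.Perm X)} (hle : N' ≤ N) (hN' : IsNormalized e N') :
    R.support (R.subHopf hle hN') = N' :=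
  eq_of_fixedGroupAlgebra_eq (R.isNormalized_support _) hN'
    ((R.image_eq_fixedGroupAlgebra _).symm.trans (R.image_subHopf hle hN'))

/-- The Galois correspondence of a Hopf Galois structure in terms of the subgroups of `N` which are
normalized by `λ(G)`. -/
theorem hasGaloisTable (hN : IsNormalized e N) (hreg : IsRegular N)
    {rows : Set (Subgroup (Equiv.Perm X) ×
      IntermediateField k (IntermediateField.fixedField G'))}
    (h1 : {N' : Subgroup (Equiv.Perm X) | N' ≤ N ∧ N' ≠ ⊥ ∧ N' ≠ N ∧ IsNormalized e N'} =
      Prod.fst '' rows)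
    (h2 : ∀ r ∈ rows, ∀ x : IntermediateField.fixedField G',
      x ∈ r.2 ↔ ∀ π ∈ r.1, emb e (π⁻¹ (basePoint e)) x = x) :
    HasGaloisTable e R rows := by
  have hrow : ∀ r ∈ rows, r.1 ≤ N ∧ r.1 ≠ ⊥ ∧ r.1 ≠ N ∧ IsNormalized e r.1 := fun r hr =>
    h1.symm.subset ⟨r, hr, rfl⟩
  have hsub : ∀ r (hr : r ∈ rows),
      T.fixedField (R.subHopf (hrow r hr).1 (hrow r hr).2.2.2) = r.2 := fun r hr => by
    ext x
    rw [R.mem_fixedField_iff, R.support_subHopf, h2 r hr]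
  have hbot : ∀ H' : SubHopfAlgebra k T.H, R.support H' = ⊥ → T.fixedField H' = ⊤ := by
    intro H' h
    ext x
    rw [R.mem_fixedField_iff, h]
    refine ⟨fun _ => trivial, fun _ π hπ => ?_⟩
    rw [Subgroup.mem_bot.1 hπ]
    exact emb_basePoint e x
  have htop : ∀ H' : SubHopfAlgebra k T.H, R.support H' = N → T.fixedField H' = ⊥ := by
    intro H' h
    ext x
    rw [R.mem_fixedField_iff, h]
    constructor
    · intro hx
      -- Transitivity of `N` makes all embeddings agree on `x`, and each Galois automorphism
      -- restricts to one of them.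
      have hall : ∀ c, emb e c x = x := fun c => by
        obtain ⟨π, hπ⟩ := (hreg.bijective (basePoint e)).2 c
        rw [← hx π π.2, ← hπ]
      have hfix : (x : Kt) ∈ (⊥ : IntermediateField k Kt) := by
        rw [IsGalois.mem_bot_iff_fixed]
        intro g
        rw [← emb_mk e g x, hall]
      obtain ⟨c, hc⟩ := IntermediateField.mem_bot.1 hfix
      exact IntermediateField.mem_bot.2 ⟨c, Subtype.ext hc⟩
    · intro hx π _
      obtain ⟨c, rfl⟩ := IntermediateField.mem_bot.1 hx
      rw [AlgHom.commutes]
      rfl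
  refine ⟨h1, fun r hr => ⟨R.subHopf (hrow r hr).1 (hrow r hr).2.2.2, R.image_subHopf _ _,
    hsub r hr⟩, ?_⟩
  ext F
  constructor
  · rintro ⟨H', rfl⟩
    by_cases hb : R.support H' = ⊥
    · exact Or.inl (Or.inr (hbot H' hb))
    by_cases ht : R.support H' = N
    · exact Or.inl (Or.inl (htop H' ht))
    obtain ⟨r, hr, hr1⟩ := h1.subset
      ⟨R.support_le H', hb, ht, R.isNormalized_support H'⟩
    refine Or.inr ⟨r, hr, ?_⟩
    ext x
    rw [R.mem_fixedField_iff, ← hr1, h2 r hr]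
  · rintro ((rfl | rfl) | ⟨r, hr, rfl⟩)
    · exact ⟨R.subHopf le_rfl hN, htop _ (R.support_subHopf _ _)⟩
    · have hb : IsNormalized e (⊥ : Subgroup (Equiv.Perm X)) :=
        isNormalized_of_forall_conj_mem fun g π hπ => by
          rw [Subgroup.mem_bot.1 hπ]
          simp
      exact ⟨R.subHopf bot_le hb, hbot _ (R.support_subHopf _ _)⟩
    · exact ⟨_, hsub r hr⟩

end Realization

/-! ### The four elementary abelian groups -/

section Involutions

variable {P : Type*} [Group P] {a b c : P}

/-- The homomorphism from the group of order two attached to an involution. -/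
def involutionHom (a : P) (ha : a * a = 1) : Multiplicative (ZMod 2) →* P where
  toFun x := a ^ (x.toAdd : ZMod 2).val
  map_one' := pow_zero a
  map_mul' x y := by
    obtain ⟨x, rfl⟩ := Multiplicative.ofAdd.surjective x
    obtain ⟨y, rfl⟩ := Multiplicative.ofAdd.surjective y
    change a ^ (x + y).val = a ^ x.val * a ^ y.val
    rw [← pow_add, ZMod.val_add]
    exact (pow_eq_pow_mod _ (by rw [pow_two, ha])).symm

theorem involutionHom_commute (ha : a * a = 1) (hb : Commute a b)
    (x : Multiplicative (ZMod 2)) : Commute (involutionHom a ha x) b :=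
  hb.pow_left _

theorem mem_closure_pair_of_commute (ha : a * a = 1) (hb : b * b = 1) (hab : Commute a b) {x : P} :
    x ∈ Subgroup.closure {a, b} ↔ x = 1 ∨ x = a ∨ x = b ∨ x = a * b := by
  constructor
  · intro hx
    induction hx using Subgroup.closure_induction with
    | mem x hx => rcases hx with rfl | rfl <;> simp
    | one => simp
    | mul x y _ _ hx hy =>
      have h1 : a * (a * b) = b := by rw [← mul_assoc, ha, one_mul]
      have h2 : b * a = a * b := hab.eq.symm
      have h3 : b * (a * b) = a := by rw [hab.eq, ← mul_assoc, hb, one_mul]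
      have h4 : a * b * (a * b) = 1 := by rw [mul_assoc, h3, ha]
      have h5 : a * b * b = a := by rw [mul_assoc, hb, mul_one]
      have h6 : a * b * a = b := by rw [mul_assoc, h2, h1]
      rcases hx with rfl | rfl | rfl | rfl <;> rcases hy with rfl | rfl | rfl | rfl <;>
        simp [ha, hb, h1, h2, h3, h4, h5, h6]
    | inv x _ hx =>
      have h1 : a⁻¹ = a := inv_eq_of_mul_eq_one_left ha
      have h2 : b⁻¹ = b := inv_eq_of_mul_eq_one_left hb
      rcases hx with rfl | rfl | rfl | rfl <;> simp [h1, h2, hab.eq]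
  · have h1 : a ∈ Subgroup.closure {a, b} := Subgroup.subset_closure (by simp)
    have h2 : b ∈ Subgroup.closure {a, b} := Subgroup.subset_closure (by simp)
    rintro (rfl | rfl | rfl | rfl)
    · exact one_mem _
    · exact h1
    · exact h2
    · exact mul_mem h1 h2

theorem mem_closure_singleton_of_mul_self (ha : a * a = 1) {x : P} :
    x ∈ Subgroup.closure {a} ↔ x = 1 ∨ x = a := by
  have := mem_closure_pair_of_commute ha ha (Commute.refl a) (x := x)
  rw [Set.pair_eq_singleton, ha] at this
  rw [this]
  tauto

end Involutions

theorem r_mul_self (i : Fin 4) : r i * r i = 1 := by revert i; decide +kernel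

theorem s_mul_self (i : Fin 4) : s i * s i = 1 := by revert i; decide +kernel

theorem t_mul_self (i : Fin 4) : t i * t i = 1 := by revert i; decide +kernel

theorem commute_r_s (i : Fin 4) : Commute (r i) (s i) := by
  have : ∀ i, r i * s i = s i * r i := by decide +kernel
  exact this i

theorem commute_r_t (i : Fin 4) : Commute (r i) (t i) := by
  have : ∀ i, r i * t i = t i * r i := by decide +kernel
  exact this i

theorem commute_s_t (i : Fin 4) : Commute (s i) (t i) := by
  have : ∀ i, s i * t i = t i * s i := by decide +kernel
  exact this i

/-- The parametrization of `Nᵢ` by the generators. -/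
def paramHom (i : Fin 4) :
    Multiplicative (ZMod 2) × Multiplicative (ZMod 2) × Multiplicative (ZMod 2) →*
      Equiv.Perm (Fin 8) :=
  (involutionHom (r i) (r_mul_self i)).noncommCoprod
    ((involutionHom (s i) (s_mul_self i)).noncommCoprod (involutionHom (t i) (t_mul_self i))
      fun x y => (involutionHom_commute _ ((involutionHom_commute _ (commute_s_t i).symm y).symm) x))
    fun x _ => (involutionHom_commute (r_mul_self i) (commute_r_s i) x).pow_right _ |>.mul_right
      ((involutionHom_commute (r_mul_self i) (commute_r_t i) x).pow_right _)

/-- `rᵢ ^ a * sᵢ ^ b * tᵢ ^ c` -/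
def elem (i : Fin 4) (a b c : Fin 2) : Equiv.Perm (Fin 8) :=
  r i ^ (a : ℕ) * (s i ^ (b : ℕ) * t i ^ (c : ℕ))

theorem elem_zero (i : Fin 4) : elem i 0 0 0 = 1 := by
  change r i ^ 0 * (s i ^ 0 * t i ^ 0) = 1
  simp

theorem elem_one_zero_zero (i : Fin 4) : elem i 1 0 0 = r i := by
  change r i ^ 1 * (s i ^ 0 * t i ^ 0) = r i
  simp

theorem elem_zero_one_zero (i : Fin 4) : elem i 0 1 0 = s i := by
  change r i ^ 0 * (s i ^ 1 * t i ^ 0) = s i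
  simp

theorem elem_zero_zero_one (i : Fin 4) : elem i 0 0 1 = t i := by
  change r i ^ 0 * (s i ^ 0 * t i ^ 1) = t i
  simp

theorem range_paramHom (i : Fin 4) : (paramHom i).range = N i := by
  apply le_antisymm
  · rintro _ ⟨⟨x, y, z⟩, rfl⟩
    have h : ∀ a ∈ ({r i, s i, t i} : Set (Equiv.Perm (Fin 8))), a ∈ N i := fun a ha =>
      Subgroup.subset_closure ha
    exact mul_mem (pow_mem (h _ (by simp)) _)
      (mul_mem (pow_mem (h _ (by simp)) _) (pow_mem (h _ (by simp)) _))
  · refine (Subgroup.closure_le _).2 ?_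
    rintro _ (rfl | rfl | rfl)
    · exact ⟨(.ofAdd 1, .ofAdd 0, .ofAdd 0), elem_one_zero_zero i⟩
    · exact ⟨(.ofAdd 0, .ofAdd 1, .ofAdd 0), elem_zero_one_zero i⟩
    · exact ⟨(.ofAdd 0, .ofAdd 0, .ofAdd 1), elem_zero_zero_one i⟩

theorem mem_N_iff {i : Fin 4} {π : Equiv.Perm (Fin 8)} :
    π ∈ N i ↔ ∃ a b c, π = elem i a b c := by
  rw [← range_paramHom]
  constructor
  · rintro ⟨⟨x, y, z⟩, rfl⟩
    exact ⟨x, y, z, rfl⟩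
  · rintro ⟨a, b, c, rfl⟩
    exact ⟨(.ofAdd a, .ofAdd b, .ofAdd c), rfl⟩

theorem elem_fixed (i : Fin 4) (a b c : Fin 2) (x : Fin 8) (h : elem i a b c x = x) :
    a = 0 ∧ b = 0 ∧ c = 0 := by
  revert i a b c x
  decide +kernel

theorem exists_elem_apply_eq (i : Fin 4) (x y : Fin 8) : ∃ a b c, elem i a b c x = y := by
  revert i x y
  decide +kernel

theorem isRegular_N (i : Fin 4) : IsRegular (N i) := by
  intro x y
  obtain ⟨a, b, c, h⟩ := exists_elem_apply_eq i x y
  refine ⟨_, ⟨mem_N_iff.2 ⟨a, b, c, rfl⟩, h⟩, ?_⟩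
  rintro π ⟨hπ, hx⟩
  have hmem : π⁻¹ * elem i a b c ∈ N i := mul_mem (inv_mem hπ) (mem_N_iff.2 ⟨a, b, c, rfl⟩)
  obtain ⟨a', b', c', h'⟩ := mem_N_iff.1 hmem
  have hfix : elem i a' b' c' x = x := by
    rw [← h', Equiv.Perm.mul_apply, h, Equiv.Perm.inv_eq_iff_eq, hx]
  obtain ⟨rfl, rfl, rfl⟩ := elem_fixed _ _ _ _ _ hfix
  rw [elem_zero, inv_mul_eq_one] at h'
  exact h'

theorem paramHom_injective (i : Fin 4) : Function.Injective (paramHom i) := by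
  rw [injective_iff_map_eq_one]
  rintro ⟨x, y, z⟩ h
  obtain ⟨h1, h2, h3⟩ := elem_fixed i x y z 0 (by
    change paramHom i (x, y, z) 0 = 0
    rw [h]
    rfl)
  exact Prod.ext h1 (Prod.ext h2 h3)

/-- `Nᵢ` is an elementary abelian group of order eight. -/
def equivN (i : Fin 4) : N i ≃*
    Multiplicative (ZMod 2) × Multiplicative (ZMod 2) × Multiplicative (ZMod 2) :=
  ((MonoidHom.ofInjective (paramHom_injective i)).trans
    (MulEquiv.subgroupCongr (range_paramHom i))).symm

theorem N_injective : Function.Injective N := by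
  intro i j h
  have h1 : r i ∈ N j := h ▸ Subgroup.subset_closure (by simp)
  have h2 : s i ∈ N j := h ▸ Subgroup.subset_closure (by simp)
  have h3 : t i ∈ N j := h ▸ Subgroup.subset_closure (by simp)
  rw [mem_N_iff] at h1 h2 h3
  have key : ∀ i j, (∃ a b c, r i = elem j a b c) → (∃ a b c, s i = elem j a b c) →
      (∃ a b c, t i = elem j a b c) → i = j := by decide +kernel
  exact key i j h1 h2 h3

/-- `(1, 2, 3, 4)(5, 6, 7, 8)` -/
abbrev permTau : Equiv.Perm (Fin 8) := c[1, 2, 3, 4] * c[5, 6, 7, 8]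

/-- `(1, 2)(3, 5)(4, 6)(7, 8)` -/
abbrev permSigma : Equiv.Perm (Fin 8) := transp 1 2 3 5 4 6 7 8

theorem mem_normalizer_of_conj_mem {P : Type*} [Group P] [Finite P] {M : Subgroup P} {g : P}
    (h : ∀ x ∈ M, g * x * g⁻¹ ∈ M) : g ∈ Subgroup.normalizer (M : Set P) :=
  Subgroup.mem_normalizer_fintype h

theorem conj_mem_closure {P : Type*} [Group P] {S : Set P} {g : P} {M : Subgroup P}
    (h : ∀ x ∈ S, g * x * g⁻¹ ∈ M) :
    ∀ x ∈ Subgroup.closure S, g * x * g⁻¹ ∈ M := fun x hx => by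
  have : Subgroup.closure S ≤ M.comap (MulAut.conj g).toMonoidHom := (Subgroup.closure_le _).2 h
  exact this hx

theorem permTau_mem_normalizer (i : Fin 4) :
    permTau ∈ Subgroup.normalizer (N i : Set (Equiv.Perm (Fin 8))) := by
  refine mem_normalizer_of_conj_mem (conj_mem_closure ?_)
  have h1 : ∀ i, (∃ a b c, permTau * r i * permTau⁻¹ = elem i a b c) ∧
      (∃ a b c, permTau * s i * permTau⁻¹ = elem i a b c) ∧
      (∃ a b c, permTau * t i * permTau⁻¹ = elem i a b c) := by decide +kernel
  rintro _ (rfl | rfl | rfl)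
  · exact mem_N_iff.2 (h1 i).1
  · exact mem_N_iff.2 (h1 i).2.1
  · exact mem_N_iff.2 (h1 i).2.2

theorem permSigma_mem_normalizer (i : Fin 4) :
    permSigma ∈ Subgroup.normalizer (N i : Set (Equiv.Perm (Fin 8))) := by
  refine mem_normalizer_of_conj_mem (conj_mem_closure ?_)
  have h1 : ∀ i, (∃ a b c, permSigma * r i * permSigma⁻¹ = elem i a b c) ∧
      (∃ a b c, permSigma * s i * permSigma⁻¹ = elem i a b c) ∧
      (∃ a b c, permSigma * t i * permSigma⁻¹ = elem i a b c) := by decide +kernel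
  rintro _ (rfl | rfl | rfl)
  · exact mem_N_iff.2 (h1 i).1
  · exact mem_N_iff.2 (h1 i).2.1
  · exact mem_N_iff.2 (h1 i).2.2

/-! ### Stable subgroups as invariant subspaces of `𝔽₂³` -/

section StableSubgroups

theorem elem_mul (i : Fin 4) (a b c a' b' c' : Fin 2) :
    elem i a b c * elem i a' b' c' = elem i (a + a') (b + b') (c + c') :=
  by
  have h (a b c : ZMod 2) (a' b' c' : ZMod 2) :=
    map_mul (paramHom i) (.ofAdd a, .ofAdd b, .ofAdd c) (.ofAdd a', .ofAdd b', .ofAdd c')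
  exact (h a b c a' b' c').symm

variable {M : Subgroup (Equiv.Perm (Fin 8))} {i : Fin 4}

theorem le_of_elem_mem (hle : M ≤ N i) {M' : Subgroup (Equiv.Perm (Fin 8))}
    (h : ∀ a b c, elem i a b c ∈ M → elem i a b c ∈ M') : M ≤ M' := by
  intro π hπ
  obtain ⟨a, b, c, rfl⟩ := mem_N_iff.1 (hle hπ)
  exact h a b c hπ

theorem elem_add_mem {a b c a' b' c' : Fin 2} (h : elem i a b c ∈ M) (h' : elem i a' b' c' ∈ M) :
    elem i (a + a') (b + b') (c + c') ∈ M :=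
  elem_mul i a b c a' b' c' ▸ mul_mem h h'

theorem elem_mem_closure_r_s (a b : Fin 2) : elem i a b 0 ∈ Subgroup.closure {r i, s i} := by
  have h1 : r i ∈ Subgroup.closure {r i, s i} := Subgroup.subset_closure (by simp)
  have h2 : s i ∈ Subgroup.closure {r i, s i} := Subgroup.subset_closure (by simp)
  exact mul_mem (pow_mem h1 _) (mul_mem (pow_mem h2 _) (one_mem _))

theorem elem_mem_closure_r_t (a c : Fin 2) : elem i a 0 c ∈ Subgroup.closure {r i, t i} := by
  have h1 : r i ∈ Subgroup.closure {r i, t i} := Subgroup.subset_closure (by simp)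
  have h2 : t i ∈ Subgroup.closure {r i, t i} := Subgroup.subset_closure (by simp)
  exact mul_mem (pow_mem h1 _) (mul_mem (one_mem _) (pow_mem h2 _))

theorem elem_mem_closure_t (c : Fin 2) : elem i 0 0 c ∈ Subgroup.closure {t i} := by
  have h2 : t i ∈ Subgroup.closure {t i} := Subgroup.subset_closure (by simp)
  exact mul_mem (one_mem _) (mul_mem (one_mem _) (pow_mem h2 _))

/-- In exponent coordinates, conjugation by `λ(τ)` and `λ(σ)` is a pair of linear maps of `𝔽₂³`. The
pairs for the indices `2` and `3` coincide, so `predicate_two` serves both. -/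
theorem conj_elem_zero (a b c : Fin 2) :
    permTau * elem 0 a b c * permTau⁻¹ = elem 0 (a + b) b c ∧
    permSigma * elem 0 a b c * permSigma⁻¹ = elem 0 a (a + b) c := by
  revert a b c
  decide +kernel

theorem conj_elem_one (a b c : Fin 2) :
    permTau * elem 1 a b c * permTau⁻¹ = elem 1 (a + b) b (a + b + c) ∧
    permSigma * elem 1 a b c * permSigma⁻¹ = elem 1 b a c := by
  revert a b c
  decide +kernel

theorem conj_elem_two (a b c : Fin 2) :
    permTau * elem 2 a b c * permTau⁻¹ = elem 2 (a + b) b (a + c) ∧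
    permSigma * elem 2 a b c * permSigma⁻¹ = elem 2 (a + b + c) b c := by
  revert a b c
  decide +kernel

theorem conj_elem_three (a b c : Fin 2) :
    permTau * elem 3 a b c * permTau⁻¹ = elem 3 (a + b) b (a + c) ∧
    permSigma * elem 3 a b c * permSigma⁻¹ = elem 3 (a + b + c) b c := by
  revert a b c
  decide +kernel

theorem exists_and_exists_not (hle : M ≤ N i) (hbot : M ≠ ⊥) (hne : M ≠ N i) :
    elem i 0 0 0 ∈ M ∧ (∃ a b c, elem i a b c ∈ M ∧ ¬ (a = 0 ∧ b = 0 ∧ c = 0)) ∧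
      ∃ a b c, elem i a b c ∉ M := by
  refine ⟨elem_zero i ▸ one_mem M, ?_, ?_⟩
  · by_contra! h
    refine hbot (le_bot_iff.1 (le_of_elem_mem hle fun a b c habc => ?_))
    obtain ⟨rfl, rfl, rfl⟩ := h a b c habc
    exact elem_zero i ▸ one_mem _
  · by_contra! h
    refine hne (le_antisymm hle fun π hπ => ?_)
    obtain ⟨a, b, c, rfl⟩ := mem_N_iff.1 hπ
    exact h a b c

/-- An additively closed subset of `𝔽₂³` containing `0` is a subspace. Phrased with a predicate, the
search for invariant subspaces becomes propositional logic in eight atoms, split according to which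
basis vectors belong. -/
theorem predicate_zero (p : Fin 2 → Fin 2 → Fin 2 → Prop) (h0 : p 0 0 0)
    (h1 : ∃ a b c, p a b c ∧ ¬ (a = 0 ∧ b = 0 ∧ c = 0)) (h2 : ∃ a b c, ¬ p a b c)
    (hadd : ∀ a b c a' b' c', p a b c → p a' b' c' → p (a + a') (b + b') (c + c'))
    (hA : ∀ a b c, p a b c → p (a + b) b c) (hB : ∀ a b c, p a b c → p a (a + b) c) :
    (∀ a b c, p a b c ↔ a = 0 ∧ b = 0) ∨ ∀ a b c, p a b c ↔ c = 0 := by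
  simp only [Fin.forall_fin_two, Fin.exists_fin_two, Fin.isValue, add_zero, zero_add,
    show (1 : Fin 2) + 1 = 0 from rfl, one_ne_zero, and_true, and_false, not_true, not_false_iff, iff_true, iff_false] at *
  by_cases h3 : p 1 0 0 <;> by_cases h4 : p 0 1 0 <;> by_cases h5 : p 0 0 1 <;> grind

theorem predicate_one (p : Fin 2 → Fin 2 → Fin 2 → Prop) (h0 : p 0 0 0)
    (h1 : ∃ a b c, p a b c ∧ ¬ (a = 0 ∧ b = 0 ∧ c = 0)) (h2 : ∃ a b c, ¬ p a b c)
    (hadd : ∀ a b c a' b' c', p a b c → p a' b' c' → p (a + a') (b + b') (c + c'))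
    (hA : ∀ a b c, p a b c → p (a + b) b (a + b + c)) (hB : ∀ a b c, p a b c → p b a c) :
    ∀ a b c, p a b c ↔ a = 0 ∧ b = 0 := by
  simp only [Fin.forall_fin_two, Fin.exists_fin_two, Fin.isValue, add_zero, zero_add,
    show (1 : Fin 2) + 1 = 0 from rfl, one_ne_zero, and_true, and_false, not_true, not_false_iff, iff_true, iff_false] at *
  by_cases h3 : p 1 0 0 <;> by_cases h4 : p 0 1 0 <;> by_cases h5 : p 0 0 1 <;> grind

theorem predicate_two (p : Fin 2 → Fin 2 → Fin 2 → Prop) (h0 : p 0 0 0)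
    (h1 : ∃ a b c, p a b c ∧ ¬ (a = 0 ∧ b = 0 ∧ c = 0)) (h2 : ∃ a b c, ¬ p a b c)
    (hadd : ∀ a b c a' b' c', p a b c → p a' b' c' → p (a + a') (b + b') (c + c'))
    (hA : ∀ a b c, p a b c → p (a + b) b (a + c)) (hB : ∀ a b c, p a b c → p (a + b + c) b c) :
    ∀ a b c, p a b c ↔ b = 0 := by
  simp only [Fin.forall_fin_two, Fin.exists_fin_two, Fin.isValue, add_zero, zero_add,
    show (1 : Fin 2) + 1 = 0 from rfl, one_ne_zero, and_true, and_false, not_true, not_false_iff, iff_true, iff_false] at *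
  by_cases h3 : p 1 0 0 <;> by_cases h4 : p 0 1 0 <;> by_cases h5 : p 0 0 1 <;> grind

theorem eq_closure_t_of_forall (hle : M ≤ N i) (h : ∀ a b c, elem i a b c ∈ M ↔ a = 0 ∧ b = 0) :
    M = Subgroup.closure {t i} := by
  refine le_antisymm (le_of_elem_mem hle fun a b c habc => ?_) ((Subgroup.closure_le _).2 ?_)
  · obtain ⟨rfl, rfl⟩ := (h a b c).1 habc
    exact elem_mem_closure_t c
  · rintro _ rfl
    exact elem_zero_zero_one i ▸ (h 0 0 1).2 ⟨rfl, rfl⟩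

theorem eq_closure_r_s_of_forall (hle : M ≤ N i) (h : ∀ a b c, elem i a b c ∈ M ↔ c = 0) :
    M = Subgroup.closure {r i, s i} := by
  refine le_antisymm (le_of_elem_mem hle fun a b c habc => ?_) ((Subgroup.closure_le _).2 ?_)
  · obtain rfl := (h a b c).1 habc
    exact elem_mem_closure_r_s a b
  · rintro _ (rfl | rfl)
    · exact elem_one_zero_zero i ▸ (h 1 0 0).2 rfl
    · exact elem_zero_one_zero i ▸ (h 0 1 0).2 rfl

theorem eq_closure_r_t_of_forall (hle : M ≤ N i) (h : ∀ a b c, elem i a b c ∈ M ↔ b = 0) :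
    M = Subgroup.closure {r i, t i} := by
  refine le_antisymm (le_of_elem_mem hle fun a b c habc => ?_) ((Subgroup.closure_le _).2 ?_)
  · obtain rfl := (h a b c).1 habc
    exact elem_mem_closure_r_t a c
  · rintro _ (rfl | rfl)
    · exact elem_one_zero_zero i ▸ (h 1 0 0).2 rfl
    · exact elem_zero_zero_one i ▸ (h 0 0 1).2 rfl

/-- `M` is stable under conjugation by `permTau` and `permSigma`. -/
def IsStable (M : Subgroup (Equiv.Perm (Fin 8))) : Prop :=
  (∀ π ∈ M, permTau * π * permTau⁻¹ ∈ M) ∧ ∀ π ∈ M, permSigma * π * permSigma⁻¹ ∈ M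

theorem eq_of_isStable_zero {M : Subgroup (Equiv.Perm (Fin 8))} (hle : M ≤ N 0) (hbot : M ≠ ⊥)
    (hne : M ≠ N 0) (h : IsStable M) :
    M = Subgroup.closure {t 0} ∨ M = Subgroup.closure {r 0, s 0} := by
  obtain ⟨h0, h1, h2⟩ := exists_and_exists_not hle hbot hne
  refine (predicate_zero (fun a b c => elem 0 a b c ∈ M) h0 h1 h2
    (fun _ _ _ _ _ _ h h' => elem_add_mem h h')
    (fun a b c habc => (conj_elem_zero a b c).1 ▸ h.1 _ habc)
    (fun a b c habc => (conj_elem_zero a b c).2 ▸ h.2 _ habc)).imp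
    (eq_closure_t_of_forall hle) (eq_closure_r_s_of_forall hle)

theorem eq_of_isStable_one {M : Subgroup (Equiv.Perm (Fin 8))} (hle : M ≤ N 1) (hbot : M ≠ ⊥)
    (hne : M ≠ N 1) (h : IsStable M) : M = Subgroup.closure {t 1} := by
  obtain ⟨h0, h1, h2⟩ := exists_and_exists_not hle hbot hne
  exact eq_closure_t_of_forall hle (predicate_one (fun a b c => elem 1 a b c ∈ M) h0 h1 h2
    (fun _ _ _ _ _ _ h h' => elem_add_mem h h')
    (fun a b c habc => (conj_elem_one a b c).1 ▸ h.1 _ habc)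
    (fun a b c habc => (conj_elem_one a b c).2 ▸ h.2 _ habc))

theorem eq_of_isStable_two {M : Subgroup (Equiv.Perm (Fin 8))} (hle : M ≤ N 2) (hbot : M ≠ ⊥)
    (hne : M ≠ N 2) (h : IsStable M) : M = Subgroup.closure {r 2, t 2} := by
  obtain ⟨h0, h1, h2⟩ := exists_and_exists_not hle hbot hne
  exact eq_closure_r_t_of_forall hle (predicate_two (fun a b c => elem 2 a b c ∈ M) h0 h1 h2
    (fun _ _ _ _ _ _ h h' => elem_add_mem h h')
    (fun a b c habc => (conj_elem_two a b c).1 ▸ h.1 _ habc)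
    (fun a b c habc => (conj_elem_two a b c).2 ▸ h.2 _ habc))

theorem eq_of_isStable_three {M : Subgroup (Equiv.Perm (Fin 8))} (hle : M ≤ N 3) (hbot : M ≠ ⊥)
    (hne : M ≠ N 3) (h : IsStable M) : M = Subgroup.closure {r 3, t 3} := by
  obtain ⟨h0, h1, h2⟩ := exists_and_exists_not hle hbot hne
  exact eq_closure_r_t_of_forall hle (predicate_two (fun a b c => elem 3 a b c ∈ M) h0 h1 h2
    (fun _ _ _ _ _ _ h h' => elem_add_mem h h')
    (fun a b c habc => (conj_elem_three a b c).1 ▸ h.1 _ habc)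
    (fun a b c habc => (conj_elem_three a b c).2 ▸ h.2 _ habc))

theorem isStable_closure_pair {a b : Equiv.Perm (Fin 8)} (ha : a * a = 1) (hb : b * b = 1)
    (hab : Commute a b)
    (h : ∀ g ∈ ({permTau, permSigma} : Set (Equiv.Perm (Fin 8))), ∀ x ∈ ({a, b} : Set _),
      g * x * g⁻¹ = 1 ∨ g * x * g⁻¹ = a ∨ g * x * g⁻¹ = b ∨ g * x * g⁻¹ = a * b) :
    IsStable (Subgroup.closure {a, b}) := by
  have key : ∀ g ∈ ({permTau, permSigma} : Set (Equiv.Perm (Fin 8))),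
      ∀ π ∈ Subgroup.closure {a, b}, g * π * g⁻¹ ∈ Subgroup.closure {a, b} := fun g hg =>
    conj_mem_closure fun x hx => (mem_closure_pair_of_commute ha hb hab).2 (h g hg x hx)
  exact ⟨key _ (by simp), key _ (by simp)⟩

theorem isStable_closure_t_zero : IsStable (Subgroup.closure {t 0}) := by
  rw [← Set.pair_eq_singleton]
  refine isStable_closure_pair (t_mul_self 0) (t_mul_self 0) (Commute.refl _) ?_
  simp only [Set.forall_mem_insert, Set.mem_singleton_iff, forall_eq]
  decide +kernel

theorem isStable_closure_t_one : IsStable (Subgroup.closure {t 1}) := by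
  rw [← Set.pair_eq_singleton]
  refine isStable_closure_pair (t_mul_self 1) (t_mul_self 1) (Commute.refl _) ?_
  simp only [Set.forall_mem_insert, Set.mem_singleton_iff, forall_eq]
  decide +kernel

theorem isStable_closure_r_s_zero : IsStable (Subgroup.closure {r 0, s 0}) := by
  refine isStable_closure_pair (r_mul_self 0) (s_mul_self 0) (commute_r_s 0) ?_
  simp only [Set.forall_mem_insert, Set.mem_singleton_iff, forall_eq]
  decide +kernel

theorem isStable_closure_r_t_two : IsStable (Subgroup.closure {r 2, t 2}) := by
  refine isStable_closure_pair (r_mul_self 2) (t_mul_self 2) (commute_r_t 2) ?_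
  simp only [Set.forall_mem_insert, Set.mem_singleton_iff, forall_eq]
  decide +kernel

theorem isStable_closure_r_t_three : IsStable (Subgroup.closure {r 3, t 3}) := by
  refine isStable_closure_pair (r_mul_self 3) (t_mul_self 3) (commute_r_t 3) ?_
  simp only [Set.forall_mem_insert, Set.mem_singleton_iff, forall_eq]
  decide +kernel

theorem closure_ne_bot {S : Set (Equiv.Perm (Fin 8))} {x : Equiv.Perm (Fin 8)} (hx : x ∈ S)
    (h : x ≠ 1) : Subgroup.closure S ≠ ⊥ := fun hS =>
  h (Subgroup.mem_bot.1 (hS ▸ Subgroup.subset_closure hx))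

theorem generators_ne_one (i : Fin 4) : r i ≠ 1 ∧ s i ≠ 1 ∧ t i ≠ 1 := by
  revert i
  decide +kernel

theorem closure_t_ne (i : Fin 4) : Subgroup.closure {t i} ≠ N i := by
  intro h
  have h1 : r i ∈ Subgroup.closure {t i} := h ▸ Subgroup.subset_closure (by simp)
  rw [mem_closure_singleton_of_mul_self (t_mul_self i)] at h1
  clear h
  revert h1
  revert i
  decide +kernel

theorem closure_r_s_ne (i : Fin 4) : Subgroup.closure {r i, s i} ≠ N i := by
  intro h
  have h1 : t i ∈ Subgroup.closure {r i, s i} := h ▸ Subgroup.subset_closure (by simp)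
  rw [mem_closure_pair_of_commute (r_mul_self i) (s_mul_self i) (commute_r_s i)] at h1
  clear h
  revert h1
  revert i
  decide +kernel

theorem closure_r_t_ne (i : Fin 4) : Subgroup.closure {r i, t i} ≠ N i := by
  intro h
  have h1 : s i ∈ Subgroup.closure {r i, t i} := h ▸ Subgroup.subset_closure (by simp)
  rw [mem_closure_pair_of_commute (r_mul_self i) (t_mul_self i) (commute_r_t i)] at h1
  clear h
  revert h1
  revert i
  decide +kernel

theorem stableSubgroups_zero :
    {M | M ≤ N 0 ∧ M ≠ ⊥ ∧ M ≠ N 0 ∧ IsStable M} =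
      {Subgroup.closure {t 0}, Subgroup.closure {r 0, s 0}} := by
  ext M
  constructor
  · rintro ⟨h1, h2, h3, h4⟩
    exact eq_of_isStable_zero h1 h2 h3 h4
  · rintro (rfl | rfl)
    · exact ⟨Subgroup.closure_mono (by simp), closure_ne_bot rfl (generators_ne_one 0).2.2,
        closure_t_ne 0, isStable_closure_t_zero⟩
    · exact ⟨Subgroup.closure_mono (by simp [Set.insert_subset_iff]),
        closure_ne_bot (Or.inl rfl) (generators_ne_one 0).1,
        closure_r_s_ne 0, isStable_closure_r_s_zero⟩

theorem stableSubgroups_one :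
    {M | M ≤ N 1 ∧ M ≠ ⊥ ∧ M ≠ N 1 ∧ IsStable M} = {Subgroup.closure {t 1}} := by
  ext M
  constructor
  · rintro ⟨h1, h2, h3, h4⟩
    exact eq_of_isStable_one h1 h2 h3 h4
  · rintro rfl
    exact ⟨Subgroup.closure_mono (by simp), closure_ne_bot rfl (generators_ne_one 1).2.2,
      closure_t_ne 1, isStable_closure_t_one⟩

theorem stableSubgroups_two :
    {M | M ≤ N 2 ∧ M ≠ ⊥ ∧ M ≠ N 2 ∧ IsStable M} = {Subgroup.closure {r 2, t 2}} := by
  ext M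
  constructor
  · rintro ⟨h1, h2, h3, h4⟩
    exact eq_of_isStable_two h1 h2 h3 h4
  · rintro rfl
    exact ⟨Subgroup.closure_mono (by simp [Set.insert_subset_iff]),
      closure_ne_bot (Or.inl rfl) (generators_ne_one 2).1,
      closure_r_t_ne 2, isStable_closure_r_t_two⟩

theorem stableSubgroups_three :
    {M | M ≤ N 3 ∧ M ≠ ⊥ ∧ M ≠ N 3 ∧ IsStable M} = {Subgroup.closure {r 3, t 3}} := by
  ext M
  constructor
  · rintro ⟨h1, h2, h3, h4⟩
    exact eq_of_isStable_three h1 h2 h3 h4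
  · rintro rfl
    exact ⟨Subgroup.closure_mono (by simp [Set.insert_subset_iff]),
      closure_ne_bot (Or.inl rfl) (generators_ne_one 3).1,
      closure_r_t_ne 3, isStable_closure_r_t_three⟩

end StableSubgroups

/-! ### Classification of the stable regular subgroups of `S₈` -/

section Classification

theorem IsRegular.eq_of_apply_eq {X : Type} {M : Subgroup (Equiv.Perm X)} (hM : IsRegular M)
    {π π' : Equiv.Perm X} (hπ : π ∈ M) (hπ' : π' ∈ M) {x : X} (h : π x = π' x) : π = π' :=
  (hM x (π' x)).unique ⟨hπ, h⟩ ⟨hπ', rfl⟩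

theorem IsRegular.eq_of_le {X : Type} {M M' : Subgroup (Equiv.Perm X)} (hM : IsRegular M)
    (hM' : IsRegular M') [Nonempty X] (hle : M ≤ M') : M = M' := by
  obtain ⟨x⟩ := ‹Nonempty X›
  refine le_antisymm hle fun π hπ => ?_
  obtain ⟨π', ⟨h1, h2⟩, -⟩ := hM x (π x)
  rw [← hM'.eq_of_apply_eq (hle h1) hπ h2]
  exact h1

/-- The permutation `λ((2, 3, 4))`. -/
abbrev permGamma : Equiv.Perm (Fin 8) := permSigma * permTau

/-- The values of `permGamma`. -/
def gammaTab : Fin 8 → Fin 8 := ![3, 1, 5, 6, 2, 4, 0, 7]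

/-- The values of the inverse of `permGamma`. -/
def gammaInvTab : Fin 8 → Fin 8 := ![6, 1, 4, 0, 5, 2, 3, 7]

/-- The values of `permTau`. -/
def tauTab : Fin 8 → Fin 8 := ![5, 2, 3, 4, 1, 6, 7, 0]

/-- The values of the inverse of `permTau`. -/
def tauInvTab : Fin 8 → Fin 8 := ![7, 4, 1, 2, 3, 0, 5, 6]

theorem permGamma_apply (x : Fin 8) : permGamma x = gammaTab x := by revert x; decide +kernel

theorem permGamma_inv_apply (x : Fin 8) : permGamma⁻¹ x = gammaInvTab x := by
  revert x; decide +kernel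

theorem permTau_apply (x : Fin 8) : permTau x = tauTab x := by revert x; decide +kernel

theorem permTau_inv_apply (x : Fin 8) : permTau⁻¹ x = tauInvTab x := by revert x; decide +kernel

/-- The fixed point free involutions which commute with `permGamma`. -/
def zTab : Fin 3 → Fin 8 → Fin 8 :=
  ![![2, 7, 0, 5, 6, 3, 4, 1], ![4, 7, 3, 2, 0, 6, 5, 1], ![5, 7, 6, 4, 3, 0, 2, 1]]

/-- In a regular group with elements `z : 1 ↦ 7` and `m : 1 ↦ 0`, the values of the element
`1 ↦ y`. -/
def rowTab (z m : Fin 8 → Fin 8) (y x : Fin 8) : Fin 8 :=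
  if y = 1 then x else if y = 7 then z x else if y = 0 then m x
  else if y = 3 then gammaTab (m (gammaInvTab x)) else if y = 6 then gammaInvTab (m (gammaTab x))
  else if z y = 0 then z (m x) else if z y = 3 then z (gammaTab (m (gammaInvTab x)))
  else z (gammaInvTab (m (gammaTab x)))

/-- The function commuting with `z` which takes given values at `0, 3, 6` and `1 ↦ 0`. -/
def mTab (z : Fin 8 → Fin 8) (m₀ m₃ m₆ x : Fin 8) : Fin 8 :=
  if x = 1 then 0 else if x = 7 then z 0 else if x = 0 then m₀ else if x = 3 then m₃
  else if x = 6 then m₆ else if z x = 0 then z m₀ else if z x = 3 then z m₃ else z m₆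

/-- Here `z` and `m` stand for the elements taking `1` to `7` and to `0`. The hypotheses say that `m
* m` is the element `1 ↦ m 0`, and that `τ m τ⁻¹` is the element `1 ↦ τ (m 4)`, as `τ⁻¹ 1 = 4`;
`rowTab` supplies those elements. There are `3 · 8³` candidates. -/
theorem table_search (j : Fin 3) (m₀ m₃ m₆ : Fin 8)
    (h1 : ∀ x, mTab (zTab j) m₀ m₃ m₆ (mTab (zTab j) m₀ m₃ m₆ x) =
      rowTab (zTab j) (mTab (zTab j) m₀ m₃ m₆) m₀ x)
    (h2 : ∀ x, tauTab (mTab (zTab j) m₀ m₃ m₆ (tauInvTab x)) =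
      rowTab (zTab j) (mTab (zTab j) m₀ m₃ m₆) (tauTab (mTab (zTab j) m₀ m₃ m₆ 4)) x)
    (h3 : Function.Injective (mTab (zTab j) m₀ m₃ m₆)) :
    ∃ i, (∃ a b c, ∀ x, zTab j x = elem i a b c x) ∧
      ∃ a b c, ∀ x, mTab (zTab j) m₀ m₃ m₆ x = elem i a b c x := by
  revert j m₀ m₃ m₆
  decide +kernel

theorem zTab_cases (j : Fin 3) (y : Fin 8) : y = 1 ∨ y = 7 ∨ y = 0 ∨ y = 3 ∨ y = 6 ∨
    zTab j y = 0 ∨ zTab j y = 3 ∨ zTab j y = 6 := by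
  revert j y
  decide +kernel

/-- The permutation `permGamma` has the cycles `(0,3,6)` and `(2,5,4)` and fixes `1` and `7`. A
commuting `z` has its values on `0, 3, 6` determined by `z 0`, and being a fixed point free
involution with `1 ↦ 7` forces `z 0` into the second cycle. -/
theorem eq_zTab (v : Fin 8) (z : Fin 8 → Fin 8) (h0 : z 0 = v) (h1 : z 1 = 7)
    (hz : ∀ x, z (z x) = x) (hne : ∀ x, z x ≠ x) (hc : ∀ x, z (gammaTab x) = gammaTab (z x)) :
    ∃ j, z = zTab j := by
  have h7 : z 7 = 1 := by rw [← h1, hz]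
  have h3 : z 3 = gammaTab v := by rw [← h0, ← hc]; rfl
  have h6 : z 6 = gammaTab (gammaTab v) := by rw [← h3, ← hc]; rfl
  have hv : z v = 0 := by rw [← h0, hz]
  have hv3 : z (gammaTab v) = 3 := by rw [← h3, hz]
  have hv6 : z (gammaTab (gammaTab v)) = 6 := by rw [← h6, hz]
  fin_cases v
  · exact absurd h0 (hne 0)
  · exact absurd (hv.symm.trans h1) (by decide)
  · refine ⟨0, funext fun x => ?_⟩
    fin_cases x <;> assumption
  · exact absurd (hv.symm.trans h3) (by decide)
  · refine ⟨1, funext fun x => ?_⟩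
    fin_cases x <;> assumption
  · refine ⟨2, funext fun x => ?_⟩
    fin_cases x <;> assumption
  · exact absurd (hv.symm.trans h6) (by decide)
  · exact absurd (hv.symm.trans h7) (by decide)

/-- Each `zTab j` exchanges `1` with `7` and one 3-cycle of `permGamma` with the other, so a
function commuting with it is known from its values at `1, 0, 3, 6`. -/
theorem eq_mTab (j : Fin 3) (m : Fin 8 → Fin 8) (h1 : m 1 = 0)
    (hm : ∀ x, m (zTab j x) = zTab j (m x)) : m = mTab (zTab j) (m 0) (m 3) (m 6) := by
  have h7 : m 7 = zTab j 0 := by rw [← h1, ← hm]; fin_cases j <;> rfl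
  have h (x y : Fin 8) (hxy : zTab j y = x) : m x = zTab j (m y) := by rw [← hm, hxy]
  fin_cases j
  · have a := h 2 0 rfl
    have b := h 5 3 rfl
    have c := h 4 6 rfl
    funext x
    fin_cases x <;> first | assumption | rfl
  · have a := h 4 0 rfl
    have b := h 2 3 rfl
    have c := h 5 6 rfl
    funext x
    fin_cases x <;> first | assumption | rfl
  · have a := h 5 0 rfl
    have b := h 4 3 rfl
    have c := h 2 6 rfl
    funext x
    fin_cases x <;> first | assumption | rfl

/-- This yields commutation of `m` and `z`. With `w = m 7`, the nested conditional is the value at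
`7` of the element `1 ↦ w`. That element is `m * z`, and it takes `7` to `m 1 = 0`. The conclusion
`m 7 = z 0` says that `m * z` and `z * m` agree at `1`. -/
theorem eq_zTab_zero (j : Fin 3) (w : Fin 8) (h0 : w ≠ 0)
    (h : 0 = if w = 1 then 7 else if w = 7 then zTab j 7 else if w = 0 then w
      else if w = 3 then gammaTab w else if w = 6 then gammaInvTab w
      else if zTab j w = 0 then zTab j w else if zTab j w = 3 then zTab j (gammaTab w)
      else zTab j (gammaInvTab w)) : w = zTab j 0 := by
  revert j w
  decide +kernel

theorem isStable_N (i : Fin 4) : IsStable (N i) :=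
  ⟨fun π hπ => (Subgroup.mem_normalizer_iff.1 (permTau_mem_normalizer i) π).1 hπ,
    fun π hπ => (Subgroup.mem_normalizer_iff.1 (permSigma_mem_normalizer i) π).1 hπ⟩

theorem mul_conj_mem {P : Type*} [Group P] {M : Subgroup P} {a b x : P}
    (h : a * (b * x * b⁻¹) * a⁻¹ ∈ M) : a * b * x * (a * b)⁻¹ ∈ M := by
  rwa [mul_inv_rev, ← mul_assoc, mul_assoc a b x, mul_assoc a (b * x)]

theorem IsStable.conj_permGamma {M : Subgroup (Equiv.Perm (Fin 8))} (h : IsStable M)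
    {π : Equiv.Perm (Fin 8)} (hπ : π ∈ M) : permGamma * π * permGamma⁻¹ ∈ M :=
  mul_conj_mem (h.2 _ (h.1 _ hπ))

/-- A regular subgroup stable under conjugation by `permTau` and `permSigma` is one of the `Nᵢ`. -/
theorem exists_eq_N {M : Subgroup (Equiv.Perm (Fin 8))} (hM : IsRegular M) (hs : IsStable M) :
    ∃ i, M = N i := by
  -- The point `1` is fixed by `permGamma`, so labelling elements by the image of `1` turns
  -- conjugation by `permGamma` into its action on labels.
  choose ρ hρ using fun y => (hM 1 y).exists
  have huniq : ∀ {π}, π ∈ M → π = ρ (π 1) := fun {π} hπ =>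
    hM.eq_of_apply_eq hπ (hρ _).1 (hρ (π 1)).2.symm
  have hone : ρ 1 = 1 := (huniq (one_mem M)).symm
  have hmul : ∀ a b, ρ (ρ a b) = ρ a * ρ b := fun a b => by
    rw [huniq (mul_mem (hρ a).1 (hρ b).1), Equiv.Perm.mul_apply, (hρ b).2]
  have hconj : ∀ y, ρ (gammaTab y) = permGamma * ρ y * permGamma⁻¹ := fun y => by
    rw [huniq (hs.conj_permGamma (hρ y).1), Equiv.Perm.mul_apply, Equiv.Perm.mul_apply,
      permGamma_inv_apply, permGamma_apply]
    change _ = ρ (gammaTab (ρ y 1))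
    rw [(hρ y).2]
  have hconj' : ∀ y x, ρ (gammaTab y) x = gammaTab (ρ y (gammaInvTab x)) := fun y x => by
    rw [hconj, Equiv.Perm.mul_apply, Equiv.Perm.mul_apply, permGamma_inv_apply, permGamma_apply]
  have hinv : ∀ x, gammaInvTab (gammaTab x) = x := by decide
  have hfix : ∀ y x, y ≠ 1 → ρ y x ≠ x := fun y x hy h => hy <| by
    rw [← (hρ y).2, hM.eq_of_apply_eq (hρ y).1 (one_mem M) h, Equiv.Perm.one_apply]
  have hz7 : ∀ x, ρ 7 (gammaTab x) = gammaTab (ρ 7 x) := fun x => by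
    have := hconj' 7 (gammaTab x)
    rwa [hinv] at this
  -- The image of `7` is again fixed by `permGamma`, so it is `1` or `7`, and regularity excludes
  -- `7`.
  have h77 : ρ 7 7 = 1 := by
    have h : ∀ y, y = gammaTab y → y ≠ 7 → y = 1 := by decide
    exact h _ (hz7 7) (hfix 7 7 (by decide))
  have hzz : ρ 7 * ρ 7 = 1 := by rw [← hmul, h77, hone]
  obtain ⟨j, hj⟩ := eq_zTab _ (ρ 7) rfl (hρ 7).2 (fun x => by
    rw [← Equiv.Perm.mul_apply, hzz, Equiv.Perm.one_apply]) (fun x => hfix 7 x (by decide)) hz7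
  have hzy : ∀ y, ρ y = ρ 7 * ρ (zTab j y) := fun y => by
    rw [← hj, hmul, ← mul_assoc, hzz, one_mul]
  have h3 : ∀ x, ρ 3 x = gammaTab (ρ 0 (gammaInvTab x)) := hconj' 0
  have h6 : ∀ x, ρ 6 x = gammaInvTab (ρ 0 (gammaTab x)) := fun x => by
    have := hconj' 6 (gammaTab x)
    rw [hinv] at this
    rw [show (0 : Fin 8) = gammaTab 6 from rfl, this, hinv]
  -- Every element is `1`, `z`, one of the three `permGamma`-conjugates of `m`, or `z` times such a
  -- conjugate; so `z` and `m` give the whole multiplication table.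
  have hrow : ∀ y x, ρ y x = rowTab (zTab j) (ρ 0) y x := by
    intro y x
    unfold rowTab
    split_ifs with c1 c7 c0 c3 c6 d0 d3
    · rw [c1, hone, Equiv.Perm.one_apply]
    · rw [c7, hj]
    · rw [c0]
    · rw [c3, h3]
    · rw [c6, h6]
    · rw [hzy, d0, Equiv.Perm.mul_apply, hj]
    · rw [hzy, d3, Equiv.Perm.mul_apply, hj, h3]
    · have d6 : zTab j y = 6 := by
        have := zTab_cases j y
        tauto
      rw [hzy, d6, Equiv.Perm.mul_apply, hj, h6]
  have hcomm : ρ 0 * ρ 7 = ρ 7 * ρ 0 := by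
    rw [← hmul, ← hmul]
    congr 1
    rw [hj]
    refine eq_zTab_zero j _ (fun h => ?_) ?_
    · have := (ρ 0).injective (h.trans (hρ 0).2.symm)
      exact absurd this (by decide)
    · have h := hrow (ρ 0 7) 7
      rw [hmul, Equiv.Perm.mul_apply, h77, (hρ 0).2] at h
      exact h
  have hm := eq_mTab j (ρ 0) (hρ 0).2 fun x => by
    rw [← hj, ← Equiv.Perm.mul_apply, hcomm, Equiv.Perm.mul_apply]
  obtain ⟨i, ⟨a, b, c, hzi⟩, a', b', c', hmi⟩ := table_search j (ρ 0 0) (ρ 0 3) (ρ 0 6)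
    (fun x => by
      rw [← hm, ← hrow, hmul, Equiv.Perm.mul_apply])
    (fun x => by
      have h := huniq (hs.1 _ (hρ 0).1)
      have h' := DFunLike.congr_fun h x
      rw [Equiv.Perm.mul_apply, Equiv.Perm.mul_apply, permTau_inv_apply, permTau_apply,
        Equiv.Perm.mul_apply, Equiv.Perm.mul_apply, permTau_inv_apply, permTau_apply,
        hrow (tauTab _)] at h'
      rw [← hm]
      exact h')
    (hm ▸ (ρ 0).injective)
  have hzN : ρ 7 ∈ N i := mem_N_iff.2 ⟨a, b, c, Equiv.ext fun x => by rw [hj, hzi]⟩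
  have hmN : ρ 0 ∈ N i := mem_N_iff.2 ⟨a', b', c', Equiv.ext fun x => by
    rw [← hmi, ← hm]⟩
  have h3N : ρ 3 ∈ N i := hconj 0 ▸ (isStable_N i).conj_permGamma hmN
  have h6N : ρ 6 ∈ N i := hconj 3 ▸ (isStable_N i).conj_permGamma h3N
  refine ⟨i, hM.eq_of_le (isRegular_N i) fun π hπ => ?_⟩
  rw [huniq hπ]
  generalize π 1 = y
  rcases zTab_cases j y with rfl | rfl | rfl | rfl | rfl | h | h | h
  · exact hone ▸ one_mem _
  · exact hzN
  · exact hmN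
  · exact h3N
  · exact h6N
  · exact hzy y ▸ h.symm ▸ mul_mem hzN hmN
  · exact hzy y ▸ h.symm ▸ mul_mem hzN h3N
  · exact hzy y ▸ h.symm ▸ mul_mem hzN h6N

end Classification

/-! ### Existence of admissible enumerations -/

section Admissible

theorem closure_tau_sigma :
    Subgroup.closure {(c[1, 2, 3, 4] : Equiv.Perm (Fin 4)), c[1, 2]} = ⊤ := by
  have h := Equiv.Perm.closure_cycle_adjacent_swap (σ := (c[1, 2, 3, 4] : Equiv.Perm (Fin 4)))
    (Cycle.isCycle_formPerm _ _ ⟨1, 2, by decide, by simp, by simp⟩) (by decide +kernel) 1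
  rwa [show Equiv.swap 1 ((c[1, 2, 3, 4] : Equiv.Perm (Fin 4)) 1) = c[1, 2] by
    decide +kernel] at h

theorem gamma_eq : (c[2, 3, 4] : Equiv.Perm (Fin 4)) = c[1, 2] * c[1, 2, 3, 4] := by decide +kernel

variable {k : Type u} {Kt : Type v} [Field k] [Field Kt] [Algebra k Kt]
variable {G' : Subgroup Gal(Kt/k)} {φ : Gal(Kt/k) ≃* Equiv.Perm (Fin 4)}
variable {e : Gal(Kt/k) ⧸ G' ≃ Fin 8}

theorem isNormalized_iff_of_closure_eq_top {X : Type} [Finite X] {e : Gal(Kt/k) ⧸ G' ≃ X}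
    {M : Subgroup (Equiv.Perm X)} {a b : Gal(Kt/k)} {A B : Equiv.Perm X}
    (ha : leftTranslation e a = A) (hb : leftTranslation e b = B)
    (hab : Subgroup.closure {a, b} = ⊤) :
    IsNormalized e M ↔ (∀ π ∈ M, A * π * A⁻¹ ∈ M) ∧ ∀ π ∈ M, B * π * B⁻¹ ∈ M := by
  subst ha hb
  refine ⟨fun hM => ⟨fun π hπ => conj_mem e hM a hπ, fun π hπ => conj_mem e hM b hπ⟩, fun hM => ?_⟩
  rw [IsNormalized, MonoidHom.range_eq_map, ← hab, MonoidHom.map_closure, Subgroup.closure_le]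
  rintro _ ⟨_, rfl | rfl, rfl⟩
  · exact mem_normalizer_of_conj_mem hM.1
  · exact mem_normalizer_of_conj_mem hM.2

theorem IsAdmissible.isNormalized_iff (h : IsAdmissible φ e) {M : Subgroup (Equiv.Perm (Fin 8))} :
    IsNormalized e M ↔ IsStable M := by
  refine isNormalized_iff_of_closure_eq_top h.tau_eq h.sigma_eq ?_
  have := congrArg (Subgroup.map φ.symm.toMonoidHom) closure_tau_sigma
  rwa [MonoidHom.map_closure, Set.image_pair, Subgroup.map_top_of_surjective _ φ.symm.surjective]
    at this

theorem IsAdmissible.gamma_eq (h : IsAdmissible φ e) :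
    leftTranslation e (φ.symm c[2, 3, 4]) = permGamma := by
  rw [HopfGalois.gamma_eq, map_mul, map_mul, h.tau_eq, h.sigma_eq]

theorem IsAdmissible.isRegular_and_isNormalized_iff (h : IsAdmissible φ e)
    (M : Subgroup (Equiv.Perm (Fin 8))) :
    IsRegular M ∧ IsNormalized e M ↔ ∃ i, M = N i := by
  rw [h.isNormalized_iff]
  constructor
  · rintro ⟨h1, h2⟩
    exact exists_eq_N h1 h2
  · rintro ⟨i, rfl⟩
    exact ⟨isRegular_N i, isStable_N i⟩

theorem exists_conj_eq_gamma (p : Equiv.Perm (Fin 4)) (h : p ^ 3 = 1) (hp : p ≠ 1) :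
    ∃ g : Equiv.Perm (Fin 4), g * p * g⁻¹ = c[2, 3, 4] := by
  revert p
  decide +kernel

/-- Representatives of the cosets of `⟨(2, 3, 4)⟩` in `S₄`. -/
def cosetRep : Fin 8 → Equiv.Perm (Fin 4) :=
  let τ : Equiv.Perm (Fin 4) := c[1, 2, 3, 4]
  let σ : Equiv.Perm (Fin 4) := c[1, 2]
  ![τ * τ * τ * σ * τ * τ, 1, τ, τ * τ, τ * τ * τ, σ * τ * τ, τ * σ * τ * τ, τ * τ * σ * τ * τ]

theorem exists_cosetRep (g : Equiv.Perm (Fin 4)) :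
    ∃ (y : Fin 8) (n : Fin 3), g = cosetRep y * c[2, 3, 4] ^ (n : ℕ) := by
  revert g
  decide +kernel

theorem tau_mul_cosetRep (y : Fin 8) :
    ∃ n : Fin 3, c[1, 2, 3, 4] * cosetRep y = cosetRep (permTau y) * c[2, 3, 4] ^ (n : ℕ) := by
  revert y
  decide +kernel

theorem sigma_mul_cosetRep (y : Fin 8) :
    ∃ n : Fin 3, c[1, 2] * cosetRep y = cosetRep (permSigma y) * c[2, 3, 4] ^ (n : ℕ) := by
  revert y
  decide +kernel

theorem exists_generator_of_card_eq_three {P : Type*} [Group P] {H : Subgroup P}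
    (hH : Nat.card H = 3) : ∃ x : P, x ^ 3 = 1 ∧ x ≠ 1 ∧ H = Subgroup.zpowers x := by
  have : Fact (Nat.Prime 3) := ⟨Nat.prime_three⟩
  have : Finite H := Nat.finite_of_card_ne_zero (by omega)
  have : Nontrivial H := by
    rw [← Finite.one_lt_card_iff_nontrivial]
    omega
  obtain ⟨x, hx⟩ := exists_ne (1 : H)
  have hx3 : x ^ 3 = 1 := hH ▸ pow_card_eq_one'
  refine ⟨x, congrArg Subtype.val hx3, by simpa using hx, ?_⟩
  have h := congrArg (Subgroup.map H.subtype) (zpowers_eq_top_of_prime_card hH hx)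
  rw [MonoidHom.map_zpowers, ← MonoidHom.range_eq_map, Subgroup.range_subtype] at h
  exact h.symm

/-- Elements of order three in `S₄` are conjugate, so an inner automorphism moves a generator of
`G'` to `(2,3,4)`. The coset numbered `y` is represented by a word in `τ, σ` whose prescribed
permutation carries `1` to `y`, so left translation has the required form. -/
theorem exists_isAdmissible (hG : Nonempty (Gal(Kt/k) ≃* Equiv.Perm (Fin 4)))
    (G' : Subgroup Gal(Kt/k)) (hG' : Nat.card G' = 3) :
    ∃ (φ : Gal(Kt/k) ≃* Equiv.Perm (Fin 4)) (e : Gal(Kt/k) ⧸ G' ≃ Fin 8), IsAdmissible φ e := by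
  obtain ⟨φ₀⟩ := hG
  obtain ⟨x, hx3, hx1, hgen⟩ := exists_generator_of_card_eq_three hG'
  obtain ⟨g, hg⟩ := exists_conj_eq_gamma (φ₀ x) (by rw [← map_pow, hx3, map_one])
    (by simpa using hx1)
  let φ := φ₀.trans (MulAut.conj g)
  have hφx : φ x = c[2, 3, 4] := hg
  have hmap : G'.map φ.toMonoidHom = Subgroup.zpowers c[2, 3, 4] := by
    rw [hgen, MonoidHom.map_zpowers]
    exact congrArg _ hφx
  have hpow : ∀ n : ℕ, φ.symm (c[2, 3, 4] ^ n) ∈ G' := fun n => by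
    rw [map_pow, ← hφx, φ.symm_apply_apply]
    exact hgen ▸ pow_mem (Subgroup.mem_zpowers x) n
  have hmk : ∀ (a b : Equiv.Perm (Fin 4)) (n : Fin 3), a = b * c[2, 3, 4] ^ (n : ℕ) →
      (φ.symm a : Gal(Kt/k) ⧸ G') = (φ.symm b : Gal(Kt/k) ⧸ G') := by
    rintro _ b n rfl
    rw [eq_comm, QuotientGroup.eq, map_mul, inv_mul_cancel_left]
    exact hpow n
  let f : Fin 8 → Gal(Kt/k) ⧸ G' := fun y => (φ.symm (cosetRep y) : Gal(Kt/k) ⧸ G')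
  have hsurj : Function.Surjective f := by
    intro q
    obtain ⟨h, rfl⟩ := QuotientGroup.mk_surjective q
    obtain ⟨y, n, hy⟩ := exists_cosetRep (φ h)
    exact ⟨y, by rw [← φ.symm_apply_apply h]; exact (hmk _ _ n hy).symm⟩
  have hcard : Nat.card (Fin 8) ≤ Nat.card (Gal(Kt/k) ⧸ G') := by
    have h1 := Subgroup.card_eq_card_quotient_mul_card_subgroup G'
    rw [hG', Nat.card_congr φ.toEquiv, Nat.card_perm] at h1
    simp only [Nat.card_eq_fintype_card, Fintype.card_fin] at h1 ⊢
    have : Nat.factorial 4 = 24 := rfl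
    omega
  let e : Gal(Kt/k) ⧸ G' ≃ Fin 8 :=
    (Equiv.ofBijective f (hsurj.bijective_of_nat_card_le hcard)).symm
  have he : ∀ y, e (φ.symm (cosetRep y) : Gal(Kt/k) ⧸ G') = y := fun y =>
    (Equiv.ofBijective f _).symm_apply_apply y
  refine ⟨φ, e, hmap, ?_, ?_⟩
  · ext1 y
    obtain ⟨n, hn⟩ := tau_mul_cosetRep y
    nth_rw 1 [← he y]
    rw [leftTranslation_mk, ← map_mul, hmk _ _ n hn, he]
  · ext1 y
    obtain ⟨n, hn⟩ := sigma_mul_cosetRep y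
    nth_rw 1 [← he y]
    rw [leftTranslation_mk, ← map_mul, hmk _ _ n hn, he]

end Admissible

/-! ### Roots and discriminant of a quartic -/

section Quartic

open Polynomial

variable {k : Type u} {L : Type v} [Field k] [Field L] [Algebra k L]

/-- The action of the Galois group on the roots of a polynomial. -/
def rootAction (P : k[X]) : Gal(L/k) →* Equiv.Perm (P.rootSet L) :=
  MonoidHom.toHomPerm
    { toFun := fun g x => ⟨g x, by
        refine mem_rootSet.2 ⟨(mem_rootSet.1 x.2).1, ?_⟩
        rw [← AlgEquiv.coe_toAlgHom, aeval_algHom_apply, (mem_rootSet.1 x.2).2, map_zero]⟩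
      map_one' := rfl
      map_mul' := fun _ _ => rfl }

theorem coe_rootAction (P : k[X]) (g : Gal(L/k)) (x : P.rootSet L) :
    (rootAction P g x : L) = g x := rfl

theorem rootAction_injective (P : k[X]) [P.IsSplittingField k L] :
    Function.Injective (rootAction (L := L) P) := by
  intro g g' h
  have : (g : L →ₐ[k] L) = g' := AlgHom.ext_of_adjoin_eq_top
    (IsSplittingField.adjoin_rootSet L P) fun x hx =>
      congrArg Subtype.val (DFunLike.congr_fun h (⟨x, hx⟩ : P.rootSet L))
  exact AlgEquiv.ext fun x => DFunLike.congr_fun this x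

/-- The roots of a quartic polynomial whose Galois group has order `24`. -/
theorem exists_roots_of_card [FiniteDimensional k L] {P : k[X]} (hP : P.natDegree = 4)
    [P.IsSplittingField k L] (hcard : Nat.card Gal(L/k) = 24) :
    ∃ (β : Fin 4 → L) (ψ : Gal(L/k) →* Equiv.Perm (Fin 4)), Function.Injective β ∧
      Function.Bijective ψ ∧ (∀ g i, g (β i) = β (ψ g i)) ∧
      (P.map (algebraMap k L)).roots = Finset.univ.val.map β := by
  classical
  have hP0 : P ≠ 0 := by
    rintro rfl
    simp at hP
  have hroots : (P.map (algebraMap k L)).roots.card = 4 := by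
    rw [← (IsSplittingField.splits L P).natDegree_eq_card_roots, natDegree_map, hP]
  have hle : Nat.card (P.rootSet L) ≤ 4 := by
    rw [Nat.card_coe_set_eq, rootSet_def, Set.ncard_coe_finset, ← hroots]
    exact Multiset.toFinset_card_le _
  -- The group acts faithfully on the roots, so `24` is at most the factorial of their number. Hence
  -- the four roots are distinct.
  have hge : 4 ≤ Nat.card (P.rootSet L) := by
    have h := Nat.card_le_card_of_injective _ (rootAction_injective (L := L) P)
    rw [hcard, Nat.card_perm] at h
    by_contra! hlt
    have := h.trans (Nat.factorial_le (Nat.lt_succ_iff.1 hlt))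
    exact absurd this (by decide)
  have h4 : Nat.card (P.rootSet L) = 4 := le_antisymm hle hge
  have E : P.rootSet L ≃ Fin 4 := Finite.equivFinOfCardEq h4
  let β : Fin 4 → L := fun i => E.symm i
  have hβ : Function.Injective β := Subtype.val_injective.comp E.symm.injective
  refine ⟨β, E.permCongrHom.toMonoidHom.comp (rootAction P), hβ, ?_, fun g i => ?_, ?_⟩
  · rw [Nat.bijective_iff_injective_and_card]
    refine ⟨E.permCongrHom.injective.comp (rootAction_injective P), ?_⟩
    rw [hcard, Nat.card_perm, Nat.card_eq_fintype_card, Fintype.card_fin]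
    rfl
  · change _ = ((E.symm (E (rootAction P g (E.symm i)))) : L)
    rw [E.symm_apply_apply, coe_rootAction]
  · symm
    refine Multiset.eq_of_le_of_card_le ?_ ?_
    · rw [Multiset.le_iff_subset (Finset.univ.nodup.map hβ)]
      intro x hx
      obtain ⟨i, -, rfl⟩ := Multiset.mem_map.1 hx
      exact Multiset.mem_toFinset.1 (Finset.mem_coe.1 (rootSet_def P L ▸ (E.symm i).2))
    · rw [hroots]
      simp

/-- With leading coefficient `a` and Vandermonde determinant `V`, the resultant of `P` and `P'` is
`a · disc` (the sign is `(-1)^6`), and also `a³ ∏ P'(βᵢ) = a⁷ V²`. Cancelling `a` gives an explicit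
square root of the discriminant. -/
theorem discr_eq_of_roots {P : k[X]} (hP : P.natDegree = 4)
    (hsplit : (P.map (algebraMap k L)).Splits) {β : Fin 4 → L}
    (hβ : (P.map (algebraMap k L)).roots = Finset.univ.val.map β) :
    algebraMap k L P.discr =
      (algebraMap k L P.leadingCoeff ^ 3 * (Matrix.vandermonde β).det) ^ 2 := by
  classical
  set a := algebraMap k L P.leadingCoeff with ha
  have ha0 : a ≠ 0 := by
    rw [ha, Ne, map_eq_zero, leadingCoeff_eq_zero]
    rintro rfl
    simp at hP
  have h1 := congrArg (algebraMap k L) (resultant_deriv (f := P)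
    (natDegree_pos_iff_degree_pos.1 (by omega)))
  have hlead : (P.map (algebraMap k L)).leadingCoeff = a := leadingCoeff_map _
  have hd : (P.map (algebraMap k L)).natDegree = 4 := by rw [natDegree_map, hP]
  rw [hP, ← resultant_map_map, ← derivative_map] at h1
  have h2 := resultant_eq_prod_eval (P.map (algebraMap k L)) (P.map (algebraMap k L)).derivative 3
    ((natDegree_derivative_le _).trans (by omega)) hsplit
  rw [hd] at h2
  rw [show 4 - 1 = 3 from rfl, h2, hlead, hβ] at h1
  have h3 : ∀ i, eval (β i) (derivative (P.map (algebraMap k L))) =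
      a * ∏ j ∈ Finset.univ.erase i, (β i - β j) := by
    intro i
    have h4 : P.map (algebraMap k L) = C a * ∏ j, (X - C (β j)) := by
      conv_lhs => rw [hsplit.eq_prod_roots, hlead, hβ, Multiset.map_map]
      rfl
    rw [h4, derivative_C_mul, eval_C_mul, derivative_prod_finset]
    congr 1
    rw [eval_finsetSum, Finset.sum_eq_single i]
    · simp [eval_prod]
    · intro j _ hj
      rw [eval_mul, eval_prod, Finset.prod_eq_zero (i := i)]
      · simp
      · simp [hj.symm]
      · simp
    · simp
  rw [Multiset.map_map] at h1
  simp only [Function.comp_apply, h3] at h1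
  change a ^ 3 * ∏ i, (a * ∏ j ∈ Finset.univ.erase i, (β i - β j)) = _ at h1
  have h5 : ∏ i, (a * ∏ j ∈ Finset.univ.erase i, (β i - β j)) =
      a ^ 4 * (Matrix.vandermonde β).det ^ 2 := by
    rw [Matrix.det_vandermonde]
    have e0 : Finset.univ.erase (0 : Fin 4) = {1, 2, 3} := by decide
    have e1 : Finset.univ.erase (1 : Fin 4) = {0, 2, 3} := by decide
    have e2 : Finset.univ.erase (2 : Fin 4) = {0, 1, 3} := by decide
    have e3 : Finset.univ.erase (3 : Fin 4) = {0, 1, 2} := by decide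
    have i0 : Finset.Ioi (0 : Fin 4) = {1, 2, 3} := by decide
    have i1 : Finset.Ioi (1 : Fin 4) = {2, 3} := by decide
    have i2 : Finset.Ioi (2 : Fin 4) = {3} := by decide
    have i3 : Finset.Ioi (3 : Fin 4) = ∅ := by decide
    simp only [Fin.prod_univ_four, e0, e1, e2, e3, i0, i1, i2, i3]
    simp only [Finset.prod_insert, Finset.mem_insert, Finset.mem_singleton, Fin.reduceEq,
      or_self, not_false_eq_true, Finset.prod_singleton, Finset.prod_empty]
    ring
  rw [h5, map_mul, map_mul, ← ha] at h1
  norm_num at h1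
  refine mul_left_cancel₀ ha0 ?_
  rw [← h1]
  ring

theorem map_det_vandermonde {β : Fin 4 → L} {ψ : Gal(L/k) →* Equiv.Perm (Fin 4)}
    (hψ : ∀ g i, g (β i) = β (ψ g i)) (g : Gal(L/k)) :
    g (Matrix.vandermonde β).det =
      ((Equiv.Perm.sign (ψ g) : ℤ) : L) * (Matrix.vandermonde β).det := by
  rw [← Matrix.det_permute, ← AlgEquiv.coe_ringEquiv, RingEquiv.map_det]
  congr 1
  ext i j
  simp [Matrix.vandermonde_apply, hψ]

end Quartic

/-! ### Subgroups of `S₄` above a subgroup of order three -/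

section SymmetricGroup

theorem eq_of_pow_three_eq_one {p : Equiv.Perm (Fin 4)} (h : p ^ 3 = 1) (hp : p ≠ 1) {x y : Fin 4}
    (hx : p x = x) (hy : p y = y) : x = y := by
  revert p x y
  decide +kernel

theorem exists_fixed_of_pow_three_eq_one {p : Equiv.Perm (Fin 4)} (h : p ^ 3 = 1) :
    ∃ x, p x = x := by
  revert p
  decide +kernel

theorem card_stabilizer_fin_four (i : Fin 4) :
    Nat.card (MulAction.stabilizer (Equiv.Perm (Fin 4)) i) = 6 := by
  have h : ∀ i : Fin 4, Fintype.card {p : Equiv.Perm (Fin 4) // p i = i} = 6 := by decide +kernel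
  rw [← h i, ← Nat.card_eq_fintype_card]
  rfl

theorem exists_odd_fixed (i : Fin 4) :
    ∃ p : Equiv.Perm (Fin 4), p i = i ∧ Equiv.Perm.sign p ≠ 1 := by
  revert i
  decide +kernel

theorem exists_even_moved (i : Fin 4) :
    ∃ p : Equiv.Perm (Fin 4), p i ≠ i ∧ Equiv.Perm.sign p = 1 := by
  revert i
  decide +kernel

theorem card_perm_fin_four : Nat.card (Equiv.Perm (Fin 4)) = 24 := by
  rw [Nat.card_perm, Nat.card_eq_fintype_card, Fintype.card_fin]
  rfl

/-- The subgroups of `S₄` which contain a given subgroup of order three. -/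
theorem eq_of_le_of_card_eq_three {H U : Subgroup (Equiv.Perm (Fin 4))} (hH : Nat.card H = 3)
    {i : Fin 4} (hi : ∀ p ∈ H, p i = i) (hle : H ≤ U) :
    U = H ∨ U = MulAction.stabilizer (Equiv.Perm (Fin 4)) i ∨ U = alternatingGroup (Fin 4) ∨
      U = ⊤ := by
  have h24 := card_perm_fin_four
  have h1 : Nat.card U ∣ 24 := h24 ▸ Subgroup.card_subgroup_dvd_card U
  have h2 : 3 ∣ Nat.card U := hH ▸ Subgroup.card_dvd_of_le hle
  have h3 : ∀ n, n ∣ 24 → 3 ∣ n → n = 3 ∨ n = 6 ∨ n = 12 ∨ n = 24 := by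
    intro n hn h
    have : n ≤ 24 := Nat.le_of_dvd (by norm_num) hn
    interval_cases n <;> omega
  obtain ⟨p, hp3, hp1, hHp⟩ := exists_generator_of_card_eq_three hH
  have hp : p ∈ H := hHp ▸ Subgroup.mem_zpowers p
  rcases h3 _ h1 h2 with h | h | h | h
  · exact Or.inl (Subgroup.eq_of_le_of_card_ge hle (by omega)).symm
  · refine Or.inr (Or.inl (Subgroup.eq_of_le_of_card_ge (fun u hu => ?_)
      (by rw [card_stabilizer_fin_four, h])))
    -- In a group `U` of order six, `H` has index two and is normal, so `u⁻¹ p u` fixes `i`; hence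
    -- `p` fixes `u i`. Since `p` is a 3-cycle it has a single fixed point, so `u i = i`.
    have hindex : (H.subgroupOf U).index = 2 := by
      have := Subgroup.card_mul_index (H.subgroupOf U)
      rw [Nat.card_congr (Subgroup.subgroupOfEquivOfLe hle).toEquiv, hH, h] at this
      omega
    have hnormal := Subgroup.normal_of_index_eq_two hindex
    have hconj : u⁻¹ * p * u ∈ H := by
      have := hnormal.conj_mem ⟨p, hle hp⟩ hp (⟨u, hu⟩⁻¹ : U)
      rwa [inv_inv] at this
    refine eq_of_pow_three_eq_one hp3 hp1 ?_ (hi p hp)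
    have := congrArg u (hi _ hconj)
    rwa [← Equiv.Perm.mul_apply, ← mul_assoc, ← mul_assoc, mul_inv_cancel, one_mul] at this
  · refine Or.inr (Or.inr (Or.inl (Equiv.Perm.eq_alternatingGroup_of_index_eq_two ?_)))
    have := Subgroup.card_mul_index U
    rw [h, h24] at this
    omega
  · exact Or.inr (Or.inr (Or.inr (Subgroup.eq_top_of_card_eq U (by omega))))

end SymmetricGroup

/-! ### Intermediate fields of `K/k` and the quartic -/

section IntermediateFields

variable {k : Type u} {Kt : Type v} [Field k] [Field Kt] [Algebra k Kt]
variable {G' : Subgroup Gal(Kt/k)}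

/-- The elements of the Galois group which fix an intermediate field of `Kt^{G'} / k`. -/
def fixing (E : IntermediateField k (IntermediateField.fixedField G')) : Subgroup Gal(Kt/k) :=
  (IntermediateField.lift E).fixingSubgroup

theorem mem_fixing {E : IntermediateField k (IntermediateField.fixedField G')} {g : Gal(Kt/k)} :
    g ∈ fixing E ↔ ∀ x ∈ E, g (x : Kt) = x := by
  rw [fixing, IntermediateField.mem_fixingSubgroup_iff]
  constructor
  · intro h x hx
    exact h _ ((IntermediateField.mem_lift x).2 hx)
  · rintro h _ ⟨x, hx, rfl⟩
    exact h x hx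

theorem le_fixing (E : IntermediateField k (IntermediateField.fixedField G')) : G' ≤ fixing E :=
  fun g hg => mem_fixing.2 fun x _ => x.2 ⟨g, hg⟩

theorem mem_fixing_adjoin {S : Set (IntermediateField.fixedField G')} {g : Gal(Kt/k)} :
    g ∈ fixing (IntermediateField.adjoin k S) ↔ ∀ x ∈ S, g (x : Kt) = x := by
  rw [fixing, IntermediateField.lift_adjoin, IntermediateField.mem_fixingSubgroup_iff]
  refine (IntermediateField.forall_mem_adjoin_smul_eq_self_iff k g).trans ?_
  exact Set.forall_mem_image

theorem fixing_bot :
    fixing (⊥ : IntermediateField k (IntermediateField.fixedField G')) = ⊤ := by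
  rw [fixing, IntermediateField.lift_bot, IntermediateField.fixingSubgroup_bot]

variable [FiniteDimensional k Kt]

theorem fixing_top :
    fixing (⊤ : IntermediateField k (IntermediateField.fixedField G')) = G' := by
  rw [fixing, IntermediateField.lift_top, IntermediateField.fixingSubgroup_fixedField]

variable [IsGalois k Kt]

theorem fixing_injective :
    Function.Injective (fixing (k := k) (Kt := Kt) (G' := G')) := fun E F h =>
  IntermediateField.lift_injective _ (by
    rw [← IsGalois.fixedField_fixingSubgroup (IntermediateField.lift E),
      ← IsGalois.fixedField_fixingSubgroup (IntermediateField.lift F)]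
    exact congrArg IntermediateField.fixedField h)

theorem mem_iff_forall_fixing {E : IntermediateField k (IntermediateField.fixedField G')}
    {x : IntermediateField.fixedField G'} : x ∈ E ↔ ∀ g ∈ fixing E, g (x : Kt) = x := by
  refine ⟨fun hx g hg => mem_fixing.1 hg x hx, fun h => ?_⟩
  rw [← IntermediateField.mem_lift, ← IsGalois.fixedField_fixingSubgroup (IntermediateField.lift E)]
  exact fun g => h g g.2

end IntermediateFields

section QuarticFields

open Polynomial

variable {k : Type u} {Kt : Type v} [Field k] [Field Kt] [Algebra k Kt]
variable [FiniteDimensional k Kt] [IsGalois k Kt]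
variable {G' : Subgroup Gal(Kt/k)}

/-- The subfields generated by a root and a square root of the discriminant, in terms of
subgroups. -/
structure IsQuarticPair (φ : Gal(Kt/k) ≃* Equiv.Perm (Fin 4)) (P : k[X])
    (α d : IntermediateField.fixedField G') : Prop where
  root_unique : ∀ α' : IntermediateField.fixedField G', aeval α' P = 0 → α' = α
  mem_fixing_sqrt : ∀ g, g ∈ fixing k⟮d⟯ ↔ Equiv.Perm.sign (φ g) = 1
  eq_of_le : ∀ V, G' ≤ V → V = G' ∨ V = fixing k⟮α⟯ ∨ V = fixing k⟮d⟯ ∨ V = ⊤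
  not_le : ¬ fixing k⟮α⟯ ≤ fixing k⟮d⟯
  not_ge : ¬ fixing k⟮d⟯ ≤ fixing k⟮α⟯

/-- The action `ψ` on the roots identifies the Galois group with `S₄`. A generator of `G'` acts as a
3-cycle: it fixes exactly one root, and it is even, so it fixes `a³ V`. The groups fixing `α` and
`√δ` are then a point stabilizer and `A₄`, which are incomparable. -/
theorem isQuarticPair (φ : Gal(Kt/k) ≃* Equiv.Perm (Fin 4)) (hG' : Nat.card G' = 3) {P : k[X]}
    (h2 : (2 : k) ≠ 0) (hP : P.natDegree = 4) [P.IsSplittingField k Kt] :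
    (∃ α : IntermediateField.fixedField G', aeval α P = 0) ∧
    (∃ d : IntermediateField.fixedField G', d ^ 2 = algebraMap k _ P.discr) ∧
    ∀ α d : IntermediateField.fixedField G', aeval α P = 0 → d ^ 2 = algebraMap k _ P.discr →
      IsQuarticPair φ P α d := by
  have hcard : Nat.card Gal(Kt/k) = 24 := by rw [Nat.card_congr φ.toEquiv, card_perm_fin_four]
  obtain ⟨β, ψ, hβ, hψ, hβψ, hroots⟩ := exists_roots_of_card hP hcard
  have hP0 : P ≠ 0 := by
    rintro rfl
    simp at hP
  have hroot : ∀ x : Kt, aeval x P = 0 ↔ ∃ i, β i = x := fun x => by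
    have : x ∈ (P.map (algebraMap k Kt)).roots ↔ aeval x P = 0 := mem_aroots.trans (by simp [hP0])
    rw [← this, hroots]
    simp only [Multiset.mem_map, Finset.mem_val, Finset.mem_univ, true_and]
  have hroot' : ∀ x : IntermediateField.fixedField G', aeval x P = 0 ↔ ∃ i, β i = x := fun x => by
    rw [← hroot, ← IntermediateField.coe_val, aeval_algHom_apply]
    simp
  -- The identifications `ψ` and `φ` differ by an automorphism of `S₄`; they have the same sign
  -- because `S₄` has only one surjection onto `{±1}`.
  have hsign : ∀ g, Equiv.Perm.sign (ψ g) = Equiv.Perm.sign (φ g) := by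
    have hs : (Equiv.Perm.sign.comp (ψ.comp φ.symm.toMonoidHom)) = Equiv.Perm.sign :=
      Equiv.Perm.eq_sign_of_surjective_hom (by
        rw [MonoidHom.coe_comp, MonoidHom.coe_comp]
        exact (Equiv.Perm.sign_surjective _).comp (hψ.2.comp φ.symm.surjective))
    intro g
    have := DFunLike.congr_fun hs (φ g)
    simpa using this
  obtain ⟨x, hx3, hx1, hGx⟩ := exists_generator_of_card_eq_three hG'
  have hxG : x ∈ G' := hGx ▸ Subgroup.mem_zpowers x
  have hψx3 : ψ x ^ 3 = 1 := by rw [← map_pow, hx3, map_one]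
  have hψx1 : ψ x ≠ 1 := fun h => hx1 (hψ.1 (h.trans (map_one ψ).symm))
  have hmem : ∀ y : Kt, x y = y → y ∈ IntermediateField.fixedField G' := by
    rintro y hy ⟨g, hg⟩
    rw [hGx, Subgroup.mem_zpowers_iff] at hg
    obtain ⟨n, rfl⟩ := hg
    exact MulAction.mem_stabilizer_iff.1
      (zpow_mem (show x ∈ MulAction.stabilizer Gal(Kt/k) y from hy) n)
  set δ := algebraMap k Kt P.leadingCoeff ^ 3 * (Matrix.vandermonde β).det with hδ
  have hδ2 : algebraMap k Kt P.discr = δ ^ 2 :=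
    discr_eq_of_roots hP (IsSplittingField.splits Kt P) hroots
  have hδ0 : δ ≠ 0 := by
    refine mul_ne_zero (pow_ne_zero _ ?_) (Matrix.det_vandermonde_ne_zero_iff.2 hβ)
    rwa [Ne, map_eq_zero, leadingCoeff_eq_zero]
  have hgδ : ∀ g : Gal(Kt/k), g δ = ((Equiv.Perm.sign (φ g) : ℤ) : Kt) * δ := fun g => by
    rw [hδ, map_mul, map_pow, AlgEquiv.commutes, map_det_vandermonde hβψ, hsign]
    ring
  have hfixδ : ∀ g : Gal(Kt/k), g δ = δ ↔ Equiv.Perm.sign (φ g) = 1 := fun g => by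
    rw [hgδ]
    rcases Int.units_eq_one_or (Equiv.Perm.sign (φ g)) with h | h
    · simp [h]
    · simp only [h, Units.val_neg, Units.val_one, Int.cast_neg, Int.cast_one, neg_mul, one_mul]
      refine iff_of_false (fun h => hδ0 ?_) (by decide)
      -- An odd element sends `δ` to `-δ`, which differs from `δ` only because the characteristic is
      -- not two.
      have h2' : (2 : Kt) ≠ 0 := by
        have := (map_ne_zero (algebraMap k Kt)).2 h2
        rwa [map_ofNat] at this
      have h3 : (2 : Kt) * δ = 0 := by linear_combination -h
      exact (mul_eq_zero.1 h3).resolve_left h2'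
  obtain ⟨i, hi⟩ := exists_fixed_of_pow_three_eq_one hψx3
  have hiG : ∀ g ∈ G', ψ g i = i := by
    intro g hg
    rw [hGx, Subgroup.mem_zpowers_iff] at hg
    obtain ⟨n, rfl⟩ := hg
    rw [map_zpow]
    exact Equiv.Perm.zpow_apply_eq_self_of_apply_eq_self hi n
  have huniq : ∀ α : IntermediateField.fixedField G', aeval α P = 0 → (α : Kt) = β i := by
    intro α hα
    obtain ⟨j, hj⟩ := (hroot' α).1 hα
    rw [← hj]
    refine congrArg β (eq_of_pow_three_eq_one hψx3 hψx1 (hβ ?_) hi)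
    rw [← hβψ, hj]
    exact α.2 ⟨x, hxG⟩
  refine ⟨⟨⟨β i, hmem _ (by rw [hβψ, hi])⟩, (hroot' _).2 ⟨i, rfl⟩⟩,
    ⟨⟨δ, hmem _ ((hfixδ x).2 ?_)⟩, Subtype.ext hδ2.symm⟩, fun α d hα hd => ?_⟩
  · have h3 : Equiv.Perm.sign (φ x) ^ 3 = 1 := by rw [← map_pow, ← map_pow, hx3, map_one, map_one]
    rcases Int.units_eq_one_or (Equiv.Perm.sign (φ x)) with h | h
    · exact h
    · rw [h] at h3
      exact absurd h3 (by decide)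
  have hα' := huniq α hα
  have hd' : (d : Kt) = δ ∨ (d : Kt) = -δ := by
    rw [← sq_eq_sq_iff_eq_or_eq_neg, ← hδ2]
    exact congrArg Subtype.val hd
  have hfixα : ∀ g, g ∈ fixing k⟮α⟯ ↔ ψ g i = i := fun g => by
    rw [mem_fixing_adjoin, ← hβ.eq_iff, ← hβψ, ← hα']
    simp
  have hfixd : ∀ g, g ∈ fixing k⟮d⟯ ↔ Equiv.Perm.sign (φ g) = 1 := fun g => by
    rw [mem_fixing_adjoin, ← hfixδ]
    rcases hd' with h | h <;> simp [h]
  have hcases : ∀ V, G' ≤ V → V = G' ∨ V = fixing k⟮α⟯ ∨ V = fixing k⟮d⟯ ∨ V = ⊤ := by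
    intro V hV
    have hinj := Subgroup.map_injective hψ.1
    have h3 : Nat.card (G'.map ψ) = 3 := by
      rw [Subgroup.card_map_of_injective hψ.1, hG']
    have hα3 : (fixing k⟮α⟯).map ψ = MulAction.stabilizer (Equiv.Perm (Fin 4)) i := by
      ext p
      constructor
      · rintro ⟨g, hg, rfl⟩
        exact (hfixα g).1 hg
      · obtain ⟨g, rfl⟩ := hψ.2 p
        exact fun hg => ⟨g, (hfixα g).2 hg, rfl⟩
    have hd3 : (fixing k⟮d⟯).map ψ = alternatingGroup (Fin 4) := by
      ext p
      constructor
      · rintro ⟨g, hg, rfl⟩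
        exact (hsign g).trans ((hfixd g).1 hg)
      · obtain ⟨g, rfl⟩ := hψ.2 p
        exact fun hg => ⟨g, (hfixd g).2 ((hsign g).symm.trans hg), rfl⟩
    have htop : (⊤ : Subgroup Gal(Kt/k)).map ψ = ⊤ := Subgroup.map_top_of_surjective _ hψ.2
    have := eq_of_le_of_card_eq_three h3 (i := i) (by
      rintro _ ⟨g, hg, rfl⟩
      exact hiG g hg) (Subgroup.map_mono hV)
    rwa [← hα3, ← hd3, ← htop, hinj.eq_iff, hinj.eq_iff, hinj.eq_iff, hinj.eq_iff] at this
  refine ⟨fun α' h => Subtype.ext ((huniq α' h).trans hα'.symm), hfixd, hcases, fun hle => ?_,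
    fun hle => ?_⟩
  · obtain ⟨p, hp, hs⟩ := exists_odd_fixed i
    obtain ⟨g, rfl⟩ := hψ.2 p
    exact hs ((hsign g).trans ((hfixd g).1 (hle ((hfixα g).2 hp))))
  · obtain ⟨p, hp, hs⟩ := exists_even_moved i
    obtain ⟨g, rfl⟩ := hψ.2 p
    exact hp ((hfixα g).1 (hle ((hfixd g).2 ((hsign g).symm.trans hs))))

end QuarticFields

/-! ### Fixed fields of the stable subgroups -/

section Tables

open Polynomial

variable {k : Type u} {Kt : Type v} [Field k] [Field Kt] [Algebra k Kt]
variable [FiniteDimensional k Kt] [IsGalois k Kt]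
variable {G' : Subgroup Gal(Kt/k)} {φ : Gal(Kt/k) ≃* Equiv.Perm (Fin 4)}

namespace IsQuarticPair

variable {P : k[X]} {α d : IntermediateField.fixedField G'}

theorem inf_eq (hq : IsQuarticPair φ P α d) : fixing k⟮α⟯ ⊓ fixing k⟮d⟯ = G' := by
  rcases hq.eq_of_le _ (le_inf (le_fixing k⟮α⟯) (le_fixing k⟮d⟯)) with h | h | h | h
  · exact h
  · exact absurd (inf_eq_left.1 h) hq.not_le
  · exact absurd (inf_eq_right.1 h) hq.not_ge
  · exact absurd (le_top.trans (h.symm.le.trans inf_le_right)) hq.not_le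

theorem adjoin_eq_top (hq : IsQuarticPair φ P α d) : IntermediateField.adjoin k {α, d} = ⊤ := by
  apply fixing_injective
  refine Eq.trans ?_ (hq.inf_eq.trans fixing_top.symm)
  ext g
  simp [mem_fixing_adjoin]

theorem adjoin_ne (hq : IsQuarticPair φ P α d) : k⟮α⟯ ≠ k⟮d⟯ := fun h => hq.not_le (h ▸ le_rfl)

theorem intermediateFields_eq (hq : IsQuarticPair φ P α d) :
    {E : IntermediateField k (IntermediateField.fixedField G') | E ≠ ⊥ ∧ E ≠ ⊤} =
      {k⟮α⟯, k⟮d⟯} := by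
  ext E
  constructor
  · rintro ⟨hbot, htop⟩
    rcases hq.eq_of_le _ (le_fixing E) with h | h | h | h
    · exact absurd (fixing_injective (h.trans fixing_top.symm)) htop
    · exact Or.inl (fixing_injective h)
    · exact Or.inr (fixing_injective h)
    · exact absurd (fixing_injective (h.trans fixing_bot.symm)) hbot
  · rintro (rfl | rfl)
    · refine ⟨fun h => hq.not_ge ?_, fun h => hq.not_le ?_⟩
      · rw [h, fixing_bot]
        exact le_top
      · rw [h, fixing_top]
        exact le_fixing _
    · refine ⟨fun h => hq.not_le ?_, fun h => hq.not_ge ?_⟩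
      · rw [h, fixing_bot]
        exact le_top
      · rw [h, fixing_top]
        exact le_fixing _

end IsQuarticPair

variable {X : Type} {e : Gal(Kt/k) ⧸ G' ≃ X}

/-- If `x` is fixed by the embeddings from `M`, a single one off the base point provides some `g ∉
G'` fixing both `x` and `E`. Among the four possible groups for `k(x)`, `G'` misses `g`, and the
group of `E'` meets that of `E` inside `G'`; the remaining two contain the group of `E`, so `x ∈ E`.
-/
theorem mem_iff_forall_emb {E E' : IntermediateField k (IntermediateField.fixedField G')}
    (hcases : ∀ V, G' ≤ V → V = G' ∨ V = fixing E ∨ V = fixing E' ∨ V = ⊤)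
    (hinf : fixing E ⊓ fixing E' ≤ G') {M : Subgroup (Equiv.Perm X)}
    (hM : ∀ π ∈ M, ∃ g : Gal(Kt/k), e (g : Gal(Kt/k) ⧸ G') = π⁻¹ (basePoint e) ∧ g ∈ fixing E)
    (hne : ∃ π ∈ M, π⁻¹ (basePoint e) ≠ basePoint e) (x : IntermediateField.fixedField G') :
    x ∈ E ↔ ∀ π ∈ M, emb e (π⁻¹ (basePoint e)) x = x := by
  constructor
  · intro hx π hπ
    obtain ⟨g, hg, hgE⟩ := hM π hπ
    rw [← hg, emb_mk, mem_fixing.1 hgE x hx]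
  · intro hx
    obtain ⟨π, hπ, hne⟩ := hne
    obtain ⟨g, hg, hgE⟩ := hM π hπ
    have hgx : g ∈ fixing k⟮x⟯ := mem_fixing_adjoin.2 (by
      rintro _ rfl
      rw [← emb_mk e, hg, hx π hπ])
    have hgG : g ∉ G' := fun h => hne (by
      rw [← hg, ← leftTranslation_basePoint, leftTranslation_basePoint_eq_iff]
      exact h)
    have hle : fixing E ≤ fixing k⟮x⟯ := by
      rcases hcases _ (le_fixing k⟮x⟯) with h | h | h | h
      · exact absurd (h ▸ hgx) hgG
      · exact h.ge
      · exact absurd (hinf ⟨hgE, h ▸ hgx⟩) hgG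
      · exact h ▸ le_top
    rw [mem_iff_forall_fixing]
    exact fun g hg => mem_fixing.1 (hle hg) x (IntermediateField.mem_adjoin_simple_self k x)

variable {e : Gal(Kt/k) ⧸ G' ≃ Fin 8}

theorem IsAdmissible.symm_gamma_mem (h : IsAdmissible φ e) : φ.symm c[2, 3, 4] ∈ G' := by
  have : c[2, 3, 4] ∈ G'.map φ.toMonoidHom := h.map_eq ▸ Subgroup.mem_zpowers _
  obtain ⟨g, hg, hgc⟩ := this
  rw [← hgc]
  change φ.symm (φ g) ∈ G'
  rwa [φ.symm_apply_apply]

theorem IsAdmissible.leftTranslation_eq (h : IsAdmissible φ e) {g : Gal(Kt/k)} (hg : g ∈ G')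
    {y : Fin 8} (hy : permGamma y = y) : leftTranslation e g y = y := by
  have : φ g ∈ Subgroup.zpowers c[2, 3, 4] := h.map_eq ▸ ⟨g, hg, rfl⟩
  obtain ⟨n, hn⟩ := Subgroup.mem_zpowers_iff.1 this
  have hg' : g = φ.symm c[2, 3, 4] ^ n := by rw [← map_zpow, hn, φ.symm_apply_apply]
  rw [hg', map_zpow, h.gamma_eq]
  exact Equiv.Perm.zpow_apply_eq_self_of_apply_eq_self hy n

/-- Admissibility does not force the trivial coset to have number `1`: its number may be either
fixed point of `permGamma`, `1` or `7`. This is why the later conditions on `M` are imposed at all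
points, or at all fixed points of `permGamma`. -/
theorem IsAdmissible.basePoint_fixed (h : IsAdmissible φ e) :
    permGamma (basePoint e) = basePoint e := by
  rw [← h.gamma_eq, leftTranslation_basePoint_eq_iff]
  exact h.symm_gamma_mem

/-- Only the permutations `λ(τ)` and `λ(σ)` enter, so this holds whichever coset has number `1`. -/
theorem IsAdmissible.leftTranslation_cosetRep (h : IsAdmissible φ e) (y : Fin 8) :
    leftTranslation e (φ.symm (cosetRep y)) 1 = y := by
  -- Words in abstract `A`, `B` free the claim from the Galois group; with the explicit permutations
  -- inserted it is a finite check.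
  have key : ∀ A B : Equiv.Perm (Fin 8), leftTranslation e (φ.symm c[1, 2, 3, 4]) = A →
      leftTranslation e (φ.symm c[1, 2]) = B → leftTranslation e (φ.symm (cosetRep y)) =
        (![A * A * A * B * A * A, 1, A, A * A, A * A * A, B * A * A, A * B * A * A,
          A * A * B * A * A] : Fin 8 → Equiv.Perm (Fin 8)) y := by
    rintro _ _ rfl rfl
    fin_cases y <;> simp [cosetRep]
  rw [key _ _ h.tau_eq h.sigma_eq]
  clear key
  revert y
  decide +kernel

theorem IsAdmissible.exists_leftTranslation (h : IsAdmissible φ e) (x y : Fin 8)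
    (hxy : Equiv.Perm.sign (cosetRep x) = Equiv.Perm.sign (cosetRep y)) :
    ∃ g : Gal(Kt/k), leftTranslation e g x = y ∧ Equiv.Perm.sign (φ g) = 1 := by
  refine ⟨φ.symm (cosetRep y * (cosetRep x)⁻¹), ?_, ?_⟩
  · nth_rw 2 [← h.leftTranslation_cosetRep x]
    rw [map_mul, map_mul, map_inv, map_inv, Equiv.Perm.mul_apply, ← Equiv.Perm.mul_apply _⁻¹,
      inv_mul_cancel, Equiv.Perm.one_apply, h.leftTranslation_cosetRep]
  · rw [φ.apply_symm_apply, map_mul, map_inv, hxy, mul_inv_cancel]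

/-- A coset fixed by `permGamma` gives an embedding with image in `K`. It sends `α` to a root of `P`
in `K`, and there is only one. -/
theorem emb_eq_of_fixed (h : IsAdmissible φ e) {P : k[X]} {α d : IntermediateField.fixedField G'}
    (hq : IsQuarticPair φ P α d) (hα : aeval α P = 0) {y : Fin 8} (hy : permGamma y = y) :
    emb e y α = α := by
  have hmem : emb e y α ∈ IntermediateField.fixedField G' := by
    rintro ⟨g, hg⟩
    exact (apply_emb e g y α).trans (by rw [h.leftTranslation_eq hg hy])
  refine congrArg Subtype.val (hq.root_unique ⟨_, hmem⟩ ?_)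
  apply Subtype.val_injective
  change IntermediateField.val _ (aeval _ P) = 0
  rw [← aeval_algHom_apply]
  change aeval (emb e y α) P = 0
  rw [aeval_algHom_apply, hα, map_zero]

theorem mem_adjoin_root_iff (h : IsAdmissible φ e) {P : k[X]}
    {α d : IntermediateField.fixedField G'} (hq : IsQuarticPair φ P α d) (hα : aeval α P = 0)
    {M : Subgroup (Equiv.Perm (Fin 8))}
    (hM : ∀ π ∈ M, ∀ x, permGamma x = x → permGamma (π⁻¹ x) = π⁻¹ x)
    (hne : ∃ π ∈ M, ∀ x, π⁻¹ x ≠ x) (x : IntermediateField.fixedField G') :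
    x ∈ k⟮α⟯ ↔ ∀ π ∈ M, emb e (π⁻¹ (basePoint e)) x = x := by
  refine mem_iff_forall_emb hq.eq_of_le hq.inf_eq.le (fun π hπ => ?_)
    (hne.imp fun π hπ => ⟨hπ.1, hπ.2 _⟩) x
  obtain ⟨g, hg⟩ := exists_mk_eq e (π⁻¹ (basePoint e))
  refine ⟨g, hg, mem_fixing_adjoin.2 ?_⟩
  rintro _ rfl
  rw [← emb_mk e, hg, emb_eq_of_fixed h hq hα (hM π hπ _ h.basePoint_fixed)]

/-- Equal signs of the coset representatives allow the Galois element moving the base point to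
`π⁻¹(1̄)` to be chosen even, so that it fixes `√δ`. -/
theorem mem_adjoin_sqrt_iff (h : IsAdmissible φ e) {P : k[X]}
    {α d : IntermediateField.fixedField G'} (hq : IsQuarticPair φ P α d)
    {M : Subgroup (Equiv.Perm (Fin 8))}
    (hM : ∀ π ∈ M, ∀ x,
      Equiv.Perm.sign (cosetRep x) = Equiv.Perm.sign (cosetRep (π⁻¹ x)))
    (hne : ∃ π ∈ M, ∀ x, π⁻¹ x ≠ x) (x : IntermediateField.fixedField G') :
    x ∈ k⟮d⟯ ↔ ∀ π ∈ M, emb e (π⁻¹ (basePoint e)) x = x := by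
  refine mem_iff_forall_emb (E' := k⟮α⟯) (fun V hV => ?_) (inf_comm (fixing k⟮α⟯) _ ▸ hq.inf_eq.le)
    (fun π hπ => ?_) (hne.imp fun π hπ => ⟨hπ.1, hπ.2 _⟩) x
  · have := hq.eq_of_le V hV
    tauto
  · obtain ⟨g, hg, hs⟩ := h.exists_leftTranslation _ _ (hM π hπ (basePoint e))
    exact ⟨g, by rw [← leftTranslation_basePoint, hg], (hq.mem_fixing_sqrt g).2 hs⟩

theorem closure_t_fixes {i : Fin 4} (hi : i = 0 ∨ i = 1) :
    (∀ π ∈ Subgroup.closure {t i}, ∀ x, permGamma x = x → permGamma (π⁻¹ x) = π⁻¹ x) ∧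
      ∃ π ∈ Subgroup.closure {t i}, ∀ x, π⁻¹ x ≠ x := by
  have h1 : ∀ i : Fin 4, i = 0 ∨ i = 1 → (∀ x, permGamma x = x →
      permGamma ((t i)⁻¹ x) = (t i)⁻¹ x) ∧ ∀ x, (t i)⁻¹ x ≠ x := by decide +kernel
  refine ⟨fun π hπ x hx => ?_, t i, Subgroup.subset_closure rfl, (h1 i hi).2⟩
  rcases (mem_closure_singleton_of_mul_self (t_mul_self i)).1 hπ with rfl | rfl
  · rwa [inv_one, Equiv.Perm.one_apply]
  · exact (h1 i hi).1 x hx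

theorem closure_pair_sign {a b : Equiv.Perm (Fin 8)} (ha : a * a = 1) (hb : b * b = 1)
    (hab : Commute a b)
    (h : ∀ x, Equiv.Perm.sign (cosetRep x) = Equiv.Perm.sign (cosetRep (a⁻¹ x)) ∧
      Equiv.Perm.sign (cosetRep x) = Equiv.Perm.sign (cosetRep (b⁻¹ x)) ∧ a⁻¹ x ≠ x) :
    (∀ π ∈ Subgroup.closure {a, b}, ∀ x,
      Equiv.Perm.sign (cosetRep x) = Equiv.Perm.sign (cosetRep (π⁻¹ x))) ∧
      ∃ π ∈ Subgroup.closure {a, b}, ∀ x, π⁻¹ x ≠ x := by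
  refine ⟨fun π hπ x => ?_, a, Subgroup.subset_closure (by simp), fun x => (h x).2.2⟩
  rcases (mem_closure_pair_of_commute ha hb hab).1 hπ with rfl | rfl | rfl | rfl
  · rw [inv_one, Equiv.Perm.one_apply]
  · exact (h x).1
  · exact (h x).2.1
  · rw [mul_inv_rev, Equiv.Perm.mul_apply, ← (h _).2.1]
    exact (h x).1

theorem closure_r_s_sign {i : Fin 4} (hi : i = 0) :
    (∀ π ∈ Subgroup.closure {r i, s i}, ∀ x,
      Equiv.Perm.sign (cosetRep x) = Equiv.Perm.sign (cosetRep (π⁻¹ x))) ∧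
      ∃ π ∈ Subgroup.closure {r i, s i}, ∀ x, π⁻¹ x ≠ x := by
  refine closure_pair_sign (r_mul_self i) (s_mul_self i) (commute_r_s i) ?_
  subst hi
  decide +kernel

theorem closure_r_t_sign {i : Fin 4} (hi : i = 2 ∨ i = 3) :
    (∀ π ∈ Subgroup.closure {r i, t i}, ∀ x,
      Equiv.Perm.sign (cosetRep x) = Equiv.Perm.sign (cosetRep (π⁻¹ x))) ∧
      ∃ π ∈ Subgroup.closure {r i, t i}, ∀ x, π⁻¹ x ≠ x := by
  refine closure_pair_sign (r_mul_self i) (t_mul_self i) (commute_r_t i) ?_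
  revert i
  decide +kernel

end Tables

end HopfGalois

end

/-! ### The main theorem -/

theorem mainTheorem2 {k : Type u} {Kt : Type v} [Field k] [Field Kt] [Algebra k Kt]
    [FiniteDimensional k Kt] [IsGalois k Kt]
    (hG : Nonempty (Gal(Kt/k) ≃* Equiv.Perm (Fin 4)))
    (G' : Subgroup Gal(Kt/k)) (hG' : Nat.card G' = 3) :
    (∃ (φ : Gal(Kt/k) ≃* Equiv.Perm (Fin 4)) (e : Gal(Kt/k) ⧸ G' ≃ Fin 8),
      HopfGalois.IsAdmissible φ e) ∧
    ∀ (φ : Gal(Kt/k) ≃* Equiv.Perm (Fin 4)) (e : Gal(Kt/k) ⧸ G' ≃ Fin 8),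
      HopfGalois.IsAdmissible φ e →
      -- the regular subgroups normalized by `λ(G)`
      (Function.Injective HopfGalois.N ∧
        (∀ i, Nonempty (HopfGalois.N i ≃*
          Multiplicative (ZMod 2) × Multiplicative (ZMod 2) × Multiplicative (ZMod 2))) ∧
        (∀ M : Subgroup (Equiv.Perm (Fin 8)),
          HopfGalois.IsRegular M ∧ HopfGalois.IsNormalized e M ↔ ∃ i, M = HopfGalois.N i)) ∧
      -- the Hopf Galois structures
      (∃ S : Fin 4 →
          HopfGalois.HopfGaloisStructure.{u, v, v} k (IntermediateField.fixedField G'),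
        (∀ i, Nonempty (HopfGalois.Realization e (HopfGalois.N i) (S i))) ∧
        ∀ T : HopfGalois.HopfGaloisStructure.{u, v, w} k (IntermediateField.fixedField G'),
          (∃! i, T.IsIso (S i)) ∧
          ∀ i, T.IsIso (S i) ↔ Nonempty (HopfGalois.Realization e (HopfGalois.N i) T)) ∧
      -- the Galois correspondences
      ∀ P : Polynomial k, (2 : k) ≠ 0 → P.natDegree = 4 → P.IsSplittingField k Kt →
        (∃ α : IntermediateField.fixedField G', Polynomial.aeval α P = 0) ∧
        (∃ d : IntermediateField.fixedField G', d ^ 2 = algebraMap k _ P.discr) ∧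
        ∀ α d : IntermediateField.fixedField G',
          Polynomial.aeval α P = 0 → d ^ 2 = algebraMap k _ P.discr →
          IntermediateField.adjoin k {α, d} = ⊤ ∧
          k⟮α⟯ ≠ k⟮d⟯ ∧
          {E : IntermediateField k (IntermediateField.fixedField G') | E ≠ ⊥ ∧ E ≠ ⊤} =
            {k⟮α⟯, k⟮d⟯} ∧
          ∀ T : HopfGalois.HopfGaloisStructure.{u, v, w} k (IntermediateField.fixedField G'),
            (∀ R : HopfGalois.Realization e (HopfGalois.N 0) T, HopfGalois.HasGaloisTable e R
              {(Subgroup.closure {HopfGalois.t 0}, k⟮α⟯),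
                (Subgroup.closure {HopfGalois.r 0, HopfGalois.s 0}, k⟮d⟯)}) ∧
            (∀ R : HopfGalois.Realization e (HopfGalois.N 1) T, HopfGalois.HasGaloisTable e R
              {(Subgroup.closure {HopfGalois.t 1}, k⟮α⟯)}) ∧
            (∀ R : HopfGalois.Realization e (HopfGalois.N 2) T, HopfGalois.HasGaloisTable e R
              {(Subgroup.closure {HopfGalois.r 2, HopfGalois.t 2}, k⟮d⟯)}) ∧
            (∀ R : HopfGalois.Realization e (HopfGalois.N 3) T, HopfGalois.HasGaloisTable e R
              {(Subgroup.closure {HopfGalois.r 3, HopfGalois.t 3}, k⟮d⟯)}) := by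
  refine ⟨HopfGalois.exists_isAdmissible hG G' hG', fun φ e h => ?_⟩
  have hnorm : ∀ i, HopfGalois.IsNormalized e (HopfGalois.N i) := fun i =>
    ((h.isRegular_and_isNormalized_iff _).2 ⟨i, rfl⟩).2
  have hreg := HopfGalois.isRegular_N
  refine ⟨⟨HopfGalois.N_injective, fun i => ⟨HopfGalois.equivN i⟩,
    h.isRegular_and_isNormalized_iff⟩, ?_, fun P h2 hP hsplit => ?_⟩
  · have hfact : ∀ i, Fact (HopfGalois.IsNormalized e (HopfGalois.N i)) := fun i => ⟨hnorm i⟩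
    have R := fun i => HopfGalois.fixedRealization e (HopfGalois.N i) (hreg i)
    refine ⟨fun i => HopfGalois.fixedStructure e (HopfGalois.N i) (hreg i), fun i => ⟨R i⟩,
      fun T => ⟨?_, fun i => ⟨HopfGalois.nonempty_realization_of_isIso (R i),
        fun ⟨R'⟩ => R'.isIso (R i)⟩⟩⟩
    -- The permutation group of `T` is regular and stable, hence some `Nᵢ`, and `T` is isomorphic to
    -- the structure attached to it. Uniqueness of `i` holds because `T` determines its group.
    obtain ⟨i, hi⟩ := (h.isRegular_and_isNormalized_iff _).1
      ⟨HopfGalois.isRegular_permGroup e T, HopfGalois.isNormalized_permGroup e T⟩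
    have RT := HopfGalois.permRealization e T
    refine ⟨i, (hi ▸ RT).isIso (R i), fun j hj => ?_⟩
    obtain ⟨R'⟩ := HopfGalois.nonempty_realization_of_isIso (R j) hj
    exact HopfGalois.N_injective ((R'.eq_permGroup (hreg j)).trans hi)
  · obtain ⟨hα, hd, hpair⟩ := HopfGalois.isQuarticPair φ hG' h2 hP
    refine ⟨hα, hd, fun α d hα hd => ?_⟩
    have hq := hpair α d hα hd
    refine ⟨hq.adjoin_eq_top, hq.adjoin_ne, hq.intermediateFields_eq, fun T => ⟨fun R => ?_,
      fun R => ?_, fun R => ?_, fun R => ?_⟩⟩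
    all_goals
      refine R.hasGaloisTable (hnorm _) (hreg _) ?_ ?_
      simp only [h.isNormalized_iff]
    · rw [Set.image_pair]
      exact HopfGalois.stableSubgroups_zero
    · rintro _ (rfl | rfl)
      · exact HopfGalois.mem_adjoin_root_iff h hq hα
          (HopfGalois.closure_t_fixes (Or.inl rfl)).1 (HopfGalois.closure_t_fixes (Or.inl rfl)).2
      · exact HopfGalois.mem_adjoin_sqrt_iff h hq (HopfGalois.closure_r_s_sign rfl).1
          (HopfGalois.closure_r_s_sign rfl).2
    · rw [Set.image_singleton]
      exact HopfGalois.stableSubgroups_one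
    · rintro _ rfl
      exact HopfGalois.mem_adjoin_root_iff h hq hα
        (HopfGalois.closure_t_fixes (Or.inr rfl)).1 (HopfGalois.closure_t_fixes (Or.inr rfl)).2
    · rw [Set.image_singleton]
      exact HopfGalois.stableSubgroups_two
    · rintro _ rfl
      exact HopfGalois.mem_adjoin_sqrt_iff h hq (HopfGalois.closure_r_t_sign (Or.inl rfl)).1
        (HopfGalois.closure_r_t_sign (Or.inl rfl)).2
    · rw [Set.image_singleton]
      exact HopfGalois.stableSubgroups_three
    · rintro _ rfl
      exact HopfGalois.mem_adjoin_sqrt_iff h hq (HopfGalois.closure_r_t_sign (Or.inr rfl)).1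
        (HopfGalois.closure_r_t_sign (Or.inr rfl)).2
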